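/- Let $m\ge 2$ and let $D\subset\mathbb R^m$ be a (connected, open) domain with smooth boundary $\Sigma=\partial D$. Let $a_1,\dots,a_N\in D$ be distinct points, $A=\{a_1,\dots,a_N\}$, and let $\phi_j:S^{m-1}\to\mathbb R^m$ ($1\le j\le N$) be smooth embeddings, $\Sigma_j=\phi_j(S^{m-1})$. For $\varepsilon>0$ let $\Omega_\varepsilon=D\setminus\bigcup_j D_j$, where the scatterer $D_j$ is the body bounded by the hypersurface $a_j+\varepsilon\Sigma_j$. A *quasi-trajectory* is a billiard trajectory $\kappa=(a_i,p_1,\dots,p_n,a_j)$, $n\ge 0$, of $D$ from $a_\kappa^-=a_i\in A$ to $a_\kappa^+=a_j\in A$ (a broken line with consecutive vertices distinct, whose open segments lie in $D$, reflected elastically at $p_1,\dots,p_n\in\Sigma$) such that $n=0$ or $(p_1,\dots,p_n)$ is a nondegenerate critical point of the length function $|a_i-p_1|+|p_1-p_2|+\dots+|p_n-a_j|$ on $\Sigma^n$, and such that $\kappa$ contains no point of $A$ except at its two ends. Let $v_\kappa^-$ and $v_\kappa^+$ be the unit velocities of $\kappa$ along its first and its last segment. Let $U_\kappa^-$ (for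 $a_\kappa^-=a_i$) be the set of $x\in S^{m-1}$ such that $\phi_i(x)+tv_\kappa^-\notin\Sigma_i$ for all $t>0$, and $U_\kappa^+$ (for $a_\kappa^+=a_j$) the set of $x\in S^{m-1}$ such that $\phi_j(x)-tv_\kappa^+\notin\Sigma_j$ for all $t>0$. Let $\Gamma$ be a finite graph whose vertices are quasi-trajectories and whose edges are triples $(\kappa,\kappa',s)$, leading from the vertex $\kappa$ to the vertex $\kappa'$, with $s\in S^{m-1}$, such that 1. $a_\kappa^+=a_{\kappa'}^-=a_k$ for some $k$; 2. $v_\kappa^+\ne v_{\kappa'}^-$; 3. $s\in U_\kappa^+\cap U_{\kappa'}^-$, the vector $v=(v_{\kappa'}^--v_\kappa^+)/|v_{\kappa'}^--v_\kappa^+|$ is the outer normal to $\Sigma_k$ at $\phi_k(s)$, and the second fundamental form $\langle v,d^2\phi_k(s)\rangle$ of $\Sigma_k$ at $\phi_k(s)$ is nondegenerate. A *code* is a two-sided infinite path in $\Gamma$, that is, a sequence of edges $(\kappa_{i-1},\kappa_i,s_i)_{i\in\mathbb Z}$ of $\Gamma$. **Theorem.** There are $\varepsilon_0>0$ and $C>0$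 (depending on $D$, the $a_j$, the $\phi_j$ and $\Gamma$, but not on the code) such that for all $\varepsilon\in(0,\varepsilon_0)$ and for every code there is a billiard trajectory in $\Omega_\varepsilon$ which shadows the chain of quasi-trajectories $(\kappa_i)_{i\in\mathbb Z}$ with precision $C\varepsilon$: it is a concatenation of pieces, $i\in\mathbb Z$, where the $i$-th piece starts at a point $a_k+\varepsilon\phi_k(x_i)$ of the scatterer at $a_k=a_{\kappa_i}^-$ with $|x_i-s_i|\le C\varepsilon$, and then has, before the next piece starts, exactly one reflection point on $\Sigma$ within distance $C\varepsilon$ of each of the reflection points $p_1,\dots,p_n$ of $\kappa_i$, in this order. Moreover, this trajectory is hyperbolic as an orbit of the billiard map: along it, the tangent spaces of the phase space split into two complementary subspaces, invariant under the derivative of the billiard map, which it contracts uniformly exponentially in forward and in backward time, respectively. -/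

import Mathlib

open Set Filter Topology
open scoped ContDiff Manifold RealInnerProductSpace

noncomputable section

namespace SmallScatterers

/-- Euclidean space `ℝ^m`. -/
abbrev Euc (m : ℕ) : Type := EuclideanSpace ℝ (Fin m)

/-- The unit sphere `S^d` of `ℝ^(d+1)`. -/
abbrev Sph (d : ℕ) : Type := Metric.sphere (0 : Euc (d + 1)) 1

/-! ### Hypersurfaces and nondegenerate critical points -/

/-- `ψ` is a smooth local parametrization near `0 ∈ ℝ^d` of the hypersurface `S ⊆ ℝ^(d+1)` around
its point `q`: `ψ` is a smooth immersion near `0` with `ψ 0 = q`, and the images of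
the neighbourhoods of `0` are exactly (a basis of) the neighbourhoods of `q` in `S`. -/
structure IsLocalParam {d : ℕ} (S : Set (Euc (d + 1))) (q : Euc (d + 1))
    (ψ : Euc d → Euc (d + 1)) : Prop where
  apply_zero : ψ 0 = q
  smooth : ∀ᶠ y in 𝓝 (0 : Euc d), ContDiffAt ℝ ∞ ψ y
  immersion : Function.Injective (fderiv ℝ ψ 0)
  map_nhds : Filter.map ψ (𝓝 0) = 𝓝[S] q

/-- `v` is orthogonal to the tangent space of the hypersurface `S` at `q`. -/
def IsNormal {d : ℕ} (S : Set (Euc (d + 1))) (q v : Euc (d + 1)) : Prop :=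
  ∃ ψ : Euc d → Euc (d + 1), IsLocalParam S q ψ ∧ ∀ u : Euc d, ⟪v, fderiv ℝ ψ 0 u⟫ = 0

/-- `y` is a nondegenerate critical point of `f`: the differential of `f` at `y` vanishes and the
Hessian bilinear form at `y` has trivial kernel. -/
def IsNondegCritPt {X : Type*} [NormedAddCommGroup X] [NormedSpace ℝ X] (f : X → ℝ) (y : X) :
    Prop :=
  fderiv ℝ f y = 0 ∧ ∀ u : X, (∀ w : X, fderiv ℝ (fderiv ℝ f) y u w = 0) → u = 0

/-- `v` is normal to the hypersurface `S` at `q`, and the second fundamental form `⟨v, d²ψ⟩` of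
`S` at `q` in the direction `v` is nondegenerate. -/
def HasNondegSecondForm {d : ℕ} (S : Set (Euc (d + 1))) (q v : Euc (d + 1)) : Prop :=
  ∃ ψ : Euc d → Euc (d + 1), IsLocalParam S q ψ ∧ IsNondegCritPt (fun y => ⟪v, ψ y⟫) 0

/-- The open set `D` has smooth boundary: near each boundary point it is a sublevel set `{g < 0}`
of a smooth function `g` without critical point there. -/
def HasSmoothBoundary {m : ℕ} (D : Set (Euc m)) : Prop :=
  ∀ p ∈ frontier D, ∃ g : Euc m → ℝ, ContDiff ℝ ∞ g ∧ g p = 0 ∧ fderiv ℝ g p ≠ 0 ∧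
    ∀ᶠ x in 𝓝 p, (x ∈ D ↔ g x < 0)

/-! ### Broken lines and elastic reflection -/

/-- The unit vector pointing from `x` to `y`. -/
def dir {m : ℕ} (x y : Euc m) : Euc m := ‖y - x‖⁻¹ • (y - x)

/-- Elastic reflection from the hypersurface `S` at `q`: the incoming velocity `e` is not tangent
to `S` and the outgoing velocity `e'` is its mirror image in the tangent space of `S` at `q`. -/
def ReflectsAt {d : ℕ} (S : Set (Euc (d + 1))) (q e e' : Euc (d + 1)) : Prop :=
  ∃ ν : Euc (d + 1), ‖ν‖ = 1 ∧ IsNormal S q ν ∧ ⟪e, ν⟫ ≠ 0 ∧ e' = e - (2 * ⟪e, ν⟫) • ν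

/-- The vertices `x, p₁, …, pₙ, y` of a broken line. -/
def vertices {m n : ℕ} (x y : Euc m) (p : Fin n → Euc m) : Fin (n + 2) → Euc m :=
  Fin.cons (α := fun _ => Euc m) x (Fin.snoc (α := fun _ => Euc m) p y)

/-- The length `|x - p₁| + |p₁ - p₂| + ⋯ + |pₙ - y|` of a broken line. -/
def pathLength {m n : ℕ} (x y : Euc m) (p : Fin n → Euc m) : ℝ :=
  ∑ k : Fin (n + 1), dist (vertices x y p k.castSucc) (vertices x y p k.succ)

/-! ### Quasi-trajectories -/

/-- A quasi-trajectory `(a_i, p₁, …, pₙ, a_j)`, `i = src`, `j = tgt`: a billiard trajectory of `D`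
with reflection points `p₁, …, pₙ` on the boundary, nondegenerate, and with no point of
`A = {a₁, …, a_N}` on it except its end points. -/
structure QuasiTrajectory {d N : ℕ} (D : Set (Euc (d + 1))) (a : Fin N → Euc (d + 1)) where
  n : ℕ
  src : Fin N
  tgt : Fin N
  p : Fin n → Euc (d + 1)
  p_mem : ∀ k, p k ∈ frontier D
  ne : ∀ k : Fin (n + 1),
    vertices (a src) (a tgt) p k.castSucc ≠ vertices (a src) (a tgt) p k.succ
  segment_subset : ∀ k : Fin (n + 1),
    openSegment ℝ (vertices (a src) (a tgt) p k.castSucc) (vertices (a src) (a tgt) p k.succ) ⊆ D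
  reflects : ∀ k : Fin n, ReflectsAt (frontier D) (p k)
    (dir (vertices (a src) (a tgt) p k.castSucc.castSucc) (p k))
    (dir (p k) (vertices (a src) (a tgt) p k.succ.succ))
  /-- The critical point `(p₁, …, pₙ)` of the length function on `(∂D)ⁿ` is nondegenerate. -/
  nondegenerate : ∃ ψ : Fin n → Euc d → Euc (d + 1),
    (∀ k, IsLocalParam (frontier D) (p k) (ψ k)) ∧
    IsNondegCritPt
      (fun y : Fin n → Euc d => pathLength (a src) (a tgt) (fun k => ψ k (y k))) 0
  avoids : ∀ (k : Fin (n + 1)) (j : Fin N),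
    a j ∉ openSegment ℝ (vertices (a src) (a tgt) p k.castSucc) (vertices (a src) (a tgt) p k.succ)

namespace QuasiTrajectory

variable {d N : ℕ} {D : Set (Euc (d + 1))} {a : Fin N → Euc (d + 1)}

/-- The vertices of a quasi-trajectory, end points included. -/
def vert (κ : QuasiTrajectory D a) : Fin (κ.n + 2) → Euc (d + 1) :=
  vertices (a κ.src) (a κ.tgt) κ.p

/-- The initial velocity `v_κ^-`. -/
def vInit (κ : QuasiTrajectory D a) : Euc (d + 1) :=
  dir (κ.vert 0) (κ.vert 1)

/-- The final velocity `v_κ^+`. -/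
def vFinal (κ : QuasiTrajectory D a) : Euc (d + 1) :=
  dir (κ.vert (Fin.last κ.n).castSucc) (κ.vert (Fin.last (κ.n + 1)))

end QuasiTrajectory

/-! ### Scatterers and the billiard table -/

/-- The compact body bounded by a closed hypersurface `S`: the union of `S` and
the bounded components of its complement. -/
def bodyOf {m : ℕ} (S : Set (Euc m)) : Set (Euc m) :=
  S ∪ {x | x ∉ S ∧ Bornology.IsBounded (connectedComponentIn Sᶜ x)}

/-- `v` is an outer normal at `q` to the closed hypersurface `S`. -/
def IsOuterNormal {d : ℕ} (S : Set (Euc (d + 1))) (q v : Euc (d + 1)) : Prop :=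
  IsNormal S q v ∧ ∀ᶠ t in 𝓝[>] (0 : ℝ), q + t • v ∉ bodyOf S

section Table

variable {d N : ℕ} (D : Set (Euc (d + 1))) (a : Fin N → Euc (d + 1))
  (φ : Fin N → Sph d → Euc (d + 1)) (ε : ℝ)

/-- The boundary `a_j + ε Σ_j` of the `j`-th scatterer, where `Σ_j = φ_j(S^d)`. -/
def scattererBoundary (j : Fin N) : Set (Euc (d + 1)) :=
  range fun x : Sph d => a j + ε • φ j x

/-- The (open) billiard table `Ω_ε`, obtained from `D` by removing the closed scatterers. -/
def table : Set (Euc (d + 1)) :=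
  D \ ⋃ j, bodyOf (scattererBoundary a φ ε j)

/-- The reflecting walls `∂Ω_ε`: the boundary of `D` and the boundaries of the scatterers. -/
def walls : Set (Euc (d + 1)) :=
  frontier D ∪ ⋃ j, scattererBoundary a φ ε j

/-- The sequence `q` consists of the successive reflection points of a (two-sided infinite)
billiard trajectory in `Ω_ε`: the open segments between successive points lie in the open table
(so they do not touch the walls), and at each point the trajectory is reflected elastically. -/
structure IsBilliardTrajectory (q : ℤ → Euc (d + 1)) : Prop where
  mem_walls : ∀ n, q n ∈ walls D a φ ε
  ne : ∀ n, q n ≠ q (n + 1)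
  segment_subset : ∀ n, openSegment ℝ (q n) (q (n + 1)) ⊆ table D a φ ε
  reflects : ∀ n, ReflectsAt (walls D a φ ε) (q n) (dir (q (n - 1)) (q n)) (dir (q n) (q (n + 1)))

end Table

/-! ### The graph of quasi-trajectories -/

section Graph

variable {d N : ℕ} {D : Set (Euc (d + 1))} {a : Fin N → Euc (d + 1)}
  (φ : Fin N → Sph d → Euc (d + 1))

/-- `U_κ^-`: those `x ∈ S^d` for which the ray issuing from `φ_i(x)`, `i = src κ`, in the direction
of `v_κ^-` does not meet `Σ_i` again. -/
def startSet (κ : QuasiTrajectory D a) : Set (Sph d) :=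
  {x | ∀ t : ℝ, 0 < t → φ κ.src x + t • κ.vInit ∉ range (φ κ.src)}

/-- `U_κ^+`: those `x ∈ S^d` for which the ray coming to `φ_j(x)`, `j = tgt κ`, with the velocity
`v_κ^+` does not meet `Σ_j` before. -/
def endSet (κ : QuasiTrajectory D a) : Set (Sph d) :=
  {x | ∀ t : ℝ, 0 < t → φ κ.tgt x - t • κ.vFinal ∉ range (φ κ.tgt)}

/-- `s ∈ S^d` defines an edge of the graph from `κ` to `κ'`: the end of `κ` is the start `a_k` of
`κ'`; the direction changes; the unit vector `v` along `v_κ'^- - v_κ^+` is the outer normal of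
`Σ_k` at `φ_k(s)`, with `s ∈ U_κ^+ ∩ U_κ'^-`; and the second fundamental form of `Σ_k` at
`φ_k(s)` is nondegenerate. -/
structure IsEdge (κ κ' : QuasiTrajectory D a) (s : Sph d) : Prop where
  tgt_eq_src : κ.tgt = κ'.src
  direction_change : κ.vFinal ≠ κ'.vInit
  outer_normal : IsOuterNormal (range (φ κ.tgt)) (φ κ.tgt s) (dir κ.vFinal κ'.vInit)
  mem_endSet : s ∈ endSet φ κ
  mem_startSet : s ∈ startSet φ κ'
  curvature : HasNondegSecondForm (range (φ κ.tgt)) (φ κ.tgt s) (dir κ.vFinal κ'.vInit)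

/-- A code: a two-sided infinite path in the graph with edge set `E`. The `i`-th edge joins
`κ (i - 1)` to `κ i` and carries the point `s i`. -/
def IsCode (E : Set (QuasiTrajectory D a × QuasiTrajectory D a × Sph d))
    (κ : ℤ → QuasiTrajectory D a) (s : ℤ → Sph d) : Prop :=
  ∀ i, (κ (i - 1), κ i, s i) ∈ E

/-- The trajectory with reflection points `q` shadows the code `(κ, s)` with precision `δ`: it is
a concatenation of pieces (the `i`-th piece starting at the reflection number `t i`), the
`i`-th of which starts on the scatterer at `a_(src (κ i))` at a point with parameter `δ`-close
to `s i`, and then has one reflection in the `δ`-neighbourhood of every reflection point of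
`κ i`, in the same order, before the next piece starts. -/
def Shadows (ε δ : ℝ) (κ : ℤ → QuasiTrajectory D a) (s : ℤ → Sph d) (q : ℤ → Euc (d + 1)) :
    Prop :=
  ∃ (t : ℤ → ℤ) (x : ℤ → Sph d), ∀ i,
    t (i + 1) = t i + (κ i).n + 1 ∧
    q (t i) = a (κ i).src + ε • φ (κ i).src (x i) ∧
    dist (x i) (s i) ≤ δ ∧
    ∀ k : Fin (κ i).n, q (t i + (k : ℕ) + 1) ∈ frontier D ∧
      dist (q (t i + (k : ℕ) + 1)) ((κ i).p k) ≤ δ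

end Graph

/-! ### Hyperbolicity -/

/-- The linearization at `0` of the equation
`∂_y (|ψ₀(x) - ψ₁(y)| + |ψ₁(y) - ψ₂(z)|) = 0`
for three successive reflection points `ψ₀(x), ψ₁(y), ψ₂(z)`, applied to `(u, w, r)`. -/
def VariationalEq {d : ℕ} (ψ₀ ψ₁ ψ₂ : Euc d → Euc (d + 1)) (u w r : Euc d) : Prop :=
  fderiv ℝ
    (fun X : Euc d × Euc d × Euc d =>
      fderiv ℝ (fun y : Euc d => dist (ψ₀ X.1) (ψ₁ y) + dist (ψ₁ y) (ψ₂ X.2.2)) X.2.1)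
    0 (u, w, r) = 0

/-- The billiard trajectory with reflection points `q` on the hypersurface `S` is (uniformly)
hyperbolic as an orbit of the billiard map `(q₀, q₁) ↦ (q₁, q₂)`.

Here `ψ n` is a parametrization of `S` near `q n`; in these coordinates a tangent vector
of the phase space at the `n`-th point of the orbit is a pair `ξ ∈ ℝ^d × ℝ^d` (variations of `q n`
and of `q (n + 1)`), and `T n` is the derivative of the billiard map there. Tangent
vectors are measured by the Euclidean norms of the variations of the points in `ℝ^(d+1)`.
Hyperbolicity is the existence of an invariant splitting into subspaces `Es n`, `Eu n`,
uniformly exponentially contracted in forward, respectively backward, time. -/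
def IsHyperbolic {d : ℕ} (S : Set (Euc (d + 1))) (q : ℤ → Euc (d + 1)) : Prop :=
  ∃ (ψ : ℤ → Euc d → Euc (d + 1)) (T : ℤ → (Euc d × Euc d) ≃ₗ[ℝ] (Euc d × Euc d))
    (Es Eu : ℤ → Submodule ℝ (Euc d × Euc d)) (C θ : ℝ),
    (∀ n, IsLocalParam S (q n) (ψ n)) ∧
    (∀ n ξ η, T n ξ = η ↔
      η.1 = ξ.2 ∧ VariationalEq (ψ n) (ψ (n + 1)) (ψ (n + 2)) ξ.1 ξ.2 η.2) ∧
    0 < θ ∧ θ < 1 ∧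
    (∀ n, IsCompl (Es n) (Eu n)) ∧
    (∀ n, (Es n).map (T n).toLinearMap = Es (n + 1)) ∧
    (∀ n, (Eu n).map (T n).toLinearMap = Eu (n + 1)) ∧
    let size : ℤ → Euc d × Euc d → ℝ := fun n ξ =>
      ‖fderiv ℝ (ψ n) 0 ξ.1‖ + ‖fderiv ℝ (ψ (n + 1)) 0 ξ.2‖
    ∀ ξ : ℤ → Euc d × Euc d, (∀ n, ξ (n + 1) = T n (ξ n)) → ∀ (n : ℤ) (k : ℕ),
      (ξ n ∈ Es n → size (n + k) (ξ (n + k)) ≤ C * θ ^ k * size n (ξ n)) ∧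
      (ξ n ∈ Eu n → size (n - k) (ξ (n - k)) ≤ C * θ ^ k * size n (ξ n))

end SmallScatterers

end

/-! This is an anti-integrable limit argument. A trajectory is sought through its reflection points,
each written in a chart near its limit position: a wall point as `ψ y`, a scatterer point as `a_j +
ε ψ y`. The law of reflection at the `n`-th point says that the derivative of the length in `y n`
vanishes. At a scatterer this derivative carries a factor `ε`; after division by it the equation
`mirror` is smooth up to `ε = 0` and involves only `y (n-1), y n, y (n+1)`.

At `ε = 0` a scatterer is a point, so its position no longer depends on its parameter. The equations
at the walls met by one quasi-trajectory then close up: they are the critical point equations of its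
length, with invertible Hessian. At a scatterer with the adjacent wall points fixed, there remains
the critical point equation of `⟨v, φ⟩`, whose Hessian is the second fundamental form. The
linearization over the whole code is therefore block triangular with invertible diagonal blocks,
hence invertible in the supremum norm (`uniformlyInvertible_of_blocks`,
`IsChain.uniformlyInvertible`). The graph is finite, so the bounds do not depend on the code.

A contraction argument on sequences (`exists_zero_of_approx_linear`) continues the solution `y = 0`
of the limit problem to a zero of size `O(ε)`. Transversality, segments inside `D`, avoidance of `A`
and the conditions defining `U_κ^±` persist under perturbation, so the zero is a genuine billiard
trajectory (`IsLimitTriple.eventually_good`, `isBilliardTrajectory_of_good`).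

Hyperbolicity comes from the same linear bound. The variational equation along the trajectory is a
small perturbation of a uniformly invertible tridiagonal operator. Invertibility survives in
exponentially weighted norms, so half-bounded solutions decay exponentially; those bounded in the
future and those bounded in the past span complementary spaces
(`UniformlyInvertible.exists_dichotomy`). -/

namespace SmallScatterers

/-! ### Uniformly invertible tridiagonal operators on sequences -/

section Sequences

variable {V W : Type*} [NormedAddCommGroup V] [NormedSpace ℝ V] [NormedAddCommGroup W]
  [NormedSpace ℝ W]

/-- A map between spaces of sequences which is close, in the supremum norm, to an invertible linear
map has a zero close to the origin. -/
theorem exists_zero_of_approx_linear [CompleteSpace V] {ι : Type*} (L : (ι → V) →ₗ[ℝ] (ι → W))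
    {K : ℝ} (hK : 0 ≤ K) (hL : ∀ u c, (∀ n, ‖L u n‖ ≤ c) → ∀ n, ‖u n‖ ≤ K * c)
    (hs : Function.Surjective L) (F : (ι → V) → ι → W) {r δ c : ℝ}
    (hF : ∀ x y s, (∀ n, ‖x n‖ ≤ r) → (∀ n, ‖y n‖ ≤ r) → (∀ n, ‖x n - y n‖ ≤ s) →
      ∀ n, ‖F x n - F y n - L (x - y) n‖ ≤ δ * s)
    (hF0 : ∀ n, ‖F 0 n‖ ≤ c) (hc : 0 ≤ c) (hKδ : K * δ ≤ 1 / 2) (hr : 2 * K * c ≤ r) :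
    ∃ x : ι → V, (∀ n, ‖x n‖ ≤ 2 * K * c) ∧ F x = 0 := by
  choose G hG using hs
  -- Newton iteration with frozen derivative. The right inverse `G` need not be linear: `L (Φ x - Φ
  -- y)` involves only `L ∘ G`, and `hL` then makes `Φ` contract by `K * δ ≤ 1 / 2`.
  set Φ : (ι → V) → ι → V := fun x => x - G (F x) with hΦ
  have hKc : 0 ≤ K * c := by positivity
  have step : ∀ x y s, 0 ≤ s → (∀ n, ‖x n‖ ≤ r) → (∀ n, ‖y n‖ ≤ r) → (∀ n, ‖x n - y n‖ ≤ s) →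
      ∀ n, ‖Φ x n - Φ y n‖ ≤ s / 2 := by
    intro x y s hs0 hx hy hxy n
    have h1 := hL (Φ x - Φ y) (δ * s) (fun n => by
      have h2 := hF x y s hx hy hxy n
      have h3 : L (Φ x - Φ y) = L (x - y) - (F x - F y) := by
        simp only [hΦ, map_sub, hG]; abel
      rw [h3, ← norm_neg]
      simpa using h2) n
    calc _ ≤ K * (δ * s) := h1
      _ = K * δ * s := by ring
      _ ≤ 1 / 2 * s := by gcongr
      _ = s / 2 := by ring
  let x : ℕ → ι → V := fun k => Φ^[k] 0
  have hx_succ : ∀ k, x (k + 1) = Φ (x k) := fun k => Function.iterate_succ_apply' _ _ _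
  have hx1 : ∀ n, ‖x 1 n - x 0 n‖ ≤ K * c := by
    intro n
    refine hL (x 1 - x 0) c (fun n => ?_) n
    have : L (x 1 - x 0) = - F 0 := by
      simp [x, hΦ, hG]
    rw [this]
    simpa using hF0 n
  -- The first step has size at most `K * c` and the bound halves at each step, so the iterates stay
  -- in the ball of radius `2 * K * c ≤ r` where `hF` applies.
  have key : ∀ k, (∀ n, ‖x k n‖ ≤ 2 * K * c * (1 - 1 / 2 ^ k)) ∧
      ∀ n, ‖x (k + 1) n - x k n‖ ≤ K * c / 2 ^ k := by
    intro k
    induction k with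
    | zero => exact ⟨fun n => by simp [x], fun n => by simpa using hx1 n⟩
    | succ k ih =>
      have hle : ∀ j : ℕ, 2 * K * c * (1 - 1 / 2 ^ j) ≤ r := fun j => by
        refine le_trans ?_ hr
        have : (0 : ℝ) ≤ 1 / 2 ^ j := by positivity
        nlinarith
      have hA : ∀ n, ‖x (k + 1) n‖ ≤ 2 * K * c * (1 - 1 / 2 ^ (k + 1)) := by
        intro n
        calc ‖x (k + 1) n‖ = ‖x k n + (x (k + 1) n - x k n)‖ := by congr 1; abel
          _ ≤ ‖x k n‖ + ‖x (k + 1) n - x k n‖ := norm_add_le _ _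
          _ ≤ 2 * K * c * (1 - 1 / 2 ^ k) + K * c / 2 ^ k := add_le_add (ih.1 n) (ih.2 n)
          _ = _ := by rw [pow_succ]; field_simp; ring
      refine ⟨hA, fun n => ?_⟩
      have := step (x (k + 1)) (x k) (K * c / 2 ^ k) (by positivity)
        (fun n => (hA n).trans (hle _)) (fun n => (ih.1 n).trans (hle _)) ih.2 n
      rw [hx_succ (k + 1)]
      nth_rewrite 2 [hx_succ k]
      refine this.trans (le_of_eq ?_)
      rw [pow_succ]; field_simp
  have hd : ∀ n k, dist (x k n) (x (k + 1) n) ≤ (2 * K * c) / 2 / 2 ^ k := by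
    intro n k
    rw [dist_comm, dist_eq_norm]
    refine ((key k).2 n).trans (le_of_eq ?_)
    field_simp
  -- The limit is taken index by index; the estimates are uniform in the index, so only completeness
  -- of `V` is used.
  choose y hy using fun n => cauchySeq_tendsto_of_complete (cauchySeq_of_le_geometric_two (hd n))
  have hyk : ∀ n k, dist (x k n) (y n) ≤ 2 * K * c / 2 ^ k := fun n k =>
    dist_le_of_le_geometric_two_of_tendsto (hd n) (hy n) k
  have hyb : ∀ n, ‖y n‖ ≤ 2 * K * c := by
    intro n
    have := hyk n 0
    simpa [x] using this
  refine ⟨y, hyb, ?_⟩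
  have hfix : Φ y = y := by
    funext n
    have h1 : ∀ k : ℕ, ‖Φ y n - y n‖ ≤ 2 * K * c / 2 ^ k := by
      intro k
      have h2 := step y (x k) (2 * K * c / 2 ^ k) (by positivity) (fun n => (hyb n).trans hr)
        (fun n => ((key k).1 n).trans (by
          refine le_trans ?_ hr
          have : (0 : ℝ) ≤ 1 / 2 ^ k := by positivity
          nlinarith)) (fun n => by
          rw [← dist_eq_norm, dist_comm]; exact hyk n k) n
      rw [← hx_succ k] at h2
      have h3 := hyk n (k + 1)
      rw [dist_eq_norm] at h3
      calc ‖Φ y n - y n‖ = ‖(Φ y n - x (k + 1) n) + (x (k + 1) n - y n)‖ := by congr 1; abel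
        _ ≤ _ := norm_add_le _ _
        _ ≤ 2 * K * c / 2 ^ k / 2 + 2 * K * c / 2 ^ (k + 1) := add_le_add h2 h3
        _ = _ := by rw [pow_succ]; field_simp; ring
    have h4 : Tendsto (fun k : ℕ => 2 * K * c / 2 ^ k) atTop (𝓝 0) := by
      have := (tendsto_pow_atTop_nhds_zero_of_lt_one (r := (1 / 2 : ℝ)) (by norm_num)
        (by norm_num)).const_mul (2 * K * c)
      simpa [div_eq_mul_inv] using this
    have h5 := ge_of_tendsto' h4 h1
    exact sub_eq_zero.1 (norm_le_zero_iff.1 h5)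
  have h6 : G (F y) = 0 := by
    have : y - G (F y) = y := hfix
    simpa using this
  rw [← hG (F y), h6, map_zero]

/-- The tridiagonal linear operator with the rows `A n`. -/
def tridiag (A : ℤ → V × V × V →L[ℝ] W) : (ℤ → V) →ₗ[ℝ] (ℤ → W) where
  toFun u n := A n (u (n - 1), u n, u (n + 1))
  map_add' u v := by
    funext n
    exact map_add (A n) (u (n - 1), u n, u (n + 1)) (v (n - 1), v n, v (n + 1))
  map_smul' c u := by
    funext n
    exact map_smul (A n) c (u (n - 1), u n, u (n + 1))

theorem tridiag_apply (A : ℤ → V × V × V →L[ℝ] W) (u : ℤ → V) (n : ℤ) :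
    tridiag A u n = A n (u (n - 1), u n, u (n + 1)) := rfl

theorem norm_triple_le {V : Type*} [NormedAddCommGroup V] {a b c : V} {B : ℝ}
    (ha : ‖a‖ ≤ B) (hb : ‖b‖ ≤ B) (hc : ‖c‖ ≤ B) :
    ‖((a, b, c) : V × V × V)‖ ≤ B := by
  simp only [Prod.norm_def, sup_le_iff]
  exact ⟨ha, hb, hc⟩

/-- A tridiagonal operator which is uniformly invertible on bounded sequences. -/
structure UniformlyInvertible (A : ℤ → V × V × V →L[ℝ] W) (K : ℝ) : Prop where
  nonneg : 0 ≤ K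
  bound : ∀ u c, (∀ n, ‖tridiag A u n‖ ≤ c) → ∀ n, ‖u n‖ ≤ K * c
  surj : Function.Surjective (tridiag A)

variable {A₀ A : ℤ → V × V × V →L[ℝ] W} {K δ M : ℝ}

/-- For a solution, `A₀ u = -(A - A₀) u`, so any bound on `u` improves by the factor `K * δ ≤ 1 /
4`; iterate. Boundedness is essential, since the homogeneous equation may have unbounded solutions.
-/
theorem UniformlyInvertible.eq_zero (h : UniformlyInvertible A₀ K) (hδ : ∀ n, ‖A n - A₀ n‖ ≤ δ)
    (hKδ : K * δ ≤ 1 / 4) {u : ℤ → V} {B : ℝ} (hB : ∀ n, ‖u n‖ ≤ B) (hu : tridiag A u = 0) :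
    u = 0 := by
  have hB0 : 0 ≤ B := (norm_nonneg _).trans (hB 0)
  have step : ∀ k : ℕ, ∀ n, ‖u n‖ ≤ B / 4 ^ k := by
    intro k
    induction k with
    | zero => simpa using hB
    | succ k ih =>
      intro n
      have := h.bound u (δ * (B / 4 ^ k)) (fun n => by
        have h1 : tridiag A₀ u n = - ((A n - A₀ n) (u (n - 1), u n, u (n + 1))) := by
          have h2 : A n (u (n - 1), u n, u (n + 1)) = 0 := congrFun hu n
          rw [sub_apply, h2, tridiag_apply]; simp
        rw [h1, norm_neg]
        exact (ContinuousLinearMap.le_opNorm _ _).trans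
          (mul_le_mul (hδ n) (norm_triple_le (ih _) (ih _) (ih _)) (norm_nonneg _)
            ((norm_nonneg _).trans (hδ n)))) n
      calc _ ≤ K * (δ * (B / 4 ^ k)) := this
        _ = K * δ * (B / 4 ^ k) := by ring
        _ ≤ 1 / 4 * (B / 4 ^ k) := by gcongr
        _ = _ := by rw [pow_succ]; field_simp
  funext n
  have h4 : Tendsto (fun k : ℕ => B / 4 ^ k) atTop (𝓝 0) := by
    have := (tendsto_pow_atTop_nhds_zero_of_lt_one (r := (1 / 4 : ℝ)) (by norm_num)
      (by norm_num)).const_mul B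
    simpa [div_eq_mul_inv] using this
  exact norm_le_zero_iff.1 (ge_of_tendsto' h4 fun k => step k n)

/-- Solution of a perturbed tridiagonal equation in a weighted space of sequences. -/
theorem UniformlyInvertible.exists_weighted [CompleteSpace V] (h : UniformlyInvertible A₀ K)
    (hδ : ∀ n, ‖A n - A₀ n‖ ≤ δ) (hKδ : K * δ ≤ 1 / 4) (hM : ∀ n, ‖A n‖ ≤ M) {μ : ℝ}
    (hKM : K * (M * μ) ≤ 1 / 4) {ρ : ℤ → ℝ} (hρ : ∀ n, 0 < ρ n)
    (hρ1 : ∀ n, |ρ (n + 1) / ρ n - 1| ≤ μ) (hρ2 : ∀ n, |ρ (n - 1) / ρ n - 1| ≤ μ)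
    {f : ℤ → W} {c : ℝ} (hc : 0 ≤ c) (hf : ∀ n, ‖f n‖ ≤ c * ρ n) :
    ∃ u : ℤ → V, tridiag A u = f ∧ ∀ n, ‖u n‖ ≤ 2 * K * c * ρ n := by
  have hμ : 0 ≤ μ := (abs_nonneg _).trans (hρ1 0)
  have hM0 : 0 ≤ M := (norm_nonneg _).trans (hM 0)
  -- Put `u = ρ x`. The conjugated operator `ρ⁻¹ A ρ` differs from `A₀` by at most `δ` from the
  -- coefficients and `M * μ` from the ratios of neighbouring weights; together they use up the
  -- budget `1 / 2`.
  obtain ⟨x, hx, hxF⟩ := exists_zero_of_approx_linear (tridiag A₀) h.nonneg h.bound h.surj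
    (fun x n => (ρ n)⁻¹ • (tridiag A (fun k => ρ k • x k) n - f n)) (r := 2 * K * c)
    (δ := δ + M * μ) (c := c) (by
      intro x y s _ _ hxy n
      have hs : 0 ≤ s := (norm_nonneg _).trans (hxy 0)
      set z := x - y with hz
      have hz' : ∀ n, ‖z n‖ ≤ s := hxy
      have e1 : (ρ n)⁻¹ • (tridiag A (fun k => ρ k • x k) n - f n) -
          (ρ n)⁻¹ • (tridiag A (fun k => ρ k • y k) n - f n) - tridiag A₀ (x - y) n
          = (A n - A₀ n) (z (n - 1), z n, z (n + 1)) +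
            A n ((ρ (n - 1) / ρ n - 1) • z (n - 1), 0, (ρ (n + 1) / ρ n - 1) • z (n + 1)) := by
        rw [← smul_sub, sub_sub_sub_cancel_right, tridiag_apply, tridiag_apply, tridiag_apply,
          ← map_sub, ← map_smul, sub_apply, sub_add_eq_add_sub, ← map_add]
        have hne := (hρ n).ne'
        congr 2
        simp only [Prod.mk_sub_mk, Prod.smul_mk, Prod.mk_add_mk, hz, Pi.sub_apply, ← smul_sub,
          smul_smul, sub_smul, one_smul, div_eq_inv_mul, inv_mul_cancel₀ hne]
        simp
      rw [e1]
      refine (norm_add_le _ _).trans ?_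
      rw [add_mul]
      refine add_le_add ?_ ?_
      · exact (ContinuousLinearMap.le_opNorm _ _).trans
          (mul_le_mul (hδ n) (norm_triple_le (hz' _) (hz' _) (hz' _)) (norm_nonneg _)
            ((norm_nonneg _).trans (hδ n)))
      · refine (ContinuousLinearMap.le_opNorm _ _).trans ?_
        rw [mul_assoc]
        refine mul_le_mul (hM n) (norm_triple_le ?_ ?_ ?_) (norm_nonneg _) hM0
        · rw [norm_smul]
          exact mul_le_mul (hρ2 n) (hz' _) (norm_nonneg _) hμ
        · rw [norm_zero]; positivity
        · rw [norm_smul]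
          exact mul_le_mul (hρ1 n) (hz' _) (norm_nonneg _) hμ) (by
      intro n
      have : tridiag A (fun k => ρ k • (0 : ℤ → V) k) n = 0 := by
        rw [tridiag_apply]
        simp only [Pi.zero_apply, smul_zero]
        exact map_zero (A n)
      rw [this, zero_sub, norm_smul, norm_neg, norm_inv, Real.norm_of_nonneg (hρ n).le,
        inv_mul_le_iff₀ (hρ n), mul_comm]
      exact hf n) hc (by rw [mul_add]; linarith) le_rfl
  refine ⟨fun k => ρ k • x k, ?_, fun n => ?_⟩
  · funext n
    have := congrFun hxF n
    simp only [Pi.zero_apply, smul_eq_zero, inv_eq_zero, (hρ n).ne', false_or] at this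
    exact sub_eq_zero.1 this
  · rw [norm_smul, Real.norm_of_nonneg (hρ n).le, mul_comm]
    exact mul_le_mul_of_nonneg_right (hx n) (hρ n).le

theorem UniformlyInvertible.exists_bounded [CompleteSpace V] (h : UniformlyInvertible A₀ K)
    (hδ : ∀ n, ‖A n - A₀ n‖ ≤ δ) (hKδ : K * δ ≤ 1 / 4) (hM : ∀ n, ‖A n‖ ≤ M)
    {f : ℤ → W} {c : ℝ} (hf : ∀ n, ‖f n‖ ≤ c) :
    ∃ u : ℤ → V, tridiag A u = f ∧ ∀ n, ‖u n‖ ≤ 2 * K * c := by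
  simpa using h.exists_weighted (μ := 0) (ρ := fun _ => 1) hδ hKδ hM (by simp) (by simp) (by simp)
    (by simp) ((norm_nonneg _).trans (hf 0)) (by simpa using hf)

/-- Neighbouring weights have ratio `θ` or `θ⁻¹`, and `1 - θ ≤ θ⁻¹ - 1` because `θ + θ⁻¹ ≥ 2`. -/
theorem abs_exp_weight_ratio {θ : ℝ} (h0 : 0 < θ) (h1 : θ < 1) (m n : ℤ) :
    |θ ^ (n + 1 - m).natAbs / θ ^ (n - m).natAbs - 1| ≤ θ⁻¹ - 1 ∧
    |θ ^ (n - 1 - m).natAbs / θ ^ (n - m).natAbs - 1| ≤ θ⁻¹ - 1 := by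
  have key : ∀ i j : ℕ, i = j + 1 ∨ j = i + 1 → |θ ^ i / θ ^ j - 1| ≤ θ⁻¹ - 1 := by
    have hinv : 1 < θ⁻¹ := (one_lt_inv₀ h0).2 h1
    rintro i j (rfl | rfl)
    · rw [pow_succ, mul_div_cancel_left₀ _ (by positivity), abs_sub_comm, abs_of_pos (by linarith)]
      have : θ + θ⁻¹ - 2 = (1 - θ) ^ 2 * θ⁻¹ := by field_simp; ring
      nlinarith [sq_nonneg (1 - θ), inv_pos.2 h0, mul_nonneg (sq_nonneg (1 - θ)) (inv_pos.2 h0).le]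
    · rw [pow_succ, div_mul_eq_div_div, div_self (by positivity), one_div,
        abs_of_pos (by linarith)]
  exact ⟨key _ _ (by omega), key _ _ (by omega)⟩

/-- Exponential localization of bounded solutions of tridiagonal equations. -/
theorem UniformlyInvertible.exp_decay [CompleteSpace V] (h : UniformlyInvertible A₀ K)
    (hδ : ∀ n, ‖A n - A₀ n‖ ≤ δ) (hKδ : K * δ ≤ 1 / 4) (hM : ∀ n, ‖A n‖ ≤ M) {θ : ℝ}
    (h0 : 0 < θ) (h1 : θ < 1) (hKM : K * (M * (θ⁻¹ - 1)) ≤ 1 / 4) (m : ℤ) {u : ℤ → V} {B c : ℝ}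
    (hB : ∀ n, ‖u n‖ ≤ B) (hc : 0 ≤ c) (hu : ∀ n, ‖tridiag A u n‖ ≤ c * θ ^ (n - m).natAbs)
    (n : ℤ) : ‖u n‖ ≤ 2 * K * c * θ ^ (n - m).natAbs := by
  obtain ⟨v, hv, hvb⟩ := h.exists_weighted hδ hKδ hM hKM
    (ρ := fun n => θ ^ (n - m).natAbs) (fun n => by positivity)
    (fun n => (abs_exp_weight_ratio h0 h1 m n).1) (fun n => (abs_exp_weight_ratio h0 h1 m n).2)
    hc hu
  have hvB : ∀ n, ‖v n‖ ≤ 2 * K * c := fun n => (hvb n).trans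
    (mul_le_of_le_one_right (by have := h.nonneg; positivity) (pow_le_one₀ h0.le h1.le))
  -- The localized solution `v` is bounded because the weights are at most `1`; uniqueness among
  -- bounded sequences identifies it with `u`.
  have h2 : u - v = 0 := h.eq_zero hδ hKδ (B := B + 2 * K * c)
    (fun n => (norm_sub_le _ _).trans (add_le_add (hB n) (hvB n))) (by rw [map_sub, hv, sub_self])
  have h3 : u = v := sub_eq_zero.1 h2
  rw [h3]; exact hvb n

end Sequences

/-! ### Exponential dichotomy for the transfer maps of a three-term recurrence -/

section Dichotomy

variable {V W : Type*} [NormedAddCommGroup V] [NormedSpace ℝ V] [NormedAddCommGroup W]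
  [NormedSpace ℝ W]

theorem exists_orbit {X : Type*} (T : ℤ → X ≃ X) (n : ℤ) (x : X) :
    ∃ ξ : ℤ → X, ξ n = x ∧ ∀ k, ξ (k + 1) = T k (ξ k) := by
  let f : ℕ → X := fun j => Nat.rec x (fun i y => T (n + i) y) j
  let g : ℕ → X := fun j => Nat.rec x (fun i y => (T (n - i - 1)).symm y) j
  refine ⟨fun k => if n ≤ k then f (k - n).toNat else g (n - k).toNat, by simp [f], fun k => ?_⟩
  rcases le_or_gt n k with h | h
  · obtain ⟨j, rfl⟩ : ∃ j : ℕ, k = n + j := ⟨(k - n).toNat, by omega⟩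
    have h1 : (n + (j : ℤ) + 1 - n).toNat = j + 1 := by omega
    have h2 : (n + (j : ℤ) - n).toNat = j := by omega
    simp only [if_pos h, if_pos (show n ≤ n + (j : ℤ) + 1 by omega), h1, h2, f]
  · obtain ⟨j, rfl⟩ : ∃ j : ℕ, k = n - j - 1 := ⟨(n - k - 1).toNat, by omega⟩
    have h2 : (n - (n - (j : ℤ) - 1)).toNat = j + 1 := by omega
    have h3 : n - (j : ℤ) - 1 + 1 = n - j := by ring
    simp only [if_neg (not_le.2 h), h2, h3]
    rcases Nat.eq_zero_or_pos j with rfl | hj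
    · simp [f, g]
    · have h1 : (n - (n - (j : ℤ))).toNat = j := by omega
      rw [if_neg (by omega), h1]
      simp [g]

theorem orbit_unique {X : Type*} (T : ℤ → X ≃ X) {ξ η : ℤ → X} (hξ : ∀ k, ξ (k + 1) = T k (ξ k))
    (hη : ∀ k, η (k + 1) = T k (η k)) {n : ℤ} (h : ξ n = η n) (k : ℤ) : ξ k = η k := by
  refine Int.inductionOn' (motive := fun k => ξ k = η k) k n h (fun k _ ih => ?_) fun k _ ih => ?_
  · rw [hξ, hη, ih]
  · have h1 := hξ (k - 1)
    have h2 := hη (k - 1)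
    rw [sub_add_cancel] at h1 h2
    exact (T (k - 1)).injective (by rw [← h1, ← h2, ih])

variable (A : ℤ → V × V × V →L[ℝ] W)

/-- Initial data `(u n, u (n + 1))` of the solutions of `tridiag A u = 0` which are bounded along
the set of indices `s`. -/
def boundedData (s : Set ℤ) (n : ℤ) : Submodule ℝ (V × V) where
  carrier := {ξ | ∃ u : ℤ → V, tridiag A u = 0 ∧ u n = ξ.1 ∧ u (n + 1) = ξ.2 ∧
    ∃ B, ∀ k ∈ s, ‖u k‖ ≤ B}
  add_mem' := by
    rintro ξ η ⟨u, hu, h1, h2, B, hB⟩ ⟨v, hv, h3, h4, B', hB'⟩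
    exact ⟨u + v, by rw [map_add, hu, hv, add_zero], by simp [h1, h3], by simp [h2, h4], B + B',
      fun k hk => (norm_add_le _ _).trans (add_le_add (hB k hk) (hB' k hk))⟩
  zero_mem' := ⟨0, map_zero _, rfl, rfl, 0, by simp⟩
  smul_mem' := by
    rintro c ξ ⟨u, hu, h1, h2, B, hB⟩
    refine ⟨c • u, by rw [map_smul, hu, smul_zero], by simp [h1], by simp [h2], ‖c‖ * B,
      fun k hk => ?_⟩
    rw [Pi.smul_apply, norm_smul]
    exact mul_le_mul_of_nonneg_left (hB k hk) (norm_nonneg _)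

variable {A}
variable {T : ℤ → (V × V) ≃ₗ[ℝ] (V × V)}

/-- Index shift: the map `T n`, from the pair at `n, n + 1` to the pair at `n + 1, n + 2`, encodes
row `n + 1`. -/
theorem orbit_iff_tridiag
    (hT : ∀ n ξ η, T n ξ = η ↔ η.1 = ξ.2 ∧ A (n + 1) (ξ.1, ξ.2, η.2) = 0) {u : ℤ → V} :
    tridiag A u = 0 ↔ ∀ n, (u (n + 1), u (n + 1 + 1)) = T n (u n, u (n + 1)) := by
  constructor
  · intro h n
    refine ((hT n _ _).2 ⟨rfl, ?_⟩).symm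
    have := congrFun h (n + 1)
    rwa [tridiag_apply, add_sub_cancel_right] at this
  · intro h
    funext n
    have := ((hT (n - 1) _ _).1 (h (n - 1)).symm).2
    rw [sub_add_cancel] at this
    exact this

theorem exists_solution
    (hT : ∀ n ξ η, T n ξ = η ↔ η.1 = ξ.2 ∧ A (n + 1) (ξ.1, ξ.2, η.2) = 0)
    {ξ : ℤ → V × V} (hξ : ∀ n, ξ (n + 1) = T n (ξ n)) :
    tridiag A (fun n => (ξ n).1) = 0 ∧ ∀ n, ξ n = ((ξ n).1, (ξ (n + 1)).1) := by
  have h : ∀ n, ξ n = ((ξ n).1, (ξ (n + 1)).1) := fun n => by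
    have := ((hT n _ _).1 (hξ n).symm).1
    rw [this]
  refine ⟨(orbit_iff_tridiag hT).2 fun n => ?_, h⟩
  rw [← h, ← h, hξ]

theorem solution_unique
    (hT : ∀ n ξ η, T n ξ = η ↔ η.1 = ξ.2 ∧ A (n + 1) (ξ.1, ξ.2, η.2) = 0) {u v : ℤ → V}
    (hu : tridiag A u = 0) (hv : tridiag A v = 0) {n : ℤ} (h0 : u n = v n)
    (h1 : u (n + 1) = v (n + 1)) : u = v := by
  funext k
  have := orbit_unique (fun n => (T n).toEquiv) (ξ := fun n => (u n, u (n + 1)))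
    (η := fun n => (v n, v (n + 1))) ((orbit_iff_tridiag hT).1 hu) ((orbit_iff_tridiag hT).1 hv)
    (n := n) (by simp [h0, h1]) k
  exact congrArg Prod.fst this

/-- Boundedness along `s` and along `t` is the same condition, since up to one index each set is
contained in the other. -/
theorem map_boundedData
    (hT : ∀ n ξ η, T n ξ = η ↔ η.1 = ξ.2 ∧ A (n + 1) (ξ.1, ξ.2, η.2) = 0) {s t : Set ℤ}
    (n : ℤ) {a b : ℤ} (hst : s \ {a} ⊆ t) (hts : t \ {b} ⊆ s) :
    (boundedData A s n).map (T n).toLinearMap = boundedData A t (n + 1) := by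
  have aux : ∀ (s t : Set ℤ) (m : ℤ), s \ {m} ⊆ t → ∀ u : ℤ → V, (∃ B, ∀ k ∈ t, ‖u k‖ ≤ B) →
      ∃ B, ∀ k ∈ s, ‖u k‖ ≤ B := by
    rintro s t m hst u ⟨B, hB⟩
    refine ⟨max B ‖u m‖, fun k hk => ?_⟩
    rcases eq_or_ne k m with rfl | hkm
    · exact le_max_right _ _
    · exact (hB k (hst ⟨hk, hkm⟩)).trans (le_max_left _ _)
  apply le_antisymm
  · rintro _ ⟨ξ, ⟨u, hu, h1, h2, hB⟩, rfl⟩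
    have h3 := (orbit_iff_tridiag hT).1 hu n
    rw [h1, h2] at h3
    exact ⟨u, hu, by rw [h2]; exact congrArg Prod.fst h3, congrArg Prod.snd h3,
      aux t s _ hts u hB⟩
  · rintro η ⟨u, hu, h1, h2, hB⟩
    have h3 := (orbit_iff_tridiag hT).1 hu n
    exact ⟨(u n, u (n + 1)), ⟨u, hu, rfl, rfl, aux s t _ hst u hB⟩, by
      rw [LinearEquiv.coe_coe, ← h3, h1, h2]⟩

variable {A₀ : ℤ → V × V × V →L[ℝ] W} {K δ M : ℝ}

/-- Cut the solution off before `n`. The truncated sequence is bounded and its image lives on the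
rows `n - 1` and `n`, with size at most `M` times the initial data, so `exp_decay` applies. The
factor `θ⁻¹` pays for row `n - 1` lying at distance `1` from the centre `n`. -/
theorem UniformlyInvertible.forward_bound [CompleteSpace V] (h : UniformlyInvertible A₀ K)
    (hδ : ∀ n, ‖A n - A₀ n‖ ≤ δ) (hKδ : K * δ ≤ 1 / 4) (hM : ∀ n, ‖A n‖ ≤ M) {θ : ℝ}
    (h0 : 0 < θ) (h1 : θ < 1) (hKM : K * (M * (θ⁻¹ - 1)) ≤ 1 / 4) {u : ℤ → V}
    (hu : tridiag A u = 0) {n : ℤ} {B : ℝ} (hB : ∀ k, n ≤ k → ‖u k‖ ≤ B) (k : ℕ) :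
    ‖(u (n + k), u (n + k + 1))‖ ≤ 2 * K * (M * θ⁻¹) * θ ^ k * ‖(u n, u (n + 1))‖ := by
  set X := ‖(u n, u (n + 1))‖ with hX
  have hM0 : 0 ≤ M := (norm_nonneg _).trans (hM 0)
  have hX0 : 0 ≤ X := norm_nonneg _
  have hun : ‖u n‖ ≤ X := norm_fst_le (u n, u (n + 1))
  have hun1 : ‖u (n + 1)‖ ≤ X := norm_snd_le (u n, u (n + 1))
  have hB0 : 0 ≤ B := (norm_nonneg _).trans (hB n le_rfl)
  let w : ℤ → V := fun k => if n ≤ k then u k else 0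
  have hwB : ∀ k, ‖w k‖ ≤ B := fun k => by
    simp only [w]; split_ifs with hk
    · exact hB k hk
    · simpa using hB0
  have hf : ∀ j, ‖tridiag A w j‖ ≤ M * X * θ⁻¹ * θ ^ (j - n).natAbs := by
    intro j
    rw [tridiag_apply]
    rcases lt_trichotomy j n with hj | rfl | hj
    · rcases eq_or_ne j (n - 1) with rfl | hj'
      · have hn : (n - 1 - n).natAbs = 1 := by omega
        rw [hn, pow_one, mul_assoc, inv_mul_cancel₀ h0.ne', mul_one]
        refine (A _).le_of_opNorm_le_of_le (hM _) (norm_triple_le ?_ ?_ ?_)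
        · simp only [w]; rw [if_neg (by omega)]; simpa using hX0
        · simp only [w]; rw [if_neg (by omega)]; simpa using hX0
        · simp only [w]; rw [if_pos (by omega), sub_add_cancel]; exact hun
      · have : (w (j - 1), w j, w (j + 1)) = 0 := by
          simp only [w]
          rw [if_neg (by omega), if_neg (by omega), if_neg (by omega)]; rfl
        rw [this, map_zero, norm_zero]; positivity
    · refine ((A _).le_of_opNorm_le_of_le (hM _) (norm_triple_le (B := X) ?_ ?_ ?_)).trans ?_
      · simp only [w]; rw [if_neg (by omega)]; simpa using hX0
      · simp only [w]; rw [if_pos (by omega)]; exact hun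
      · simp only [w]; rw [if_pos (by omega)]; exact hun1
      · simp only [sub_self, Int.natAbs_zero, pow_zero, mul_one]
        exact le_mul_of_one_le_right (by positivity) ((one_le_inv₀ h0).2 h1.le)
    · have h2 : A j (w (j - 1), w j, w (j + 1)) = 0 := by
        simp only [w]
        rw [if_pos (by omega), if_pos (by omega), if_pos (by omega)]
        exact congrFun hu j
      rw [h2, norm_zero]; positivity
  have hw := h.exp_decay hδ hKδ hM h0 h1 hKM n hwB (by positivity) hf
  have hw' : ∀ j : ℕ, ‖u (n + j)‖ ≤ 2 * K * (M * X * θ⁻¹) * θ ^ j := fun j => by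
    have := hw (n + j)
    have h3 : (n + (j : ℤ) - n).natAbs = j := by omega
    rw [h3] at this
    simp only [w] at this
    rwa [if_pos (by omega)] at this
  rw [Prod.norm_def, sup_le_iff]
  have hK := h.nonneg
  constructor
  · refine (hw' k).trans (le_of_eq (by ring))
  · have := hw' (k + 1)
    push_cast at this
    rw [← add_assoc] at this
    refine this.trans ?_
    have : θ ^ (k + 1) ≤ θ ^ k := pow_le_pow_of_le_one h0.le h1.le (by omega)
    calc _ ≤ 2 * K * (M * X * θ⁻¹) * θ ^ k := by gcongr
      _ = _ := by ring

/-- Same truncation, after `n + 1`. The image now lives on the rows `n + 1` and `n + 2`, which costs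
`θ⁻¹ ^ 2`; a further `θ⁻¹` appears because the second component `u (n - k + 1)` may be one step
closer to `n`. -/
theorem UniformlyInvertible.backward_bound [CompleteSpace V] (h : UniformlyInvertible A₀ K)
    (hδ : ∀ n, ‖A n - A₀ n‖ ≤ δ) (hKδ : K * δ ≤ 1 / 4) (hM : ∀ n, ‖A n‖ ≤ M) {θ : ℝ}
    (h0 : 0 < θ) (h1 : θ < 1) (hKM : K * (M * (θ⁻¹ - 1)) ≤ 1 / 4) {u : ℤ → V}
    (hu : tridiag A u = 0) {n : ℤ} {B : ℝ} (hB : ∀ k, k ≤ n + 1 → ‖u k‖ ≤ B) (k : ℕ) :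
    ‖(u (n - k), u (n - k + 1))‖ ≤ 2 * K * (M * θ⁻¹ ^ 3) * θ ^ k * ‖(u n, u (n + 1))‖ := by
  set X := ‖(u n, u (n + 1))‖ with hX
  have hM0 : 0 ≤ M := (norm_nonneg _).trans (hM 0)
  have hX0 : 0 ≤ X := norm_nonneg _
  have hun : ‖u n‖ ≤ X := norm_fst_le (u n, u (n + 1))
  have hun1 : ‖u (n + 1)‖ ≤ X := norm_snd_le (u n, u (n + 1))
  have hB0 : 0 ≤ B := (norm_nonneg _).trans (hB n (by omega))
  have hinv : 1 ≤ θ⁻¹ := (one_le_inv₀ h0).2 h1.le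
  let w : ℤ → V := fun k => if k ≤ n + 1 then u k else 0
  have hwB : ∀ k, ‖w k‖ ≤ B := fun k => by
    simp only [w]; split_ifs with hk
    · exact hB k hk
    · simpa using hB0
  have hf : ∀ j, ‖tridiag A w j‖ ≤ M * X * θ⁻¹ ^ 2 * θ ^ (j - n).natAbs := by
    intro j
    rw [tridiag_apply]
    have hcase : j ≤ n ∨ j = n + 1 ∨ j = n + 2 ∨ n + 2 < j := by omega
    rcases hcase with hj | rfl | rfl | hj
    · have h2 : A j (w (j - 1), w j, w (j + 1)) = 0 := by
        simp only [w]
        rw [if_pos (by omega), if_pos (by omega), if_pos (by omega)]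
        exact congrFun hu j
      rw [h2, norm_zero]; positivity
    · have hn : (n + 1 - n).natAbs = 1 := by omega
      rw [hn]
      refine ((A _).le_of_opNorm_le_of_le (hM _) (norm_triple_le (B := X) ?_ ?_ ?_)).trans ?_
      · simp only [w]; rw [if_pos (by omega), add_sub_cancel_right]; exact hun
      · simp only [w]; rw [if_pos (by omega)]; exact hun1
      · simp only [w]; rw [if_neg (by omega)]; simpa using hX0
      · have : M * X * θ⁻¹ ^ 2 * θ ^ 1 = M * X * θ⁻¹ := by field_simp
        rw [this]
        exact le_mul_of_one_le_right (by positivity) hinv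
    · have hn : (n + 2 - n).natAbs = 2 := by omega
      rw [hn]
      have : M * X * θ⁻¹ ^ 2 * θ ^ 2 = M * X := by field_simp
      rw [this]
      refine (A _).le_of_opNorm_le_of_le (hM _) (norm_triple_le (B := X) ?_ ?_ ?_)
      · simp only [w]; rw [if_pos (by omega), show n + 2 - 1 = n + 1 by ring]; exact hun1
      · simp only [w]; rw [if_neg (by omega)]; simpa using hX0
      · simp only [w]; rw [if_neg (by omega)]; simpa using hX0
    · have : (w (j - 1), w j, w (j + 1)) = 0 := by
        simp only [w]
        rw [if_neg (by omega), if_neg (by omega), if_neg (by omega)]; rfl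
      rw [this, map_zero, norm_zero]; positivity
  have hw := h.exp_decay hδ hKδ hM h0 h1 hKM n hwB (by positivity) hf
  have hK := h.nonneg
  have hw' : ∀ j : ℤ, j ≤ n + 1 → ‖u j‖ ≤ 2 * K * (M * X * θ⁻¹ ^ 2) * θ ^ (j - n).natAbs :=
    fun j hj => by
      have := hw j
      simp only [w] at this
      rwa [if_pos hj] at this
  have hle : ∀ i : ℕ, k ≤ i + 1 → θ ^ i ≤ θ⁻¹ * θ ^ k := fun i hi => by
    rw [le_inv_mul_iff₀ h0, ← pow_succ']
    exact pow_le_pow_of_le_one h0.le h1.le hi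
  have fin : ∀ j : ℤ, j ≤ n + 1 → k ≤ (j - n).natAbs + 1 →
      ‖u j‖ ≤ 2 * K * (M * θ⁻¹ ^ 3) * θ ^ k * X := fun j hj hj' =>
    calc ‖u j‖ ≤ 2 * K * (M * X * θ⁻¹ ^ 2) * θ ^ (j - n).natAbs := hw' j hj
      _ ≤ 2 * K * (M * X * θ⁻¹ ^ 2) * (θ⁻¹ * θ ^ k) := by gcongr; exact hle _ hj'
      _ = _ := by ring
  rw [Prod.norm_def, sup_le_iff]
  exact ⟨fin _ (by omega) (by omega), fin _ (by omega) (by omega)⟩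

/-- A tridiagonal system close to a uniformly invertible one has an exponential dichotomy. -/
theorem UniformlyInvertible.exists_dichotomy [CompleteSpace V] (h : UniformlyInvertible A₀ K)
    (hδ : ∀ n, ‖A n - A₀ n‖ ≤ δ) (hKδ : K * δ ≤ 1 / 4) (hM : ∀ n, ‖A n‖ ≤ M)
    (hT : ∀ n ξ η, T n ξ = η ↔ η.1 = ξ.2 ∧ A (n + 1) (ξ.1, ξ.2, η.2) = 0) :
    ∃ (Es Eu : ℤ → Submodule ℝ (V × V)) (C θ : ℝ), 0 ≤ C ∧ 0 < θ ∧ θ < 1 ∧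
      (∀ n, IsCompl (Es n) (Eu n)) ∧
      (∀ n, (Es n).map (T n).toLinearMap = Es (n + 1)) ∧
      (∀ n, (Eu n).map (T n).toLinearMap = Eu (n + 1)) ∧
      ∀ ξ : ℤ → V × V, (∀ n, ξ (n + 1) = T n (ξ n)) → ∀ (n : ℤ) (k : ℕ),
        (ξ n ∈ Es n → ‖ξ (n + k)‖ ≤ C * θ ^ k * ‖ξ n‖) ∧
        (ξ n ∈ Eu n → ‖ξ (n - k)‖ ≤ C * θ ^ k * ‖ξ n‖) := by
  have hM0 : 0 ≤ M := (norm_nonneg _).trans (hM 0)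
  have hK := h.nonneg
  -- Choose `θ⁻¹ - 1 = 1 / (4 (K M + 1))`, so the rate depends only on `K` and `M`.
  obtain ⟨θ, h0, h1, hKM⟩ : ∃ θ : ℝ, 0 < θ ∧ θ < 1 ∧ K * (M * (θ⁻¹ - 1)) ≤ 1 / 4 := by
    refine ⟨(1 + 1 / (4 * (K * M + 1)))⁻¹, by positivity, ?_, ?_⟩
    · refine inv_lt_one_of_one_lt₀ ?_
      have : 0 < 1 / (4 * (K * M + 1)) := by positivity
      linarith
    · rw [inv_inv, add_sub_cancel_left, ← mul_assoc, mul_one_div, div_le_div_iff₀ (by positivity)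
        (by norm_num)]
      linarith
  have hinv : 1 ≤ θ⁻¹ := (one_le_inv₀ h0).2 h1.le
  -- Stable data: solutions bounded in the future. Unstable data: bounded in the past, up to `n + 1`
  -- because the data at `n` include `u (n + 1)`.
  refine ⟨fun n => boundedData A (Ici n) n, fun n => boundedData A (Iic (n + 1)) n,
    2 * K * (M * θ⁻¹ ^ 3), θ, by positivity, h0, h1, fun n => ?_, fun n => ?_, fun n => ?_,
    fun ξ hξ n k => ⟨fun hn => ?_, fun hn => ?_⟩⟩
  · constructor
    · rw [Submodule.disjoint_def]
      rintro ξ ⟨u, hu, h2, h3, B, hB⟩ ⟨v, hv, h4, h5, B', hB'⟩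
      have huv : u = v := solution_unique hT hu hv (h2.trans h4.symm) (h3.trans h5.symm)
      subst huv
      have := h.eq_zero hδ hKδ (B := max B B') (fun k => ?_) hu
      · subst this
        exact Prod.ext h2.symm h3.symm
      · rcases le_total n k with hk | hk
        · exact (hB k hk).trans (le_max_left _ _)
        · exact (hB' k (by simp only [mem_Iic]; omega)).trans (le_max_right _ _)
    · rw [codisjoint_iff, eq_top_iff]
      intro x _
      obtain ⟨ξ, hξn, hξ⟩ := exists_orbit (fun n => (T n).toEquiv) n x
      obtain ⟨hu, hξu⟩ := exists_solution hT hξ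
      set u : ℤ → V := fun n => (ξ n).1 with hu_def
      -- To split a solution `u`, truncate it before `n`; the defect of `w` occupies two rows and is
      -- bounded even if `u` is not.
      let w : ℤ → V := fun k => if n ≤ k then u k else 0
      have hwk : ∀ k, n ≤ k → w k = u k := fun k hk => if_pos hk
      have hwk' : ∀ k, k < n → w k = 0 := fun k hk => if_neg (by omega)
      have hf : ∀ j, ‖tridiag A w j‖ ≤ max ‖tridiag A w (n - 1)‖ ‖tridiag A w n‖ := by
        intro j
        rcases lt_trichotomy j n with hj | rfl | hj
        · rcases eq_or_ne j (n - 1) with rfl | hj'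
          · exact le_max_left _ _
          · rw [tridiag_apply, hwk' _ (by omega), hwk' _ (by omega), hwk' _ (by omega)]
            have : ((0 : V), (0 : V), (0 : V)) = 0 := rfl
            rw [this, map_zero, norm_zero]
            exact (norm_nonneg _).trans (le_max_left _ _)
        · exact le_max_right _ _
        · rw [tridiag_apply, hwk _ (by omega), hwk _ (by omega), hwk _ (by omega),
            ← tridiag_apply A u, hu, Pi.zero_apply, norm_zero]
          exact (norm_nonneg _).trans (le_max_left _ _)
      -- A bounded `v` with the same defect gives `u = (u - (w - v)) + (w - v)`. The first summand
      -- is `v` in the future, the second is `-v` in the past, and both solve the homogeneous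
      -- equation.
      obtain ⟨v, hv, hvb⟩ := h.exists_bounded hδ hKδ hM hf
      have hwv : tridiag A (w - v) = 0 := by rw [map_sub, hv, sub_self]
      rw [Submodule.mem_sup]
      refine ⟨((u - (w - v)) n, (u - (w - v)) (n + 1)),
        ⟨u - (w - v), by rw [map_sub, hu, hwv, sub_zero], rfl, rfl,
          2 * K * max ‖tridiag A w (n - 1)‖ ‖tridiag A w n‖, fun k hk => ?_⟩,
        ((w - v) n, (w - v) (n + 1)), ⟨w - v, hwv, rfl, rfl,
          max (2 * K * max ‖tridiag A w (n - 1)‖ ‖tridiag A w n‖)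
            (max ‖(w - v) n‖ ‖(w - v) (n + 1)‖), fun k hk => ?_⟩, ?_⟩
      · rw [Pi.sub_apply, Pi.sub_apply, hwk k hk, sub_sub_cancel]
        exact hvb k
      · rcases lt_or_ge k n with hk' | hk'
        · rw [Pi.sub_apply, hwk' k hk', zero_sub, norm_neg]
          exact (hvb k).trans (le_max_left _ _)
        · rw [mem_Iic] at hk
          obtain rfl | rfl : k = n ∨ k = n + 1 := by omega
          · exact (le_max_left _ _).trans (le_max_right _ _)
          · exact (le_max_right _ _).trans (le_max_right _ _)
      · rw [Prod.mk_add_mk, ← Pi.add_apply, ← Pi.add_apply, sub_add_cancel, ← hξn, hξu n]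
  · exact map_boundedData hT n (a := n) (b := n + 2) (fun k hk => by
      simp only [Set.mem_sdiff, mem_Ici, mem_singleton_iff] at hk ⊢; omega) (fun k hk => by
      simp only [Set.mem_sdiff, mem_Ici, mem_singleton_iff] at hk ⊢; omega)
  · exact map_boundedData hT n (a := n) (b := n + 2) (fun k hk => by
      simp only [Set.mem_sdiff, mem_Iic, mem_singleton_iff] at hk ⊢; omega) (fun k hk => by
      simp only [Set.mem_sdiff, mem_Iic, mem_singleton_iff] at hk ⊢; omega)
  all_goals
    obtain ⟨hu, hξu⟩ := exists_solution hT hξ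
    obtain ⟨v, hv, h2, h3, B, hB⟩ := hn
    have huv : v = fun n => (ξ n).1 := solution_unique hT hv hu h2
      (by rw [h3, hξu n])
    subst huv
  · have := h.forward_bound hδ hKδ hM h0 h1 hKM hu (n := n) hB k
    rw [← hξu, ← hξu] at this
    refine this.trans ?_
    gcongr
    exact le_self_pow₀ hinv (by norm_num)
  · have := h.backward_bound hδ hKδ hM h0 h1 hKM hu (n := n) hB k
    rw [← hξu, ← hξu] at this
    exact this

end Dichotomy

/-! ### Consequences of strict differentiability -/

section Immersions

variable {X Y : Type*} [NormedAddCommGroup X] [NormedSpace ℝ X] [NormedAddCommGroup Y]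
  [NormedSpace ℝ Y]

theorem exists_lower_bound_of_injective [FiniteDimensional ℝ X] {A : X →L[ℝ] Y}
    (hA : Function.Injective A) : ∃ c > 0, ∀ u, c * ‖u‖ ≤ ‖A u‖ := by
  obtain ⟨K, hK, hA'⟩ := LinearMap.exists_antilipschitzWith A.toLinearMap
    (LinearMap.ker_eq_bot.2 hA)
  have hK' : (0 : ℝ) < K := hK
  refine ⟨(K : ℝ)⁻¹, by positivity, fun u => ?_⟩
  rw [inv_mul_le_iff₀ hK']
  simpa using hA'.le_mul_dist u 0

theorem _root_.HasStrictFDerivAt.eventually_norm_sub_le {f : X → Y} {f' : X →L[ℝ] Y} {x : X}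
    (hf : HasStrictFDerivAt f f' x) {δ : ℝ} (hδ : 0 < δ) :
    ∀ᶠ p : X × X in 𝓝 (x, x), ‖f p.1 - f p.2 - f' (p.1 - p.2)‖ ≤ δ * ‖p.1 - p.2‖ :=
  hf.isLittleO.def hδ

theorem _root_.HasStrictFDerivAt.eventually_antilipschitz [FiniteDimensional ℝ X] {f : X → Y}
    {f' : X →L[ℝ] Y} {x : X} (hf : HasStrictFDerivAt f f' x) (hf' : Function.Injective f') :
    ∃ c > 0, ∀ᶠ p : X × X in 𝓝 (x, x), c * ‖p.1 - p.2‖ ≤ ‖f p.1 - f p.2‖ := by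
  obtain ⟨c, hc, hcA⟩ := exists_lower_bound_of_injective hf'
  refine ⟨c / 2, by positivity, ?_⟩
  filter_upwards [hf.eventually_norm_sub_le (half_pos hc)] with p hp
  have h1 := hcA (p.1 - p.2)
  have h2 : ‖f' (p.1 - p.2)‖ ≤ ‖f p.1 - f p.2‖ + ‖f p.1 - f p.2 - f' (p.1 - p.2)‖ := by
    rw [← norm_neg (f p.1 - f p.2 - _)]
    refine (le_of_eq ?_).trans (norm_add_le _ _)
    congr 1; abel
  linarith

theorem _root_.HasStrictFDerivAt.eventually_lipschitz {f : X → Y}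
    {f' : X →L[ℝ] Y} {x : X} (hf : HasStrictFDerivAt f f' x) :
    ∃ C > 0, ∀ᶠ p : X × X in 𝓝 (x, x), ‖f p.1 - f p.2‖ ≤ C * ‖p.1 - p.2‖ := by
  refine ⟨‖f'‖ + 1, by positivity, ?_⟩
  filter_upwards [hf.eventually_norm_sub_le one_pos] with p hp
  calc ‖f p.1 - f p.2‖ = ‖f' (p.1 - p.2) + (f p.1 - f p.2 - f' (p.1 - p.2))‖ := by congr 1; abel
    _ ≤ ‖f'‖ * ‖p.1 - p.2‖ + 1 * ‖p.1 - p.2‖ :=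
      (norm_add_le _ _).trans (add_le_add (f'.le_opNorm _) hp)
    _ = _ := by ring

end Immersions

/-! ### Local parametrizations of hypersurfaces and transversal rays -/

section LocalParam

variable {d : ℕ} {S : Set (Euc (d + 1))} {q : Euc (d + 1)} {ψ : Euc d → Euc (d + 1)}

theorem IsLocalParam.contDiffAt (h : IsLocalParam S q ψ) : ContDiffAt ℝ ∞ ψ 0 :=
  h.smooth.self_of_nhds

theorem IsLocalParam.hasStrictFDerivAt (h : IsLocalParam S q ψ) :
    HasStrictFDerivAt ψ (fderiv ℝ ψ 0) 0 :=
  h.contDiffAt.hasStrictFDerivAt (by simp)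

theorem IsLocalParam.tendsto (h : IsLocalParam S q ψ) : Tendsto ψ (𝓝 0) (𝓝 q) := by
  have := h.contDiffAt.continuousAt
  rwa [ContinuousAt, h.apply_zero] at this

theorem IsLocalParam.eventually_mem (h : IsLocalParam S q ψ) : ∀ᶠ y in 𝓝 0, ψ y ∈ S := by
  have : ∀ᶠ z in Filter.map ψ (𝓝 0), z ∈ S := by
    rw [h.map_nhds]; exact eventually_mem_nhdsWithin
  exact this

theorem IsLocalParam.continuousAt_fderiv (h : IsLocalParam S q ψ) :
    ContinuousAt (fderiv ℝ ψ) 0 :=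
  (h.contDiffAt.fderiv_right (m := 0) (by simp)).continuousAt

theorem IsLocalParam.eventually_fderiv_lower_bound (h : IsLocalParam S q ψ) :
    ∃ c > 0, ∀ᶠ y in 𝓝 0, ∀ u, c * ‖u‖ ≤ ‖fderiv ℝ ψ y u‖ := by
  obtain ⟨c, hc, hcA⟩ := exists_lower_bound_of_injective h.immersion
  refine ⟨c / 2, by positivity, ?_⟩
  filter_upwards [h.continuousAt_fderiv.eventually (Metric.ball_mem_nhds _ (half_pos hc))]
    with y hy u
  rw [dist_eq_norm] at hy
  have h1 := hcA u
  have h2 : ‖fderiv ℝ ψ 0 u‖ ≤ ‖fderiv ℝ ψ y u‖ + ‖(fderiv ℝ ψ y - fderiv ℝ ψ 0) u‖ := by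
    rw [← norm_neg ((fderiv ℝ ψ y - fderiv ℝ ψ 0) u)]
    refine (le_of_eq ?_).trans (norm_add_le _ _)
    congr 1; rw [sub_apply]; abel
  have h3 := (fderiv ℝ ψ y - fderiv ℝ ψ 0).le_of_opNorm_le hy.le u
  linarith

/-- The perturbed reflection points are `ψ y` with `y` small, and need charts centred there. Near
`q` the hypersurface is the image of a set on which `ψ` is antilipschitz, so points of `S` close to
`ψ y` have parameters close to `y`. -/
theorem IsLocalParam.eventually_translate (h : IsLocalParam S q ψ) :
    ∀ᶠ y in 𝓝 0, IsLocalParam S (ψ y) (fun z => ψ (y + z)) := by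
  obtain ⟨c, hc, hanti⟩ :=
    h.hasStrictFDerivAt.eventually_antilipschitz h.immersion
  obtain ⟨c', hc', hlow⟩ := h.eventually_fderiv_lower_bound
  rw [nhds_prod_eq] at hanti
  obtain ⟨U, hU, hUanti⟩ := eventually_prod_self_iff'.1 hanti
  have himg : ψ '' U ∈ 𝓝[S] q := by
    rw [← h.map_nhds]; exact image_mem_map hU
  obtain ⟨O, hO, hqO, hOS⟩ := mem_nhdsWithin.1 himg
  filter_upwards [hU, h.smooth.eventually_nhds, h.eventually_mem.eventually_nhds, hlow,
    h.tendsto.eventually (hO.mem_nhds hqO)] with y hyU hys hyS hylow hyO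
  have hadd : Filter.map (fun z => y + z) (𝓝 0) = 𝓝 y := by
    simp
  have hadd' : Tendsto (fun z => y + z) (𝓝 0) (𝓝 y) := hadd.le
  refine ⟨by simp, ?_, ?_, ?_⟩
  · filter_upwards [hadd'.eventually hys] with z hz
    exact hz.comp z (contDiffAt_const.add contDiffAt_id)
  · have h1 : fderiv ℝ (fun z => ψ (y + z)) 0 = fderiv ℝ ψ y := by
      rw [fderiv_comp_add_left, add_zero]
    rw [h1, injective_iff_map_eq_zero]
    intro u hu
    have := hylow u
    rw [hu, norm_zero] at this
    exact norm_le_zero_iff.1 (by nlinarith [norm_nonneg u])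
  · have h1 : Filter.map (fun z => ψ (y + z)) (𝓝 0) = Filter.map ψ (𝓝 y) := by
      rw [← hadd, Filter.map_map]; rfl
    rw [h1]
    apply le_antisymm
    · exact tendsto_nhdsWithin_iff.2 ⟨hys.self_of_nhds.continuousAt, hyS⟩
    · intro A hA
      obtain ⟨r, hr, hrA⟩ := Metric.mem_nhds_iff.1 hA
      have : O ∩ Metric.ball (ψ y) (c * r) ∈ 𝓝 (ψ y) :=
        inter_mem (hO.mem_nhds hyO) (Metric.ball_mem_nhds _ (by positivity))
      refine mem_of_superset (inter_mem_nhdsWithin S this) ?_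
      rintro z ⟨hzS, hzO, hzb⟩
      obtain ⟨y', hy', rfl⟩ := hOS ⟨hzO, hzS⟩
      refine hrA ?_
      have h2 := hUanti y' hy' y hyU
      rw [Metric.mem_ball, dist_eq_norm] at hzb ⊢
      exact lt_of_mul_lt_mul_left (h2.trans_lt hzb) hc.le

theorem IsLocalParam.congr_nhdsWithin {S' : Set (Euc (d + 1))} (h : IsLocalParam S q ψ)
    (hS : 𝓝[S] q = 𝓝[S'] q) : IsLocalParam S' q ψ :=
  ⟨h.apply_zero, h.smooth, h.immersion, h.map_nhds.trans hS⟩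

theorem IsLocalParam.union_of_isClosed {S' : Set (Euc (d + 1))} (h : IsLocalParam S q ψ)
    (hS' : IsClosed S') (hq : q ∉ S') : IsLocalParam (S ∪ S') q ψ := by
  refine h.congr_nhdsWithin ?_
  have h1 : 𝓝[S'] q = ⊥ := notMem_closure_iff_nhdsWithin_eq_bot.1 (by rwa [hS'.closure_eq])
  rw [nhdsWithin_union, h1, sup_bot_eq]

theorem IsLocalParam.add_smul (h : IsLocalParam S q ψ) (b : Euc (d + 1)) {ε : ℝ} (hε : ε ≠ 0) :
    IsLocalParam ((fun z => b + ε • z) '' S) (b + ε • q) (fun y => b + ε • ψ y) := by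
  let e : Euc (d + 1) ≃ₜ Euc (d + 1) := (Homeomorph.smulOfNeZero ε hε).trans (Homeomorph.addLeft b)
  have he : ∀ z, e z = b + ε • z := fun z => rfl
  refine ⟨by simp [h.apply_zero], ?_, ?_, ?_⟩
  · filter_upwards [h.smooth] with y hy
    exact contDiffAt_const.add (hy.const_smul ε)
  · have h1 : fderiv ℝ (fun y => b + ε • ψ y) 0 = ε • fderiv ℝ ψ 0 := by
      rw [fderiv_const_add, fderiv_fun_const_smul (h.contDiffAt.differentiableAt (by simp))]
    rw [h1]
    intro u v huv
    exact h.immersion (smul_right_injective _ hε huv)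
  · have h1 : Filter.map (fun y => b + ε • ψ y) (𝓝 0) = Filter.map e (Filter.map ψ (𝓝 0)) := by
      rw [Filter.map_map]; rfl
    rw [h1, h.map_nhds]
    exact e.isEmbedding.map_nhdsWithin_eq S q

/-- A hyperplane and a vector outside of it span the space. -/
theorem exists_add_smul_of_notMem_range {A : Euc d →L[ℝ] Euc (d + 1)}
    (hA : Function.Injective A) {w : Euc (d + 1)} (hw : w ∉ range A) (z : Euc (d + 1)) :
    ∃ (u : Euc d) (t : ℝ), z = A u + t • w := by
  let Φ : Euc d × ℝ →ₗ[ℝ] Euc (d + 1) := A.toLinearMap.coprod (LinearMap.toSpanSingleton ℝ _ w)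
  have hΦ : ∀ u t, Φ (u, t) = A u + t • w := fun u t => rfl
  have hinj : Function.Injective Φ := by
    rw [injective_iff_map_eq_zero]
    rintro ⟨u, t⟩ h
    rw [hΦ] at h
    have ht : t = 0 := by
      by_contra ht
      refine hw ⟨-(t⁻¹ • u), ?_⟩
      rw [map_neg, map_smul, ← smul_neg, inv_smul_eq_iff₀ ht]
      exact neg_eq_of_add_eq_zero_right h
    subst ht
    rw [zero_smul, add_zero] at h
    rw [(injective_iff_map_eq_zero A).1 hA u h]; rfl
  have hsurj : Function.Surjective Φ :=
    (LinearMap.injective_iff_surjective_of_finrank_eq_finrank (by simp)).1 hinj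
  obtain ⟨⟨u, t⟩, h⟩ := hsurj z
  exact ⟨u, t, by rw [← h, hΦ]⟩

theorem exists_pos_le_norm_sub_of_notMem_range (A : Euc d →L[ℝ] Euc (d + 1)) {w : Euc (d + 1)}
    (hw : w ∉ range A) : ∃ η > 0, ∀ u, η ≤ ‖w - A u‖ := by
  have hc : IsClosed (A.toLinearMap.range : Set (Euc (d + 1))) :=
    Submodule.closed_of_finiteDimensional _
  have hw' : w ∉ (A.toLinearMap.range : Set (Euc (d + 1))) := hw
  obtain ⟨η, hη, h⟩ := Metric.mem_nhds_iff.1 (hc.isOpen_compl.mem_nhds hw')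
  refine ⟨η, hη, fun u => ?_⟩
  by_contra hu
  refine h (a := A u) ?_ ⟨u, rfl⟩
  rw [Metric.mem_ball, dist_comm, dist_eq_norm]
  exact not_le.1 hu

/-- A ray which issues transversally from a point of a compact hypersurface and does not meet the
hypersurface again keeps this property under perturbation. -/
theorem IsLocalParam.eventually_ray_notMem (h : IsLocalParam S q ψ) (hS : IsCompact S)
    {w₀ : Euc (d + 1)} (hw₀ : w₀ ∉ range (fderiv ℝ ψ 0))
    (hray : ∀ t : ℝ, 0 < t → q + t • w₀ ∉ S) :
    ∀ᶠ p : Euc d × Euc (d + 1) in 𝓝 (0, w₀), ∀ t : ℝ, 0 < t → ψ p.1 + t • p.2 ∉ S := by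
  have hw0 : w₀ ≠ 0 := fun h0 => hw₀ ⟨0, by rw [map_zero, h0]⟩
  have hw0' : 0 < ‖w₀‖ := norm_pos_iff.2 hw0
  obtain ⟨η, hη, hηA⟩ := exists_pos_le_norm_sub_of_notMem_range _ hw₀
  obtain ⟨c, hc, hanti⟩ :=
    h.hasStrictFDerivAt.eventually_antilipschitz h.immersion
  -- If the ray meets `ψ y'` at time `t`, then `‖y' - y‖ ≤ 2 t ‖w₀‖ / c`, so the linearization error
  -- is at most `t * η / 4`.
  set δ := c * η / (8 * ‖w₀‖) with hδ
  have hδ0 : 0 < δ := by positivity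
  have hstr := h.hasStrictFDerivAt.eventually_norm_sub_le hδ0
  have hboth := hanti.and hstr
  rw [nhds_prod_eq] at hboth
  obtain ⟨U, hU, hUP⟩ := eventually_prod_self_iff'.1 hboth
  have himg : ψ '' U ∈ 𝓝[S] q := by
    rw [← h.map_nhds]; exact image_mem_map hU
  obtain ⟨r, hr, hrS⟩ := Metric.mem_nhdsWithin_iff.1 himg
  set τ := r / (4 * ‖w₀‖) with hτ
  have hτ0 : 0 < τ := by positivity
  obtain ⟨R, hR0, hR⟩ := hS.isBounded.exists_pos_norm_le
  set T := (2 * R + 2 * ‖q‖ + 4) / ‖w₀‖ + τ with hT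
  have hfst : Tendsto (fun p : Euc d × Euc (d + 1) => p.1) (𝓝 (0, w₀)) (𝓝 0) :=
    continuous_fst.tendsto' _ _ rfl
  have hsnd : Tendsto (fun p : Euc d × Euc (d + 1) => p.2) (𝓝 (0, w₀)) (𝓝 w₀) :=
    continuous_snd.tendsto' _ _ rfl
  have hpsi : Tendsto (fun p : Euc d × Euc (d + 1) => ψ p.1) (𝓝 (0, w₀)) (𝓝 q) :=
    h.tendsto.comp hfst
  have hmid : ∀ᶠ p : Euc d × Euc (d + 1) in 𝓝 (0, w₀), ∀ t ∈ Icc τ T, ψ p.1 + t • p.2 ∉ S := by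
    refine isCompact_Icc.eventually_forall_of_forall_eventually fun t ht => ?_
    have : Tendsto (fun z : (Euc d × Euc (d + 1)) × ℝ => ψ z.1.1 + z.2 • z.1.2)
        (𝓝 ((0, w₀), t)) (𝓝 (q + t • w₀)) := by
      rw [nhds_prod_eq]
      exact (hpsi.comp tendsto_fst).add (tendsto_snd.smul (hsnd.comp tendsto_fst))
    exact this.eventually (hS.isClosed.isOpen_compl.mem_nhds (hray t (hτ0.trans_le ht.1)))
  have hw_near := hsnd.eventually (Metric.ball_mem_nhds w₀ (show 0 < min (η / 2) (‖w₀‖ / 2) by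
    positivity))
  filter_upwards [hmid, hw_near, hfst.eventually hU,
    hpsi.eventually (Metric.ball_mem_nhds q (show 0 < min (r / 4) 1 by positivity))]
    with p hpmid hpw hpU hpq t ht hmem
  obtain ⟨y, w⟩ := p
  simp only at hpmid hpw hpU hpq hmem
  rw [dist_eq_norm, lt_min_iff] at hpw hpq
  have hw1 : ‖w‖ ≤ 2 * ‖w₀‖ := by
    have := norm_sub_norm_le w w₀; linarith [hpw.2]
  have hw2 : ‖w₀‖ / 2 ≤ ‖w‖ := by
    have := norm_sub_norm_le w₀ w; rw [norm_sub_rev] at this; linarith [hpw.2]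
  -- Three ranges of `t`. For small `t` a hit would put `w` within `η / 4` of the tangent space,
  -- against transversality. On `[τ, T]` compactness applies. Beyond `T` the ray has left the
  -- bounded set `S`.
  rcases lt_or_ge t τ with htτ | htτ
  · have hnear : ψ y + t • w ∈ Metric.ball q r := by
      rw [Metric.mem_ball, dist_eq_norm]
      have h1 : ‖t • w‖ ≤ r / 2 := by
        rw [norm_smul, Real.norm_of_nonneg ht.le]
        calc t * ‖w‖ ≤ τ * (2 * ‖w₀‖) := by gcongr
          _ = r / 2 := by rw [hτ]; field_simp; norm_num
      calc ‖ψ y + t • w - q‖ = ‖(ψ y - q) + t • w‖ := by congr 1; abel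
        _ ≤ _ := norm_add_le _ _
        _ < r := by linarith [hpq.1]
    obtain ⟨y', hy'U, hy'⟩ := hrS ⟨hnear, hmem⟩
    obtain ⟨h1, h2⟩ := hUP y' hy'U y hpU
    simp only [hy', add_sub_cancel_left] at h1 h2
    have h3 : ‖y' - y‖ ≤ t * (2 * ‖w₀‖) / c := by
      rw [le_div_iff₀ hc, mul_comm]
      refine h1.trans ?_
      rw [norm_smul, Real.norm_of_nonneg ht.le]
      gcongr
    have h4 : ‖w - fderiv ℝ ψ 0 (t⁻¹ • (y' - y))‖ ≤ η / 4 := by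
      have h5 : w - fderiv ℝ ψ 0 (t⁻¹ • (y' - y)) = t⁻¹ • (t • w - fderiv ℝ ψ 0 (y' - y)) := by
        rw [map_smul, smul_sub, inv_smul_smul₀ ht.ne']
      rw [h5, norm_smul, norm_inv, Real.norm_of_nonneg ht.le, inv_mul_le_iff₀ ht]
      refine h2.trans ((mul_le_mul_of_nonneg_left h3 hδ0.le).trans (le_of_eq ?_))
      rw [hδ]; field_simp; norm_num
    have h6 := hηA (t⁻¹ • (y' - y))
    have h7 : ‖w₀ - fderiv ℝ ψ 0 (t⁻¹ • (y' - y))‖ ≤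
        ‖w - w₀‖ + ‖w - fderiv ℝ ψ 0 (t⁻¹ • (y' - y))‖ := by
      rw [← norm_neg (w - w₀)]
      refine (le_of_eq ?_).trans (norm_add_le _ _)
      congr 1; abel
    linarith [hpw.1]
  · rcases le_or_gt t T with htT | htT
    · exact hpmid t ⟨htτ, htT⟩ hmem
    · have h1 := hR _ hmem
      have h2 : 2 * R + 2 * ‖q‖ + 4 ≤ t * ‖w₀‖ := by
        rw [← div_le_iff₀ hw0']; linarith
      have h3 : ‖t • w‖ ≤ ‖ψ y + t • w‖ + ‖ψ y‖ := by
        rw [← norm_neg (ψ y)]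
        refine (le_of_eq ?_).trans (norm_add_le _ _)
        congr 1; abel
      have h4 : ‖ψ y‖ ≤ ‖q‖ + 1 := by
        have := norm_sub_norm_le (ψ y) q; linarith [hpq.2]
      rw [norm_smul, Real.norm_of_nonneg ht.le] at h3
      have h5 : t * (‖w₀‖ / 2) ≤ t * ‖w‖ := by gcongr
      linarith

/-- A segment which leaves transversally a smooth boundary point into the domain keeps this
property under perturbation. -/
theorem IsLocalParam.eventually_mem_domain {D : Set (Euc (d + 1))} (hDo : IsOpen D)
    (hDs : HasSmoothBoundary D) (h : IsLocalParam (frontier D) q ψ)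
    {w₀ : Euc (d + 1)} (hw₀ : w₀ ∉ range (fderiv ℝ ψ 0))
    (hD : ∀ᶠ t : ℝ in 𝓝[>] 0, q + t • w₀ ∈ D) :
    ∃ τ > 0, ∀ᶠ p : Euc (d + 1) × Euc (d + 1) in 𝓝 (q, w₀), p.1 ∈ frontier D →
      ∀ t : ℝ, 0 < t → t ≤ τ → p.1 + t • p.2 ∈ D := by
  have hq : q ∈ frontier D := by
    have := h.eventually_mem.self_of_nhds
    rwa [h.apply_zero] at this
  obtain ⟨g, hg, hgq, hg', hgD⟩ := hDs q hq
  -- A frontier point is a limit of points of `D`, whence `g ≤ 0`, and is not in the open set `D`,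
  -- whence `g ≥ 0`.
  have hgfr : ∀ᶠ P in 𝓝 q, P ∈ frontier D → g P = 0 := by
    filter_upwards [hgD.eventually_nhds] with P hP hPf
    rw [hDo.frontier_eq] at hPf
    apply le_antisymm
    · have h1 : ∃ᶠ x in 𝓝 P, x ∈ D := mem_closure_iff_frequently.1 hPf.1
      by_contra hpos
      have h2 : ∀ᶠ x in 𝓝 P, 0 < g x :=
        hg.continuous.continuousAt.eventually (lt_mem_nhds (not_le.1 hpos))
      obtain ⟨x, hx, hx1, hx2⟩ := (h1.and_eventually (hP.and h2)).exists
      exact absurd (hx1.1 hx) (not_lt.2 hx2.le)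
    · by_contra hneg
      exact hPf.2 (hP.self_of_nhds.2 (not_le.1 hneg))
  have hgs : HasStrictFDerivAt g (fderiv ℝ g q) q :=
    hg.contDiffAt.hasStrictFDerivAt (by simp)
  have htan : ∀ u, fderiv ℝ g q (fderiv ℝ ψ 0 u) = 0 := by
    have h1 : HasFDerivAt (g ∘ ψ) ((fderiv ℝ g q).comp (fderiv ℝ ψ 0)) 0 := by
      refine HasFDerivAt.comp 0 ?_ h.hasStrictFDerivAt.hasFDerivAt
      rw [h.apply_zero]; exact hgs.hasFDerivAt
    have h2 : g ∘ ψ =ᶠ[𝓝 0] fun _ => 0 := by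
      filter_upwards [h.eventually_mem, h.tendsto.eventually hgfr] with y hy hy'
      exact hy' hy
    have h3 := h1.unique ((hasFDerivAt_const 0 0).congr_of_eventuallyEq h2)
    intro u
    exact DFunLike.congr_fun h3 u
  -- The sign is weak because the segment enters `D`. It is strict because `dg` vanishes on the
  -- tangent space: if it also vanished on the transversal vector `w₀`, it would be zero.
  have hgw : fderiv ℝ g q w₀ < 0 := by
    refine lt_of_le_of_ne ?_ fun h0 => hg' ?_
    · have h1 : HasDerivAt (fun t : ℝ => g (q + t • w₀)) (fderiv ℝ g q w₀) 0 := by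
        have h2 : HasDerivAt (fun t : ℝ => q + t • w₀) w₀ 0 := by
          simpa using ((hasDerivAt_id (0 : ℝ)).smul_const w₀).const_add q
        refine HasFDerivAt.comp_hasDerivAt (l := g) (0 : ℝ) ?_ h2
        simpa using hgs.hasFDerivAt
      have h2 : Tendsto (fun t : ℝ => q + t • w₀) (𝓝[>] 0) (𝓝 q) :=
        (Continuous.tendsto' (by fun_prop) _ _ (by simp)).mono_left nhdsWithin_le_nhds
      have h3 : ∀ᶠ t : ℝ in 𝓝[>] 0, g (q + t • w₀) < 0 := by
        filter_upwards [hD, h2.eventually hgD] with t ht ht'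
        exact ht'.1 ht
      have h4 := (hasDerivAt_iff_tendsto_slope.1 h1).mono_left
        (nhdsWithin_mono 0 (fun x (hx : x ∈ Ioi (0 : ℝ)) => ne_of_gt hx))
      refine le_of_tendsto h4 ?_
      filter_upwards [h3, self_mem_nhdsWithin] with t ht ht0
      rw [slope_def_field]
      simp only [zero_smul, add_zero, hgq, sub_zero]
      exact div_nonpos_of_nonpos_of_nonneg ht.le (le_of_lt ht0)
    · ext z
      obtain ⟨u, t, rfl⟩ := exists_add_smul_of_notMem_range h.immersion hw₀ z
      rw [map_add, htan, map_smul, h0]; simp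
  set m := -fderiv ℝ g q w₀ with hm
  have hm0 : 0 < m := by rw [hm]; linarith
  -- The linear term is below `-t * m / 2` and the remainder at most `t * m / 4`, uniformly in the
  -- base point and direction.
  set δ := m / (4 * (‖w₀‖ + 1)) with hδ
  have hδ0 : 0 < δ := by positivity
  have hstr := (hgs.eventually_norm_sub_le hδ0)
  rw [nhds_prod_eq] at hstr
  obtain ⟨U, hU, hUP⟩ := eventually_prod_self_iff'.1 hstr
  obtain ⟨r, hr, hrU⟩ := Metric.mem_nhds_iff.1 (inter_mem hU hgD)
  refine ⟨r / (2 * (‖w₀‖ + 1)), by positivity, ?_⟩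
  have hfst : Tendsto (fun p : Euc (d + 1) × Euc (d + 1) => p.1) (𝓝 (q, w₀)) (𝓝 q) :=
    continuous_fst.tendsto' _ _ rfl
  have hsnd : Tendsto (fun p : Euc (d + 1) × Euc (d + 1) => p.2) (𝓝 (q, w₀)) (𝓝 w₀) :=
    continuous_snd.tendsto' _ _ rfl
  have hlin : ∀ᶠ p : Euc (d + 1) × Euc (d + 1) in 𝓝 (q, w₀), fderiv ℝ g q p.2 < -m / 2 := by
    refine (((fderiv ℝ g q).continuous.tendsto w₀).comp hsnd).eventually (gt_mem_nhds ?_)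
    rw [hm]; linarith
  filter_upwards [hlin, hfst.eventually (Metric.ball_mem_nhds q (half_pos hr)),
    hfst.eventually hgfr, hsnd.eventually (Metric.ball_mem_nhds w₀ one_pos)]
    with p hp1 hp2 hp3 hp4 hpf t ht htτ
  obtain ⟨P, w⟩ := p
  simp only at hp1 hp2 hp3 hp4 hpf ⊢
  have hw : ‖w‖ ≤ ‖w₀‖ + 1 := by
    rw [dist_eq_norm] at hp4
    have := norm_sub_norm_le w w₀; linarith
  have htw : ‖t • w‖ ≤ r / 2 := by
    rw [norm_smul, Real.norm_of_nonneg ht.le]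
    calc t * ‖w‖ ≤ r / (2 * (‖w₀‖ + 1)) * (‖w₀‖ + 1) := by gcongr
      _ = r / 2 := by field_simp
  have hPt : P + t • w ∈ Metric.ball q r := by
    rw [dist_eq_norm] at hp2
    rw [Metric.mem_ball, dist_eq_norm]
    calc ‖P + t • w - q‖ = ‖(P - q) + t • w‖ := by congr 1; abel
      _ ≤ _ := norm_add_le _ _
      _ < r := by linarith
  have hP : P ∈ Metric.ball q r := Metric.ball_subset_ball (by linarith) hp2
  refine (hrU hPt).2.2 ?_
  have h1 := hUP _ (hrU hPt).1 _ (hrU hP).1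
  simp only [add_sub_cancel_left, hp3 hpf, sub_zero, map_smul, smul_eq_mul] at h1
  have h2 := (le_abs_self _).trans h1
  rw [norm_smul, Real.norm_of_nonneg ht.le] at h2
  have h3 : δ * (t * ‖w‖) ≤ t * (m / 4) := by
    calc δ * (t * ‖w‖) ≤ δ * (t * (‖w₀‖ + 1)) := by gcongr
      _ = t * (m / 4) := by rw [hδ]; field_simp
  nlinarith

end LocalParam

/-! ### Points outside the body bounded by a hypersurface -/

section Bodies

variable {m : ℕ} {S : Set (Euc m)}

/-- A full ray off `S` lies in the complementary component of `x`, which is therefore unbounded. -/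
theorem notMem_bodyOf_of_ray {x w : Euc m} (hw : w ≠ 0)
    (h : ∀ t : ℝ, 0 ≤ t → x + t • w ∉ S) : x ∉ bodyOf S := by
  have hx : x ∉ S := by simpa using h 0 le_rfl
  rintro (h' | ⟨-, hb⟩)
  · exact hx h'
  · have hconn : IsPreconnected ((fun t : ℝ => x + t • w) '' Ici 0) :=
      isPreconnected_Ici.image _ (by fun_prop)
    have hsub : (fun t : ℝ => x + t • w) '' Ici 0 ⊆ connectedComponentIn Sᶜ x :=
      hconn.subset_connectedComponentIn ⟨0, by simp, by simp⟩ (by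
        rintro _ ⟨t, ht, rfl⟩; exact h t ht)
    obtain ⟨R, hR⟩ := (hb.subset hsub).exists_norm_le
    have hw' : 0 < ‖w‖ := norm_pos_iff.2 hw
    have hR0 : 0 ≤ R := (norm_nonneg _).trans (hR (x + (0 : ℝ) • w) ⟨0, by simp, rfl⟩)
    have h1 := hR _ ⟨(R + ‖x‖ + 1) / ‖w‖, by simp only [mem_Ici]; positivity, rfl⟩
    have h2 : ‖((R + ‖x‖ + 1) / ‖w‖) • w‖ = R + ‖x‖ + 1 := by
      rw [norm_smul, norm_div, norm_norm, div_mul_cancel₀ _ hw'.ne',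
        Real.norm_of_nonneg (by positivity)]
    have h3 := norm_sub_le (x + ((R + ‖x‖ + 1) / ‖w‖) • w) x
    rw [add_sub_cancel_left, h2] at h3
    simp only at h1
    linarith

/-- From a point outside the ball, the radial ray never meets `S`. -/
theorem bodyOf_subset_closedBall {c : Euc m} {R : ℝ} (hR : 0 ≤ R)
    (hS : S ⊆ Metric.closedBall c R) : bodyOf S ⊆ Metric.closedBall c R := by
  intro x hx
  by_contra hxR
  rw [Metric.mem_closedBall, dist_eq_norm, not_le] at hxR
  refine notMem_bodyOf_of_ray (w := x - c) (norm_pos_iff.1 (hR.trans_lt hxR)) (fun t ht h => ?_) hx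
  have h1 := hS h
  have h2 : x + t • (x - c) - c = (1 + t) • (x - c) := by rw [add_smul, one_smul]; abel
  rw [Metric.mem_closedBall, dist_eq_norm, h2, norm_smul,
    Real.norm_of_nonneg (by linarith)] at h1
  nlinarith

end Bodies

/-! ### Directions of segments and the law of reflection -/

section Directions

variable {m : ℕ}

theorem norm_dir {x y : Euc m} (h : x ≠ y) : ‖dir x y‖ = 1 := by
  have : 0 < ‖y - x‖ := norm_pos_iff.2 (sub_ne_zero.2 h.symm)
  rw [dir, norm_smul, norm_inv, norm_norm, inv_mul_cancel₀ this.ne']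

theorem sub_eq_smul_dir {x y : Euc m} (h : x ≠ y) : y - x = ‖y - x‖ • dir x y := by
  have : 0 < ‖y - x‖ := norm_pos_iff.2 (sub_ne_zero.2 h.symm)
  rw [dir, smul_inv_smul₀ this.ne']

theorem eq_of_inner_eq_one {e e' : Euc m} (he : ‖e‖ = 1) (he' : ‖e'‖ = 1) (h : ⟪e, e'⟫ = 1) :
    e = e' :=
  (inner_eq_one_iff_of_norm_eq_one he he').1 h

theorem hasFDerivAt_norm_of_ne_zero {E : Type*} [NormedAddCommGroup E] [InnerProductSpace ℝ E]
    {x : E} (hx : x ≠ 0) : HasFDerivAt (fun x : E => ‖x‖) (‖x‖⁻¹ • innerSL ℝ x) x := by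
  have h1 := (hasStrictFDerivAt_norm_sq x).hasFDerivAt.sqrt
    (pow_ne_zero 2 (norm_ne_zero_iff.2 hx))
  have h2 : (fun x : E => √(‖x‖ ^ 2)) = fun x => ‖x‖ := by
    funext x; exact Real.sqrt_sq (norm_nonneg x)
  rw [h2] at h1
  refine h1.congr_fderiv ?_
  rw [Real.sqrt_sq (norm_nonneg x)]
  ext v
  simp only [smul_apply, innerSL_apply_apply, smul_eq_mul, nsmul_eq_mul]
  have : ‖x‖ ≠ 0 := norm_ne_zero_iff.2 hx
  field_simp
  norm_num

variable {X : Type*} [NormedAddCommGroup X] [NormedSpace ℝ X]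

theorem hasFDerivAt_dist {f g : X → Euc m} {f' g' : X →L[ℝ] Euc m} {x : X}
    (hf : HasFDerivAt f f' x) (hg : HasFDerivAt g g' x) (h : f x ≠ g x) :
    HasFDerivAt (fun x => dist (f x) (g x)) ((innerSL ℝ (dir (f x) (g x))).comp (g' - f')) x := by
  have h1 := (hasFDerivAt_norm_of_ne_zero (sub_ne_zero.2 h.symm)).comp x (hg.sub hf)
  have h2 : (fun x => dist (f x) (g x)) = (fun x : Euc m => ‖x‖) ∘ fun x => g x - f x := by
    funext x
    rw [dist_comm, dist_eq_norm]; rfl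
  rw [h2]
  refine h1.congr_fderiv ?_
  simp only [dir]
  rw [map_smul]

theorem contDiffAt_dir {f g : X → Euc m} {x : X} {n : WithTop ℕ∞}
    (hf : ContDiffAt ℝ n f x) (hg : ContDiffAt ℝ n g x) (h : f x ≠ g x) :
    ContDiffAt ℝ n (fun x => dir (f x) (g x)) x :=
  (((hg.sub hf).norm ℝ (sub_ne_zero.2 h.symm)).inv
    (norm_ne_zero_iff.2 (sub_ne_zero.2 h.symm))).smul (hg.sub hf)

/-- The derivative of the direction of a segment with moving end points. -/
theorem hasDerivAt_dir {f g : ℝ → Euc m} {v w : Euc m} {t : ℝ}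
    (hf : HasDerivAt f v t) (hg : HasDerivAt g w t) (h : f t ≠ g t) :
    HasDerivAt (fun t => dir (f t) (g t)) (‖g t - f t‖⁻¹ •
      ((w - v) - ⟪dir (f t) (g t), w - v⟫ • dir (f t) (g t))) t := by
  have hn0 : ‖g t - f t‖ ≠ 0 := norm_ne_zero_iff.2 (sub_ne_zero.2 h.symm)
  have h1 : HasDerivAt (fun t => ‖g t - f t‖) (‖g t - f t‖⁻¹ * ⟪g t - f t, w - v⟫) t := by
    exact (hasFDerivAt_norm_of_ne_zero (sub_ne_zero.2 h.symm)).comp_hasDerivAt t (hg.sub hf)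
  have h2 := (h1.inv hn0).smul (hg.sub hf)
  refine h2.congr_deriv ?_
  simp only [dir, Pi.sub_apply, Pi.inv_apply, real_inner_smul_left]
  rw [smul_smul, sub_eq_add_neg (w - v), ← neg_smul, smul_add, smul_smul]
  congr 2
  field_simp

/-- The law of reflection, from the vanishing of the derivative of the length. -/
theorem ReflectsAt.of_inner_eq_zero {d : ℕ} {S : Set (Euc (d + 1))} {q e e' : Euc (d + 1)}
    {ψ : Euc d → Euc (d + 1)} (hψ : IsLocalParam S q ψ) (he : ‖e‖ = 1) (he' : ‖e'‖ = 1)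
    (hne : e ≠ e') (h : ∀ u, ⟪e - e', fderiv ℝ ψ 0 u⟫ = 0) : ReflectsAt S q e e' := by
  have hn : 0 < ‖e - e'‖ := norm_pos_iff.2 (sub_ne_zero.2 hne)
  have h1 : 2 * ⟪e, e - e'⟫ = ‖e - e'‖ ^ 2 := by
    rw [norm_sub_sq_real, inner_sub_right, real_inner_self_eq_norm_sq, he, he']; ring
  refine ⟨‖e - e'‖⁻¹ • (e - e'), ?_, ⟨ψ, hψ, fun u => ?_⟩, ?_, ?_⟩
  · rw [norm_smul, norm_inv, norm_norm, inv_mul_cancel₀ hn.ne']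
  · rw [real_inner_smul_left, h, mul_zero]
  · rw [real_inner_smul_right]
    have : 0 < ⟪e, e - e'⟫ := by nlinarith [sq_pos_of_pos hn]
    positivity
  · rw [real_inner_smul_right, smul_smul]
    have : 2 * (‖e - e'‖⁻¹ * ⟪e, e - e'⟫) * ‖e - e'‖⁻¹ = 1 := by
      have h2 : 2 * (‖e - e'‖⁻¹ * ⟪e, e - e'⟫) * ‖e - e'‖⁻¹
        = (2 * ⟪e, e - e'⟫) * (‖e - e'‖⁻¹ * ‖e - e'‖⁻¹) := by ring
      rw [h2, h1]; field_simp
    rw [this, one_smul]; abel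

/-- Were `e` or `e'` tangent, orthogonality of `e - e'` to it would give `⟪e, e'⟫ = 1`, hence `e =
e'`. So a change of direction alone makes a critical reflection transversal. -/
theorem notMem_range_of_inner_eq_zero {d : ℕ} {A : Euc d →L[ℝ] Euc m} {e e' : Euc m}
    (he : ‖e‖ = 1) (he' : ‖e'‖ = 1) (hne : e ≠ e') (h : ∀ u, ⟪e - e', A u⟫ = 0) :
    e ∉ range A ∧ e' ∉ range A := by
  constructor
  · rintro ⟨u, rfl⟩
    have := h u
    rw [inner_sub_left, real_inner_self_eq_norm_sq, he, one_pow, real_inner_comm] at this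
    exact hne (eq_of_inner_eq_one he he' (by linarith))
  · rintro ⟨u, rfl⟩
    have := h u
    rw [inner_sub_left, real_inner_self_eq_norm_sq, he', one_pow] at this
    exact hne (eq_of_inner_eq_one he he' (by linarith))

end Directions

/-! ### Reflection sites -/

/-- A place where a trajectory is reflected: a parametrized piece of the boundary of the domain, or
(if `obst = some j`) of the hypersurface which, scaled down, bounds the `j`-th scatterer. -/
structure Site (d N : ℕ) where
  obst : Option (Fin N)
  param : Euc d → Euc (d + 1)

namespace Site

variable {d N : ℕ} (D : Set (Euc (d + 1))) (a : Fin N → Euc (d + 1))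
  (φ : Fin N → Sph d → Euc (d + 1))

/-- The centre of the scatterer. -/
def center (B : Site d N) : Euc (d + 1) := B.obst.elim 0 a

/-- The scaling factor. -/
def scale (B : Site d N) (ε : ℝ) : ℝ := B.obst.elim 1 fun _ => ε

/-- The reflection point with parameter `y`, for scatterers of size `ε`. -/
def pos (B : Site d N) (ε : ℝ) (y : Euc d) : Euc (d + 1) := B.center a + B.scale ε • B.param y

/-- The unscaled reflecting hypersurface. -/
def surface (B : Site d N) : Set (Euc (d + 1)) := B.obst.elim (frontier D) fun j => range (φ j)

/-- The parametrization of the site is a local parametrization of the hypersurface. -/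
def IsValid (B : Site d N) : Prop := IsLocalParam (B.surface D φ) (B.param 0) B.param

variable {D a φ} {B : Site d N}

theorem pos_wall (h : B.obst = none) (ε : ℝ) (y : Euc d) : B.pos a ε y = B.param y := by
  simp [pos, center, scale, h]

theorem pos_scatterer {j : Fin N} (h : B.obst = some j) (ε : ℝ) (y : Euc d) :
    B.pos a ε y = a j + ε • B.param y := by
  simp [pos, center, scale, h]

theorem surface_wall (h : B.obst = none) : B.surface D φ = frontier D := by simp [surface, h]

theorem surface_scatterer {j : Fin N} (h : B.obst = some j) : B.surface D φ = range (φ j) := by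
  simp [surface, h]

theorem scale_ne_zero (B : Site d N) {ε : ℝ} (hε : ε ≠ 0) : B.scale ε ≠ 0 := by
  cases h : B.obst <;> simp [scale, h, hε]

theorem contDiff_scale (B : Site d N) : ContDiff ℝ ∞ B.scale := by
  cases h : B.obst
  · have : B.scale = fun _ => 1 := by funext ε; simp [scale, h]
    rw [this]; exact contDiff_const
  · have : B.scale = fun ε => ε := by funext ε; simp [scale, h]
    rw [this]; exact contDiff_id

theorem contDiffAt_pos {X : Type*} [NormedAddCommGroup X]
    [NormedSpace ℝ X] {f : X → ℝ} {g : X → Euc d} {x : X} (hf : ContDiffAt ℝ ∞ f x)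
    (hg : ContDiffAt ℝ ∞ g x) (hgx : ContDiffAt ℝ ∞ B.param (g x)) :
    ContDiffAt ℝ ∞ (fun x => B.pos a (f x) (g x)) x :=
  contDiffAt_const.add ((B.contDiff_scale.contDiffAt.comp x hf).smul (hgx.comp x hg))

theorem IsValid.tendsto_pos (hB : B.IsValid D φ) :
    Tendsto (fun p : ℝ × Euc d => B.pos a p.1 p.2) (𝓝 (0, 0)) (𝓝 (B.pos a 0 0)) :=
  (contDiffAt_pos (x := ((0 : ℝ), (0 : Euc d))) (f := Prod.fst) (g := Prod.snd) contDiffAt_fst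
    contDiffAt_snd (IsLocalParam.contDiffAt hB)).continuousAt

/-- The filter of small positive scatterer sizes and parameters close to `0`. -/
abbrev smallFilter (d : ℕ) : Filter (ℝ × Euc d) := 𝓝[>] 0 ×ˢ 𝓝 0

theorem smallFilter_le : smallFilter d ≤ 𝓝 (0, 0) := by
  rw [nhds_prod_eq]
  exact Filter.prod_mono nhdsWithin_le_nhds le_rfl

theorem image_surface_wall (h : B.obst = none) (ε : ℝ) :
    (fun z => B.center a + B.scale ε • z) '' B.surface D φ = frontier D := by
  simp [center, scale, surface, h]

theorem image_surface_scatterer {j : Fin N} (h : B.obst = some j) (ε : ℝ) :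
    (fun z => B.center a + B.scale ε • z) '' B.surface D φ = scattererBoundary a φ ε j := by
  simp only [center, scale, surface, h, Option.elim_some, scattererBoundary, ← range_comp]
  rfl

theorem scattererBoundary_subset {R : ℝ} (hR : ∀ j x, ‖φ j x‖ ≤ R) {ε : ℝ} (hε : 0 ≤ ε)
    (j : Fin N) : scattererBoundary a φ ε j ⊆ Metric.closedBall (a j) (ε * R) := by
  rintro _ ⟨x, rfl⟩
  rw [Metric.mem_closedBall, dist_eq_norm, add_sub_cancel_left, norm_smul,
    Real.norm_of_nonneg hε]
  exact mul_le_mul_of_nonneg_left (hR j x) hε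

theorem isCompact_scattererBoundary (hφ : ∀ j, Continuous (φ j)) (ε : ℝ) (j : Fin N) :
    IsCompact (scattererBoundary a φ ε j) :=
  isCompact_range (continuous_const.add ((hφ j).const_smul ε))

theorem eventually_lt_dist {α : Type*} {l : Filter α} {f : α → ℝ} {g : α → Euc (d + 1)}
    {x : Euc (d + 1)} (hf : Tendsto f l (𝓝 0)) (hg : Tendsto g l (𝓝 x)) (R : ℝ)
    {b : Euc (d + 1)} (hb : x ≠ b) : ∀ᶠ p in l, f p * R < dist (g p) b := by
  have h1 : Tendsto (fun p => f p * R) l (𝓝 0) := by simpa using hf.mul_const R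
  exact h1.eventually_lt (hg.dist tendsto_const_nhds) (by simpa using hb)

theorem IsValid.pos_zero_mem (hB : B.IsValid D φ) (h : B.obst = none) :
    B.pos a 0 0 ∈ frontier D := by
  rw [pos_wall h, ← surface_wall (φ := φ) h]
  exact (IsLocalParam.eventually_mem hB).self_of_nhds

theorem IsValid.pos_zero_ne (hDo : IsOpen D) (haD : ∀ j, a j ∈ D) (ha : Function.Injective a)
    (hB : B.IsValid D φ) {j : Fin N} (h : B.obst ≠ some j) : B.pos a 0 0 ≠ a j := by
  cases h' : B.obst with
  | none =>
    intro h0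
    have := hB.pos_zero_mem (a := a) h'
    rw [h0, hDo.frontier_eq] at this
    exact this.2 (haD j)
  | some i =>
    rw [pos_scatterer h', zero_smul, add_zero]
    exact fun h0 => h (by rw [h', ha h0])

/-- The parametrization of the walls near a reflection point. -/
theorem IsValid.eventually_isLocalParam_walls (hDo : IsOpen D) (haD : ∀ j, a j ∈ D)
    (ha : Function.Injective a) (hφ : ∀ j, Continuous (φ j)) {R : ℝ}
    (hR : ∀ j x, ‖φ j x‖ ≤ R) (hB : B.IsValid D φ) :
    ∀ᶠ p : ℝ × Euc d in smallFilter d,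
      IsLocalParam (walls D a φ p.1) (B.pos a p.1 p.2) (fun z => B.pos a p.1 (p.2 + z)) := by
  have hloc : ∀ᶠ p : ℝ × Euc d in smallFilter d,
      IsLocalParam (B.surface D φ) (B.param p.2) (fun z => B.param (p.2 + z)) :=
    tendsto_snd.eventually (IsLocalParam.eventually_translate hB)
  have hpos : ∀ᶠ p : ℝ × Euc d in smallFilter d, 0 < p.1 :=
    tendsto_fst.eventually self_mem_nhdsWithin
  have hfst : Tendsto (fun p : ℝ × Euc d => p.1) (smallFilter d) (𝓝 0) :=
    tendsto_fst.mono_right nhdsWithin_le_nhds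
  have hposs := (hB.tendsto_pos (a := a)).mono_left (smallFilter_le (d := d))
  -- The other scatterers shrink to points `a j` different from the limit position, so near the
  -- reflection point the walls consist of a single hypersurface.
  have haway : ∀ᶠ p : ℝ × Euc d in smallFilter d, ∀ j, B.obst ≠ some j →
      B.pos a p.1 p.2 ∉ scattererBoundary a φ p.1 j := by
    rw [eventually_all]
    intro j
    by_cases h : B.obst = some j
    · exact Eventually.of_forall fun p h' => absurd h h'
    · filter_upwards [eventually_lt_dist hfst hposs R (hB.pos_zero_ne hDo haD ha h), hpos]
        with p hp hp0 _ hmem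
      exact absurd (scattererBoundary_subset hR hp0.le j hmem) (by
        rw [Metric.mem_closedBall]; exact not_le.2 hp)
  have hD : ∀ᶠ p : ℝ × Euc d in smallFilter d, B.obst ≠ none → B.pos a p.1 p.2 ∈ D := by
    cases h : B.obst with
    | none => simp
    | some j =>
      have : B.pos a 0 0 ∈ D := by rw [pos_scatterer h]; simpa using haD j
      filter_upwards [hposs.eventually (hDo.mem_nhds this)] with p hp _ using hp
  filter_upwards [hloc, hpos, haway, hD] with p hp hp0 hpaway hpD
  have h1 := hp.add_smul (B.center a) (B.scale_ne_zero hp0.ne')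
  have hcl : ∀ s : Set (Fin N), IsClosed (⋃ j ∈ s, scattererBoundary a φ p.1 j) := fun s =>
    (Set.toFinite s).isClosed_biUnion fun j _ => (isCompact_scattererBoundary hφ _ j).isClosed
  cases h : B.obst with
  | none =>
    rw [image_surface_wall h] at h1
    have h2 := h1.union_of_isClosed (hcl univ) (by
      simp only [mem_univ, iUnion_true, mem_iUnion, not_exists]
      exact fun j => hpaway j (by simp [h]))
    simp only [mem_univ, iUnion_true] at h2
    exact h2
  | some j =>
    rw [image_surface_scatterer h] at h1
    have h2 := h1.union_of_isClosed (S' := frontier D ∪ ⋃ i ∈ ({j}ᶜ : Set (Fin N)),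
      scattererBoundary a φ p.1 i) (isClosed_frontier.union (hcl _)) (by
        rintro (h3 | h3)
        · rw [hDo.frontier_eq] at h3
          exact h3.2 (hpD (by simp [h]))
        · simp only [mem_iUnion] at h3
          obtain ⟨i, hi, h3⟩ := h3
          refine hpaway i (fun h4 => hi ?_) h3
          rw [h] at h4
          exact (Option.some.inj h4).symm)
    have h3 : walls D a φ p.1 = scattererBoundary a φ p.1 j ∪
        (frontier D ∪ ⋃ i ∈ ({j}ᶜ : Set (Fin N)), scattererBoundary a φ p.1 i) := by
      ext z
      simp only [walls, mem_union, mem_iUnion, mem_compl_iff, mem_singleton_iff, exists_prop]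
      constructor
      · rintro (h | ⟨i, hi⟩)
        · exact Or.inr (Or.inl h)
        · rcases eq_or_ne i j with rfl | hij
          · exact Or.inl hi
          · exact Or.inr (Or.inr ⟨i, hij, hi⟩)
      · rintro (h | h | ⟨i, -, hi⟩)
        · exact Or.inr ⟨j, h⟩
        · exact Or.inl h
        · exact Or.inr ⟨i, hi⟩
    rw [h3]
    exact h2

/-- The half of a segment adjacent to a reflection point stays in the billiard table. -/
theorem IsValid.eventually_segment_subset (hDo : IsOpen D) (hDs : HasSmoothBoundary D)
    (haD : ∀ j, a j ∈ D) (ha : Function.Injective a) (hφ : ∀ j, Continuous (φ j)) {R : ℝ}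
    (hR : ∀ j x, ‖φ j x‖ ≤ R) (hB : B.IsValid D φ) {Q₀ : Euc (d + 1)}
    (htr : Q₀ - B.pos a 0 0 ∉ range (fderiv ℝ B.param 0))
    (hseg : openSegment ℝ (B.pos a 0 0) Q₀ ⊆ D)
    (hav : ∀ j, a j ∉ openSegment ℝ (B.pos a 0 0) Q₀)
    (hray : ∀ j, B.obst = some j → ∀ t : ℝ, 0 < t →
      B.param 0 + t • (Q₀ - B.pos a 0 0) ∉ range (φ j)) :
    ∀ᶠ p : (ℝ × Euc d) × Euc (d + 1) in smallFilter d ×ˢ 𝓝 Q₀, ∀ t : ℝ, 0 < t → t ≤ 1 / 2 →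
      B.pos a p.1.1 p.1.2 + t • (p.2 - B.pos a p.1.1 p.1.2) ∈ table D a φ p.1.1 := by
  set P₀ := B.pos a 0 0 with hP₀
  set w₀ := Q₀ - P₀ with hw₀
  have hw0 : w₀ ≠ 0 := fun h0 => htr ⟨0, by rw [map_zero, h0]⟩
  set l : Filter ((ℝ × Euc d) × Euc (d + 1)) := smallFilter d ×ˢ 𝓝 Q₀ with hl
  have hpos : ∀ᶠ p in l, 0 < p.1.1 :=
    (tendsto_fst.comp tendsto_fst).eventually self_mem_nhdsWithin
  have hε : Tendsto (fun p : (ℝ × Euc d) × Euc (d + 1) => p.1.1) l (𝓝 0) :=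
    (tendsto_fst.comp tendsto_fst).mono_right nhdsWithin_le_nhds
  have hy : Tendsto (fun p : (ℝ × Euc d) × Euc (d + 1) => p.1.2) l (𝓝 0) :=
    tendsto_snd.comp tendsto_fst
  have hP : Tendsto (fun p : (ℝ × Euc d) × Euc (d + 1) => B.pos a p.1.1 p.1.2) l (𝓝 P₀) :=
    ((hB.tendsto_pos (a := a)).mono_left smallFilter_le).comp tendsto_fst
  have hw : Tendsto (fun p : (ℝ × Euc d) × Euc (d + 1) => p.2 - B.pos a p.1.1 p.1.2) l (𝓝 w₀) :=
    tendsto_snd.sub hP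
  have hmem : ∀ t : ℝ, 0 < t → t ≤ 1 / 2 → P₀ + t • w₀ ∈ openSegment ℝ P₀ Q₀ := by
    intro t ht ht'
    rw [openSegment_eq_image']
    exact ⟨t, ⟨ht, by linarith⟩, rfl⟩
  -- Only at a wall is the start delicate; a scatterer lies well inside the open set `D`.
  have hnear : ∃ τ > 0, ∀ᶠ p in l, ∀ t : ℝ, 0 < t → t ≤ τ →
      B.pos a p.1.1 p.1.2 + t • (p.2 - B.pos a p.1.1 p.1.2) ∈ D := by
    cases h : B.obst with
    | none =>
      have hBp : ∀ ε y, B.pos a ε y = B.param y := pos_wall h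
      have hB' : IsLocalParam (frontier D) P₀ B.param := by
        have := hB
        rwa [IsValid, surface_wall h, ← hBp 0 0] at this
      obtain ⟨τ, hτ, hτD⟩ := hB'.eventually_mem_domain hDo hDs htr (by
        have : Ioc (0 : ℝ) (1 / 2) ∈ 𝓝[>] 0 := Ioc_mem_nhdsGT (by norm_num)
        filter_upwards [this] with t ht
        exact hseg (hmem t ht.1 ht.2))
      refine ⟨τ, hτ, ?_⟩
      filter_upwards [(hP.prodMk_nhds hw).eventually hτD, hy.eventually hB'.eventually_mem]
        with p hp hpf t ht htτ
      refine hp ?_ t ht htτ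
      rw [hBp]; exact hpf
    | some j =>
      have hPD : P₀ ∈ D := by rw [hP₀, pos_scatterer h]; simpa using haD j
      have h1 : ∀ᶠ x : (Euc (d + 1) × Euc (d + 1)) × ℝ in 𝓝 ((P₀, w₀), 0),
          x.1.1 + x.2 • x.1.2 ∈ D := by
        have : Tendsto (fun x : (Euc (d + 1) × Euc (d + 1)) × ℝ => x.1.1 + x.2 • x.1.2)
            (𝓝 ((P₀, w₀), 0)) (𝓝 P₀) := Continuous.tendsto' (by fun_prop) _ _ (by simp)
        exact this.eventually (hDo.mem_nhds hPD)
      rw [nhds_prod_eq] at h1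
      obtain ⟨pa, hpa, pb, hpb, h2⟩ := eventually_prod_iff.1 h1
      obtain ⟨τ, hτ, hτb⟩ := Metric.eventually_nhds_iff.1 hpb
      refine ⟨τ / 2, half_pos hτ, ?_⟩
      filter_upwards [(hP.prodMk_nhds hw).eventually hpa] with p hp t ht htτ
      refine h2 hp (hτb ?_)
      rw [dist_zero_right, Real.norm_of_nonneg ht.le]
      linarith
  obtain ⟨τ, hτ, hτD⟩ := hnear
  have hmid : ∀ᶠ p in l, ∀ t ∈ Icc τ (1 / 2),
      B.pos a p.1.1 p.1.2 + t • (p.2 - B.pos a p.1.1 p.1.2) ∈ D := by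
    have h1 : ∀ᶠ x : Euc (d + 1) × Euc (d + 1) in 𝓝 (P₀, w₀), ∀ t ∈ Icc τ (1 / 2),
        x.1 + t • x.2 ∈ D := by
      refine isCompact_Icc.eventually_forall_of_forall_eventually fun t ht => ?_
      have : Tendsto (fun x : (Euc (d + 1) × Euc (d + 1)) × ℝ => x.1.1 + x.2 • x.1.2)
          (𝓝 ((P₀, w₀), t)) (𝓝 (P₀ + t • w₀)) := Continuous.tendsto' (by fun_prop) _ _ (by simp)
      exact this.eventually (hDo.mem_nhds (hseg (hmem t (hτ.trans_le ht.1) ht.2)))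
    exact (hP.prodMk_nhds hw).eventually h1
  have haway : ∀ᶠ p in l, ∀ j, B.obst ≠ some j → ∀ t ∈ Icc (0 : ℝ) (1 / 2),
      B.pos a p.1.1 p.1.2 + t • (p.2 - B.pos a p.1.1 p.1.2) ∉
        Metric.closedBall (a j) (p.1.1 * R) := by
    rw [eventually_all]
    intro j
    by_cases h : B.obst = some j
    · exact Eventually.of_forall fun p h' => absurd h h'
    · have h1 : ∀ᶠ x : ℝ × Euc (d + 1) × Euc (d + 1) in 𝓝 (0, P₀, w₀), ∀ t ∈ Icc (0 : ℝ) (1 / 2),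
          x.1 * R < dist (x.2.1 + t • x.2.2) (a j) := by
        refine isCompact_Icc.eventually_forall_of_forall_eventually fun t ht => ?_
        have h2 : Tendsto (fun x : (ℝ × Euc (d + 1) × Euc (d + 1)) × ℝ => x.1.2.1 + x.2 • x.1.2.2)
            (𝓝 ((0, P₀, w₀), t)) (𝓝 (P₀ + t • w₀)) :=
          Continuous.tendsto' (by fun_prop) _ _ (by simp)
        have h3 : Tendsto (fun x : (ℝ × Euc (d + 1) × Euc (d + 1)) × ℝ => x.1.1)
            (𝓝 ((0, P₀, w₀), t)) (𝓝 0) :=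
          Continuous.tendsto' (by fun_prop) _ _ (by simp)
        refine eventually_lt_dist h3 h2 R fun h4 => ?_
        rcases ht.1.eq_or_lt with rfl | ht0
        · refine hB.pos_zero_ne hDo haD ha h ?_
          simpa using h4
        · exact hav j (h4 ▸ hmem t ht0 ht.2)
      filter_upwards [(hε.prodMk_nhds (hP.prodMk_nhds hw)).eventually h1] with p hp _ t ht
      rw [Metric.mem_closedBall, not_le]
      exact hp t ht
  -- Rescaling by `ε` turns time `t` into `t / ε` on the unscaled hypersurface. These times are
  -- unbounded as `ε → 0`, so the ray statement is needed for all positive times.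
  have hself : ∀ᶠ p in l, ∀ j, B.obst = some j → ∀ t : ℝ, 0 < t →
      B.pos a p.1.1 p.1.2 + t • (p.2 - B.pos a p.1.1 p.1.2) ∉ scattererBoundary a φ p.1.1 j := by
    rw [eventually_all]
    intro j
    by_cases h : B.obst = some j
    · have hB' : IsLocalParam (range (φ j)) (B.param 0) B.param := by
        have := hB
        rwa [IsValid, surface_scatterer h] at this
      have h1 := hB'.eventually_ray_notMem (isCompact_range (hφ j)) htr (hray j h)
      filter_upwards [(hy.prodMk_nhds hw).eventually h1, hpos] with p hp hp0 _ t ht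
      rintro ⟨x, hx⟩
      refine hp (t / p.1.1) (by positivity) ⟨x, ?_⟩
      refine smul_right_injective _ hp0.ne' ?_
      simp only [pos_scatterer h] at hx ⊢
      rw [smul_add, smul_smul, mul_div_cancel₀ _ hp0.ne']
      rwa [add_assoc, add_right_inj] at hx
    · exact Eventually.of_forall fun p h' => absurd h' h
  have hwne : ∀ᶠ p in l, p.2 - B.pos a p.1.1 p.1.2 ≠ 0 := hw.eventually_ne hw0
  filter_upwards [hτD, hmid, haway, hself, hpos, hwne] with p h1 h2 h3 h4 hp0 hpw t ht ht'
  refine ⟨?_, ?_⟩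
  · rcases le_total t τ with htτ | htτ
    · exact h1 t ht htτ
    · exact h2 t ⟨htτ, ht'⟩
  · rw [mem_iUnion]
    rintro ⟨j, hj⟩
    by_cases h : B.obst = some j
    -- The ray prolonging the segment avoids the scatterer's boundary forever, so no point of it
    -- lies inside the scatterer.
    · refine notMem_bodyOf_of_ray hpw (fun s hs => ?_) hj
      rw [add_assoc, ← add_smul]
      exact h4 j h _ (by linarith)
    · have hR0 : 0 ≤ p.1.1 * R := by
        by_contra hneg
        have h5 := scattererBoundary_subset (a := a) hR hp0.le j
        rcases (scattererBoundary a φ p.1.1 j).eq_empty_or_nonempty with h6 | h6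
        · rw [bodyOf, h6] at hj
          rcases hj with hj | ⟨-, hj⟩
          · exact hj
          · refine notMem_bodyOf_of_ray (S := (∅ : Set (Euc (d + 1)))) hpw (fun _ _ => by simp)
              (Or.inr ⟨by simp, hj⟩)
        · rw [Metric.closedBall_eq_empty.2 (not_le.1 hneg)] at h5
          exact h6.ne_empty (subset_empty_iff.1 h5)
      exact h3 j h t ⟨ht.le, ht'⟩
        (bodyOf_subset_closedBall hR0 (scattererBoundary_subset hR hp0.le j) hj)

end Site

/-! ### The law of reflection as a smooth three-term equation, and its linearization -/

theorem contDiffAt_innerSL {X E : Type*} [NormedAddCommGroup X] [NormedSpace ℝ X]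
    [NormedAddCommGroup E] [InnerProductSpace ℝ E] {f : X → E} {x : X} {n : WithTop ℕ∞}
    (hf : ContDiffAt ℝ n f x) : ContDiffAt ℝ n (fun x => innerSL ℝ (f x)) x :=
  ((innerSL ℝ : E →L[ℝ] E →L[ℝ] ℝ).contDiff.contDiffAt).comp x hf

/-- A three-term recurrence relation with invertible extreme coefficients. -/
theorem exists_transfer {V W : Type*} [NormedAddCommGroup V] [NormedSpace ℝ V]
    [FiniteDimensional ℝ V] [NormedAddCommGroup W] [NormedSpace ℝ W] [FiniteDimensional ℝ W]
    (hVW : Module.finrank ℝ V = Module.finrank ℝ W) (A : V × V × V →L[ℝ] W)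
    (h1 : ∀ u, A (u, 0, 0) = 0 → u = 0) (h2 : ∀ r, A (0, 0, r) = 0 → r = 0) :
    ∃ T : (V × V) ≃ₗ[ℝ] (V × V), ∀ ξ η, T ξ = η ↔ η.1 = ξ.2 ∧ A (ξ.1, ξ.2, η.2) = 0 := by
  let c : V →ₗ[ℝ] W := A.toLinearMap ∘ₗ LinearMap.inr ℝ V (V × V) ∘ₗ LinearMap.inr ℝ V V
  have hc : ∀ r, c r = A (0, 0, r) := fun r => rfl
  have hcinj : Function.Injective c := (injective_iff_map_eq_zero c).2 h2
  let e : V ≃ₗ[ℝ] W := LinearEquiv.ofBijective c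
    ⟨hcinj, (LinearMap.injective_iff_surjective_of_finrank_eq_finrank hVW).1 hcinj⟩
  have he : ∀ r, e r = A (0, 0, r) := fun r => rfl
  let b : V × V →ₗ[ℝ] W := A.toLinearMap ∘ₗ
    ((LinearMap.fst ℝ V V).prod ((LinearMap.snd ℝ V V).prod 0))
  have hb : ∀ ξ, b ξ = A (ξ.1, ξ.2, 0) := fun ξ => rfl
  let f : V × V →ₗ[ℝ] V × V := (LinearMap.snd ℝ V V).prod (-(e.symm.toLinearMap ∘ₗ b))
  have hf : ∀ ξ η, f ξ = η ↔ η.1 = ξ.2 ∧ A (ξ.1, ξ.2, η.2) = 0 := by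
    intro ξ η
    have h3 : f ξ = (ξ.2, -e.symm (b ξ)) := rfl
    have h4 : A (ξ.1, ξ.2, η.2) = b ξ + e η.2 := by
      rw [hb, he, ← map_add]; simp
    rw [h3, Prod.ext_iff, h4]
    simp only
    constructor
    · rintro ⟨h5, h6⟩
      exact ⟨h5.symm, by rw [← h6, map_neg, e.apply_symm_apply, add_neg_cancel]⟩
    · rintro ⟨h5, h6⟩
      refine ⟨h5.symm, ?_⟩
      rw [← map_neg, LinearEquiv.symm_apply_eq]
      exact neg_eq_of_add_eq_zero_right h6
  have hfinj : Function.Injective f := by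
    rw [injective_iff_map_eq_zero]
    intro ξ hξ
    obtain ⟨h5, h6⟩ := (hf ξ 0).1 hξ
    have h5 : ξ.2 = 0 := h5.symm
    rw [h5] at h6
    exact Prod.ext (h1 _ h6) h5
  exact ⟨LinearEquiv.ofInjectiveEndo f hfinj, fun ξ η => hf ξ η⟩

namespace Site

variable {d N : ℕ} (D : Set (Euc (d + 1))) (a : Fin N → Euc (d + 1))
  (φ : Fin N → Sph d → Euc (d + 1))

/-- The defect of the law of reflection at the site `B`, for a trajectory coming from the site `A`
and going to the site `C`, as a function of the scatterer size and the three parameters. -/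
noncomputable def mirror (A B C : Site d N) (p : ℝ × Euc d × Euc d × Euc d) : Euc d →L[ℝ] ℝ :=
  (innerSL ℝ (dir (A.pos a p.1 p.2.1) (B.pos a p.1 p.2.2.1) -
    dir (B.pos a p.1 p.2.2.1) (C.pos a p.1 p.2.2.2))).comp (fderiv ℝ B.param p.2.2.1)

/-- The partial derivative of `mirror` with respect to the parameters. -/
noncomputable def mirrorDeriv (A B C : Site d N) (p : ℝ × Euc d × Euc d × Euc d) :
    Euc d × Euc d × Euc d →L[ℝ] (Euc d →L[ℝ] ℝ) :=
  (fderiv ℝ (mirror a A B C) p).comp (ContinuousLinearMap.inr ℝ ℝ _)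

/-- The configuration with parameters `p` is nondegenerate: the parametrizations are smooth and
the trajectory has corners. -/
structure IsRegularAt (A B C : Site d N) (p : ℝ × Euc d × Euc d × Euc d) : Prop where
  smooth_left : ContDiffAt ℝ ∞ A.param p.2.1
  smooth_mid : ContDiffAt ℝ ∞ B.param p.2.2.1
  smooth_right : ContDiffAt ℝ ∞ C.param p.2.2.2
  ne_left : A.pos a p.1 p.2.1 ≠ B.pos a p.1 p.2.2.1
  ne_right : B.pos a p.1 p.2.2.1 ≠ C.pos a p.1 p.2.2.2
  dir_ne : dir (A.pos a p.1 p.2.1) (B.pos a p.1 p.2.2.1) ≠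
    dir (B.pos a p.1 p.2.2.1) (C.pos a p.1 p.2.2.2)

/-- Three successive reflection points of a trajectory in the limit of point scatterers. -/
structure IsLimitTriple (A B C : Site d N) : Prop where
  valid_left : A.IsValid D φ
  valid_mid : B.IsValid D φ
  valid_right : C.IsValid D φ
  regular : IsRegularAt a A B C 0
  mirror_zero : mirror a A B C 0 = 0

variable {D a φ} {A B C : Site d N} {p : ℝ × Euc d × Euc d × Euc d}

theorem IsRegularAt.contDiffAt_left (h : IsRegularAt a A B C p) :
    ContDiffAt ℝ ∞ (fun p : ℝ × Euc d × Euc d × Euc d => A.pos a p.1 p.2.1) p :=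
  contDiffAt_pos (f := fun p : ℝ × Euc d × Euc d × Euc d => p.1) (g := fun p => p.2.1)
    contDiffAt_fst contDiffAt_snd.fst h.smooth_left

theorem IsRegularAt.contDiffAt_mid (h : IsRegularAt a A B C p) :
    ContDiffAt ℝ ∞ (fun p : ℝ × Euc d × Euc d × Euc d => B.pos a p.1 p.2.2.1) p :=
  contDiffAt_pos (f := fun p : ℝ × Euc d × Euc d × Euc d => p.1) (g := fun p => p.2.2.1)
    contDiffAt_fst contDiffAt_snd.snd.fst h.smooth_mid

theorem IsRegularAt.contDiffAt_right (h : IsRegularAt a A B C p) :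
    ContDiffAt ℝ ∞ (fun p : ℝ × Euc d × Euc d × Euc d => C.pos a p.1 p.2.2.2) p :=
  contDiffAt_pos (f := fun p : ℝ × Euc d × Euc d × Euc d => p.1) (g := fun p => p.2.2.2)
    contDiffAt_fst contDiffAt_snd.snd.snd h.smooth_right

theorem IsRegularAt.contDiffAt_mirror (h : IsRegularAt a A B C p) :
    ContDiffAt ℝ ∞ (mirror a A B C) p := by
  refine (contDiffAt_innerSL ((contDiffAt_dir h.contDiffAt_left h.contDiffAt_mid h.ne_left).sub
    (contDiffAt_dir h.contDiffAt_mid h.contDiffAt_right h.ne_right))).clm_comp ?_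
  have h1 : ContDiffAt ℝ ∞ (fderiv ℝ B.param) p.2.2.1 := h.smooth_mid.fderiv_right (by simp)
  exact h1.comp p contDiffAt_snd.snd.fst

theorem IsRegularAt.differentiableAt_mirror (h : IsRegularAt a A B C p) :
    DifferentiableAt ℝ (mirror a A B C) p := h.contDiffAt_mirror.differentiableAt (by simp)

theorem IsRegularAt.hasStrictFDerivAt_mirror (h : IsRegularAt a A B C p) :
    HasStrictFDerivAt (mirror a A B C) (fderiv ℝ (mirror a A B C) p) p :=
  h.contDiffAt_mirror.hasStrictFDerivAt (by simp)

theorem IsRegularAt.eventually_ne_left (h : IsRegularAt a A B C p) :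
    ∀ᶠ p' : ℝ × Euc d × Euc d × Euc d in 𝓝 p, A.pos a p'.1 p'.2.1 ≠ B.pos a p'.1 p'.2.2.1 :=
  h.contDiffAt_left.continuousAt.ne_iff_eventually_ne h.contDiffAt_mid.continuousAt |>.1 h.ne_left

theorem IsRegularAt.eventually_ne_right (h : IsRegularAt a A B C p) :
    ∀ᶠ p' : ℝ × Euc d × Euc d × Euc d in 𝓝 p, B.pos a p'.1 p'.2.2.1 ≠ C.pos a p'.1 p'.2.2.2 :=
  h.contDiffAt_mid.continuousAt.ne_iff_eventually_ne h.contDiffAt_right.continuousAt |>.1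
    h.ne_right

theorem IsLimitTriple.eventually_regular (h : IsLimitTriple D a φ A B C) :
    ∀ᶠ p in 𝓝 0, IsRegularAt a A B C p := by
  have hr := h.regular
  have t1 : Tendsto (fun p : ℝ × Euc d × Euc d × Euc d => p.2.1) (𝓝 0) (𝓝 0) :=
    Continuous.tendsto' (by fun_prop) _ _ rfl
  have t2 : Tendsto (fun p : ℝ × Euc d × Euc d × Euc d => p.2.2.1) (𝓝 0) (𝓝 0) :=
    Continuous.tendsto' (by fun_prop) _ _ rfl
  have t3 : Tendsto (fun p : ℝ × Euc d × Euc d × Euc d => p.2.2.2) (𝓝 0) (𝓝 0) :=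
    Continuous.tendsto' (by fun_prop) _ _ rfl
  have hd := (contDiffAt_dir hr.contDiffAt_left hr.contDiffAt_mid
    hr.ne_left).continuousAt.ne_iff_eventually_ne (contDiffAt_dir hr.contDiffAt_mid
    hr.contDiffAt_right hr.ne_right).continuousAt |>.1 hr.dir_ne
  filter_upwards [t1.eventually (IsLocalParam.smooth h.valid_left),
    t2.eventually (IsLocalParam.smooth h.valid_mid),
    t3.eventually (IsLocalParam.smooth h.valid_right), hr.eventually_ne_left,
    hr.eventually_ne_right, hd] with p h1 h2 h3 h4 h5 h6
  exact ⟨h1, h2, h3, h4, h5, h6⟩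

/-- Strict differentiability in all variables, applied to two points with the same `ε`: the
derivative at `ε = 0` serves for all small `ε`, as the contraction argument requires. -/
theorem IsLimitTriple.eventually_approx (h : IsLimitTriple D a φ A B C) {δ : ℝ} (hδ : 0 < δ) :
    ∀ᶠ x : ℝ × (Euc d × Euc d × Euc d) × (Euc d × Euc d × Euc d) in 𝓝 0,
      ‖mirror a A B C (x.1, x.2.1) - mirror a A B C (x.1, x.2.2) -
        mirrorDeriv a A B C 0 (x.2.1 - x.2.2)‖ ≤ δ * ‖x.2.1 - x.2.2‖ := by
  have h1 := h.regular.hasStrictFDerivAt_mirror.eventually_norm_sub_le hδ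
  have h2 : Tendsto (fun x : ℝ × (Euc d × Euc d × Euc d) × (Euc d × Euc d × Euc d) =>
      ((x.1, x.2.1), (x.1, x.2.2))) (𝓝 0) (𝓝 (0, 0)) := Continuous.tendsto' (by fun_prop) _ _ rfl
  filter_upwards [h2.eventually h1] with x hx
  have h3 : ((x.1, x.2.1) : ℝ × Euc d × Euc d × Euc d) - (x.1, x.2.2) = (0, x.2.1 - x.2.2) := by
    rw [Prod.mk_sub_mk, sub_self]
  simp only [h3] at hx
  have h4 : ‖((0, x.2.1 - x.2.2) : ℝ × Euc d × Euc d × Euc d)‖ = ‖x.2.1 - x.2.2‖ := by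
    rw [Prod.norm_def]; simp
  rw [h4] at hx
  exact hx

/-- The unperturbed chain solves the equations up to `O(ε)`; this is the source of the shadowing
precision. -/
theorem IsLimitTriple.exists_bound (h : IsLimitTriple D a φ A B C) :
    ∃ c > 0, ∀ᶠ ε : ℝ in 𝓝 0, ‖mirror a A B C (ε, 0)‖ ≤ c * |ε| := by
  obtain ⟨c, hc, h1⟩ := h.regular.hasStrictFDerivAt_mirror.eventually_lipschitz
  refine ⟨c, hc, ?_⟩
  have h2 : Tendsto (fun ε : ℝ => ((ε, (0 : Euc d × Euc d × Euc d)),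
      (0 : ℝ × Euc d × Euc d × Euc d))) (𝓝 0) (𝓝 (0, 0)) :=
    Continuous.tendsto' (by fun_prop) _ _ rfl
  filter_upwards [h2.eventually h1] with ε hε
  simp only [h.mirror_zero, sub_zero] at hε
  have h4 : ‖((ε, 0) : ℝ × Euc d × Euc d × Euc d)‖ = |ε| := by
    rw [Prod.norm_def]; simp
  rwa [h4] at hε

theorem IsLimitTriple.eventually_deriv_near (h : IsLimitTriple D a φ A B C) {δ : ℝ} (hδ : 0 < δ) :
    ∀ᶠ p in 𝓝 0, ‖mirrorDeriv a A B C p - mirrorDeriv a A B C 0‖ ≤ δ := by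
  have h1 : ContinuousAt (fderiv ℝ (mirror a A B C)) 0 :=
    (h.regular.contDiffAt_mirror.fderiv_right (m := 0) (by simp)).continuousAt
  have h2 : ContinuousAt (mirrorDeriv a A B C) 0 := h1.clm_comp continuousAt_const
  filter_upwards [(Metric.continuousAt_iff' (f := mirrorDeriv a A B C)).1 h2 δ hδ] with p hp
  exact (dist_eq_norm (mirrorDeriv a A B C p) (mirrorDeriv a A B C 0)).symm.trans_le hp.le

/-- The variational equation is the linearization of the law of reflection. -/
theorem IsRegularAt.variationalEq_iff {ε : ℝ} (hε : ε ≠ 0) {x y z : Euc d}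
    (h : IsRegularAt a A B C (ε, x, y, z)) (u w r : Euc d) :
    VariationalEq (fun v => A.pos a ε (x + v)) (fun v => B.pos a ε (y + v))
      (fun v => C.pos a ε (z + v)) u w r ↔ mirrorDeriv a A B C (ε, x, y, z) (u, w, r) = 0 := by
  have hlim : Tendsto (fun X : Euc d × Euc d × Euc d => (ε, (x, y, z) + X)) (𝓝 0)
      (𝓝 (ε, x, y, z)) := Continuous.tendsto' (by fun_prop) _ _ (by simp)
  have hy : Tendsto (fun X : Euc d × Euc d × Euc d => y + X.2.1) (𝓝 0) (𝓝 y) :=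
    Continuous.tendsto' (by fun_prop) _ _ (by simp)
  -- The gradient of the length in the middle parameter is `mirror` times the scale of the site, a
  -- nonzero constant that does not affect the kernel.
  have hev : (fun X : Euc d × Euc d × Euc d => fderiv ℝ (fun v : Euc d =>
      dist (A.pos a ε (x + X.1)) (B.pos a ε (y + v)) +
        dist (B.pos a ε (y + v)) (C.pos a ε (z + X.2.2))) X.2.1) =ᶠ[𝓝 0]
      fun X => B.scale ε • mirror a A B C (ε, (x, y, z) + X) := by
    have hsm : ∀ᶠ y' in 𝓝 y, ContDiffAt ℝ 1 B.param y' :=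
      (h.smooth_mid.of_le (by simp)).eventually (by simp)
    filter_upwards [hlim.eventually h.eventually_ne_left, hlim.eventually h.eventually_ne_right,
      hy.eventually hsm] with X h1 h2 h3
    have h4 : HasFDerivAt (fun v => B.pos a ε (y + v)) (B.scale ε • fderiv ℝ B.param (y + X.2.1))
        X.2.1 := by
      have h5 := (h3.differentiableAt (by simp)).hasFDerivAt
      exact ((h5.comp X.2.1
        ((hasFDerivAt_id X.2.1).const_add y)).const_smul (B.scale ε)).const_add _
    have h6 : HasFDerivAt (fun v : Euc d => dist (A.pos a ε (x + X.1)) (B.pos a ε (y + v)) +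
        dist (B.pos a ε (y + v)) (C.pos a ε (z + X.2.2))) _ X.2.1 :=
      (hasFDerivAt_dist (hasFDerivAt_const (A.pos a ε (x + X.1)) X.2.1) h4 h1).add
      (hasFDerivAt_dist h4 (hasFDerivAt_const (C.pos a ε (z + X.2.2)) X.2.1) h2)
    rw [h6.fderiv]
    ext v
    simp [mirror]
    ring
  have hd : HasFDerivAt (fun X : Euc d × Euc d × Euc d => B.scale ε •
      mirror a A B C (ε, (x, y, z) + X)) (B.scale ε • mirrorDeriv a A B C (ε, x, y, z)) 0 := by
    have h1 : HasFDerivAt (fun X : Euc d × Euc d × Euc d => (ε, (x, y, z) + X))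
        (ContinuousLinearMap.inr ℝ ℝ _) 0 :=
      (hasFDerivAt_const ε _).prodMk ((hasFDerivAt_id _).const_add _)
    have h2 : HasFDerivAt (mirror a A B C) (fderiv ℝ (mirror a A B C) (ε, x, y, z))
        (ε, (x, y, z) + (0 : Euc d × Euc d × Euc d)) := by
      rw [add_zero]; exact h.differentiableAt_mirror.hasFDerivAt
    have h3 : HasFDerivAt (fun X : Euc d × Euc d × Euc d => mirror a A B C (ε, (x, y, z) + X))
        (mirrorDeriv a A B C (ε, x, y, z)) 0 := HasFDerivAt.comp (g := mirror a A B C) 0 h2 h1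
    exact h3.fun_const_smul _
  rw [VariationalEq, hev.fderiv_eq, hd.fderiv, smul_apply, smul_eq_zero]
  simp [B.scale_ne_zero hε]

theorem IsRegularAt.hasDerivAt_line (h : IsRegularAt a A B C p) (X : Euc d × Euc d × Euc d)
    (v : Euc d) :
    HasDerivAt (fun s : ℝ => mirror a A B C (p.1, p.2 + s • X) v)
      (mirrorDeriv a A B C p X v) 0 := by
  have h1 : HasDerivAt (fun s : ℝ => (p.1, p.2 + s • X)) ((0 : ℝ), X) 0 := by
    refine (hasDerivAt_const _ _).prodMk ?_
    simpa using ((hasDerivAt_id (0 : ℝ)).smul_const X).const_add p.2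
  have h2 : HasFDerivAt (mirror a A B C) (fderiv ℝ (mirror a A B C) p)
      (p.1, p.2 + (0 : ℝ) • X) := by
    rw [zero_smul, add_zero]; exact h.differentiableAt_mirror.hasFDerivAt
  have h3 : HasDerivAt (fun s : ℝ => mirror a A B C (p.1, p.2 + s • X))
      (fderiv ℝ (mirror a A B C) p (0, X)) 0 :=
    HasFDerivAt.comp_hasDerivAt (l := mirror a A B C) (0 : ℝ) h2 h1
  exact (ContinuousLinearMap.apply ℝ ℝ v).hasFDerivAt.comp_hasDerivAt (0 : ℝ) h3

/-- The part of `A r` orthogonal to `e` is orthogonal to `e` and to the range of `B`, which span the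
space, so it vanishes. Then `A r` is parallel to `e`, and transversality of `A` forces `r = 0`. -/
theorem transversal_kernel {E : Type*} [NormedAddCommGroup E] [InnerProductSpace ℝ E]
    {A : E →L[ℝ] Euc (d + 1)} {B : Euc d →L[ℝ] Euc (d + 1)} (hA : Function.Injective A)
    (hB : Function.Injective B) {e : Euc (d + 1)} (he : ‖e‖ = 1) (heA : e ∉ range A)
    (heB : e ∉ range B) {r : E} (h : ∀ u, ⟪A r - ⟪e, A r⟫ • e, B u⟫ = 0) : r = 0 := by
  set g := A r - ⟪e, A r⟫ • e with hg
  have h1 : ⟪g, e⟫ = 0 := by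
    rw [hg, inner_sub_left, real_inner_smul_left, real_inner_self_eq_norm_sq, he,
      real_inner_comm]; ring
  obtain ⟨u, t, hut⟩ := exists_add_smul_of_notMem_range hB heB g
  have h2 : ⟪g, g⟫ = 0 := by
    nth_rewrite 2 [hut]
    rw [inner_add_right, h, real_inner_smul_right, h1]; simp
  have h3 : A r = ⟪e, A r⟫ • e := sub_eq_zero.1 (inner_self_eq_zero.1 h2)
  by_cases h4 : ⟪e, A r⟫ = 0
  · rw [h4, zero_smul] at h3
    exact (injective_iff_map_eq_zero A).1 hA r h3
  · exact absurd ⟨⟪e, A r⟫⁻¹ • r, by rw [map_smul, h3, inner_smul_right,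
      real_inner_self_eq_norm_sq, he]; simp [smul_smul, h4]⟩ heA

theorem smul_fderiv_injective {A : Site d N} {ε : ℝ} (hε : ε ≠ 0) {x : Euc d}
    (hA : Function.Injective (fderiv ℝ A.param x)) :
    Function.Injective (A.scale ε • fderiv ℝ A.param x) := fun _ _ huv =>
  hA (smul_right_injective _ (A.scale_ne_zero hε) huv)

theorem notMem_range_smul {A : Site d N} {ε : ℝ} {x : Euc d} {e : Euc (d + 1)}
    (h : e ∉ range (fderiv ℝ A.param x)) : e ∉ range (A.scale ε • fderiv ℝ A.param x) := by
  rintro ⟨u, rfl⟩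
  exact h ⟨A.scale ε • u, by rw [map_smul]; rfl⟩

theorem hasDerivAt_pos {A : Site d N} {ε : ℝ} {x : Euc d} (hA : ContDiffAt ℝ ∞ A.param x)
    (r : Euc d) : HasDerivAt (fun s : ℝ => A.pos a ε (x + s • r))
      ((A.scale ε • fderiv ℝ A.param x) r) 0 := by
  have h1 : HasDerivAt (fun s : ℝ => x + s • r) r 0 := by
    simpa using ((hasDerivAt_id (0 : ℝ)).smul_const r).const_add x
  have h2 : HasFDerivAt A.param (fderiv ℝ A.param x) (x + (0 : ℝ) • r) := by
    rw [zero_smul, add_zero]; exact (hA.differentiableAt (by simp)).hasFDerivAt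
  exact ((h2.comp_hasDerivAt (0 : ℝ) h1).const_smul (A.scale ε)).const_add _

/-- The twist condition, for variations of the next reflection point. -/
theorem IsRegularAt.eq_zero_of_mirrorDeriv_right (h : IsRegularAt a A B C p) (hp : p.1 ≠ 0)
    (hB : Function.Injective (fderiv ℝ B.param p.2.2.1))
    (hC : Function.Injective (fderiv ℝ C.param p.2.2.2))
    (heB : dir (B.pos a p.1 p.2.2.1) (C.pos a p.1 p.2.2.2) ∉ range (fderiv ℝ B.param p.2.2.1))
    (heC : dir (B.pos a p.1 p.2.2.1) (C.pos a p.1 p.2.2.2) ∉ range (fderiv ℝ C.param p.2.2.2))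
    {r : Euc d} (hr : mirrorDeriv a A B C p (0, 0, r) = 0) : r = 0 := by
  refine transversal_kernel (smul_fderiv_injective hp hC) hB (norm_dir h.ne_right)
    (notMem_range_smul heC) heB fun u => ?_
  have h1 := h.hasDerivAt_line (0, 0, r) u
  rw [hr, zero_apply] at h1
  set v := (C.scale p.1 • fderiv ℝ C.param p.2.2.2) r with hv
  -- Moving an end point changes the direction by the component of the motion orthogonal to it,
  -- divided by the length: the form treated by `transversal_kernel`.
  have h2 := hasDerivAt_dir (hasDerivAt_const (0 : ℝ) (B.pos a p.1 p.2.2.1))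
    (hasDerivAt_pos (a := a) (ε := p.1) h.smooth_right r) (by simpa using h.ne_right)
  have h4 := ((hasDerivAt_const (0 : ℝ) (dir (A.pos a p.1 p.2.1)
      (B.pos a p.1 p.2.2.1))).sub h2).inner ℝ
    (hasDerivAt_const (0 : ℝ) (fderiv ℝ B.param p.2.2.1 u))
  have h3 := h4.congr_of_eventuallyEq (f₁ := fun s : ℝ =>
    mirror a A B C (p.1, p.2 + s • (0, 0, r)) u) (Eventually.of_forall fun s => by
    simp [mirror, inner_sub_left])
  have h5 := h1.unique h3
  simp only [zero_smul, add_zero, sub_zero, inner_zero_right, zero_sub, inner_neg_left,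
    real_inner_smul_left, zero_add] at h5
  have h6 : ‖C.pos a p.1 p.2.2.2 - B.pos a p.1 p.2.2.1‖⁻¹ ≠ 0 :=
    inv_ne_zero (norm_ne_zero_iff.2 (sub_ne_zero.2 h.ne_right.symm))
  rw [zero_eq_neg, mul_eq_zero] at h5
  exact h5.resolve_left h6

/-- The twist condition, for variations of the previous reflection point. -/
theorem IsRegularAt.eq_zero_of_mirrorDeriv_left (h : IsRegularAt a A B C p) (hp : p.1 ≠ 0)
    (hA : Function.Injective (fderiv ℝ A.param p.2.1))
    (hB : Function.Injective (fderiv ℝ B.param p.2.2.1))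
    (heA : dir (A.pos a p.1 p.2.1) (B.pos a p.1 p.2.2.1) ∉ range (fderiv ℝ A.param p.2.1))
    (heB : dir (A.pos a p.1 p.2.1) (B.pos a p.1 p.2.2.1) ∉ range (fderiv ℝ B.param p.2.2.1))
    {r : Euc d} (hr : mirrorDeriv a A B C p (r, 0, 0) = 0) : r = 0 := by
  refine transversal_kernel (smul_fderiv_injective hp hA) hB (norm_dir h.ne_left)
    (notMem_range_smul heA) heB fun u => ?_
  have h1 := h.hasDerivAt_line (r, 0, 0) u
  rw [hr, zero_apply] at h1
  set v := (A.scale p.1 • fderiv ℝ A.param p.2.1) r with hv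
  have h2 := hasDerivAt_dir (hasDerivAt_pos (a := a) (ε := p.1) h.smooth_left r)
    (hasDerivAt_const (0 : ℝ) (B.pos a p.1 p.2.2.1)) (by simpa using h.ne_left)
  have h4 := (h2.sub (hasDerivAt_const (0 : ℝ) (dir (B.pos a p.1 p.2.2.1)
      (C.pos a p.1 p.2.2.2)))).inner ℝ (hasDerivAt_const (0 : ℝ) (fderiv ℝ B.param p.2.2.1 u))
  have h3 := h4.congr_of_eventuallyEq (f₁ := fun s : ℝ =>
    mirror a A B C (p.1, p.2 + s • (r, 0, 0)) u) (Eventually.of_forall fun s => by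
    simp [mirror, inner_sub_left])
  have h5 := h1.unique h3
  simp only [zero_smul, add_zero, sub_zero, inner_zero_right, zero_sub, inner_neg_right,
    neg_smul, sub_neg_eq_add, real_inner_smul_left, zero_add] at h5
  have h6 : ‖B.pos a p.1 p.2.2.1 - A.pos a p.1 p.2.1‖⁻¹ ≠ 0 :=
    inv_ne_zero (norm_ne_zero_iff.2 (sub_ne_zero.2 h.ne_left.symm))
  rw [zero_eq_mul] at h5
  have h7 := h5.resolve_left h6
  rw [← neg_eq_zero, ← inner_neg_left, neg_add, neg_neg] at h7
  rw [sub_eq_add_neg]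
  exact h7

end Site

/-! ### From limit configurations to hyperbolic trajectories -/

theorem exists_uniform_bound {α : Type*} {s : Set α} (hs : s.Finite) {P : α → ℝ → Prop}
    (hmono : ∀ x c c', c ≤ c' → P x c → P x c') (h : ∀ x ∈ s, ∃ c, P x c) :
    ∃ c > 0, ∀ x ∈ s, P x c := by
  choose! f hf using h
  obtain ⟨c, hc⟩ := (hs.image f).bddAbove
  exact ⟨max c 1, by positivity, fun x hx =>
    hmono x _ _ ((hc (mem_image_of_mem f hx)).trans (le_max_left _ _)) (hf x hx)⟩

theorem exists_pos_of_eventually {X : Type*} [SeminormedAddCommGroup X] {P : ℝ → X → Prop}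
    (h : ∀ᶠ p : ℝ × X in 𝓝[>] 0 ×ˢ 𝓝 0, P p.1 p.2) :
    ∃ ρ > 0, ∀ ε x, 0 < ε → ε < ρ → ‖x‖ < ρ → P ε x := by
  obtain ⟨pa, hpa, pb, hpb, h⟩ := eventually_prod_iff.1 h
  obtain ⟨ρ₁, h1, h1'⟩ := mem_nhdsGT_iff_exists_Ioo_subset.1 hpa
  obtain ⟨ρ₂, h2, h2'⟩ := Metric.eventually_nhds_iff.1 hpb
  refine ⟨min ρ₁ ρ₂, lt_min h1 h2, fun ε x h3 h4 h5 => h (h1' ⟨h3, h4.trans_le (min_le_left _ _)⟩)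
    (h2' ?_)⟩
  rw [dist_zero_right]
  exact h5.trans_le (min_le_right _ _)

theorem nhdsGT_prod_nhds_le {X : Type*} [TopologicalSpace X] [Zero X] :
    𝓝[>] (0 : ℝ) ×ˢ 𝓝 (0 : X) ≤ 𝓝 (0 : ℝ × X) := by
  rw [Prod.zero_eq_mk, nhds_prod_eq]
  exact Filter.prod_mono nhdsWithin_le_nhds le_rfl

namespace Site

variable {d N : ℕ} (D : Set (Euc (d + 1))) (a : Fin N → Euc (d + 1))
  (φ : Fin N → Sph d → Euc (d + 1))

/-- In the limit of point scatterers, the segment from the site `B` to the point `Q` lies in the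
domain and avoids the scatterers. -/
structure IsClear (B : Site d N) (Q : Euc (d + 1)) : Prop where
  segment_subset : openSegment ℝ (B.pos a 0 0) Q ⊆ D
  avoids : ∀ j, a j ∉ openSegment ℝ (B.pos a 0 0) Q
  ray : ∀ j, B.obst = some j → ∀ t : ℝ, 0 < t →
    B.param 0 + t • (Q - B.pos a 0 0) ∉ range (φ j)

/-- Properties of three successive reflection points of a perturbed trajectory; the bounds for the
derivatives depend on `c` and `δ`. -/
structure IsGoodAt (A B C : Site d N) (c δ : ℝ) (p : ℝ × Euc d × Euc d × Euc d) : Prop where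
  regular : IsRegularAt a A B C p
  deriv_near : ‖mirrorDeriv a A B C p - mirrorDeriv a A B C 0‖ ≤ δ
  segment_right : ∀ t : ℝ, 0 < t → t ≤ 1 / 2 → B.pos a p.1 p.2.2.1 +
    t • (C.pos a p.1 p.2.2.2 - B.pos a p.1 p.2.2.1) ∈ table D a φ p.1
  segment_left : ∀ t : ℝ, 0 < t → t ≤ 1 / 2 → B.pos a p.1 p.2.2.1 +
    t • (A.pos a p.1 p.2.1 - B.pos a p.1 p.2.2.1) ∈ table D a φ p.1
  localParam : IsLocalParam (walls D a φ p.1) (B.pos a p.1 p.2.2.1)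
    (fun z => B.pos a p.1 (p.2.2.1 + z))
  lower : ∀ u, ‖u‖ ≤ c * ‖fderiv ℝ B.param p.2.2.1 u‖
  upper : ∀ u, ‖fderiv ℝ B.param p.2.2.1 u‖ ≤ c * ‖u‖

variable {D a φ} {A B C : Site d N}

theorem IsLimitTriple.notMem_range (h : IsLimitTriple D a φ A B C) :
    C.pos a 0 0 - B.pos a 0 0 ∉ range (fderiv ℝ B.param 0) ∧
    A.pos a 0 0 - B.pos a 0 0 ∉ range (fderiv ℝ B.param 0) := by
  have hr := h.regular
  have h0 : ∀ u, ⟪dir (A.pos a 0 0) (B.pos a 0 0) - dir (B.pos a 0 0) (C.pos a 0 0),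
      fderiv ℝ B.param 0 u⟫ = 0 := fun u => DFunLike.congr_fun h.mirror_zero u
  obtain ⟨h1, h2⟩ := notMem_range_of_inner_eq_zero (norm_dir hr.ne_left) (norm_dir hr.ne_right)
    hr.dir_ne h0
  constructor
  · rintro ⟨u, hu⟩
    exact h2 ⟨‖C.pos a 0 0 - B.pos a 0 0‖⁻¹ • u, by rw [map_smul, hu]; rfl⟩
  · rintro ⟨u, hu⟩
    refine h1 ⟨-(‖B.pos a 0 0 - A.pos a 0 0‖⁻¹ • u), ?_⟩
    rw [map_neg, map_smul, hu, ← smul_neg, neg_sub]; rfl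

theorem IsValid.exists_fderiv_bounds (hB : B.IsValid D φ) :
    ∃ c : ℝ, 0 ≤ c ∧ ∀ᶠ y in 𝓝 0, (∀ u, ‖u‖ ≤ c * ‖fderiv ℝ B.param y u‖) ∧
      ∀ u, ‖fderiv ℝ B.param y u‖ ≤ c * ‖u‖ := by
  obtain ⟨c, hc, hlow⟩ := IsLocalParam.eventually_fderiv_lower_bound hB
  have hup : ∀ᶠ y in 𝓝 0, ‖fderiv ℝ B.param y‖ < ‖fderiv ℝ B.param 0‖ + 1 :=
    (IsLocalParam.continuousAt_fderiv hB).norm.eventually (gt_mem_nhds (by linarith))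
  refine ⟨max c⁻¹ (‖fderiv ℝ B.param 0‖ + 1), by positivity, ?_⟩
  filter_upwards [hlow, hup] with y h1 h2
  refine ⟨fun u => ?_, fun u => ?_⟩
  · have h3 : ‖u‖ ≤ c⁻¹ * ‖fderiv ℝ B.param y u‖ := by
      rw [le_inv_mul_iff₀ hc]; exact h1 u
    exact h3.trans (by gcongr; exact le_max_left _ _)
  · exact (ContinuousLinearMap.le_of_opNorm_le _ h2.le u).trans (by gcongr; exact le_max_right _ _)

/-- All these requirements persist near the limit configuration. The filter keeps `ε > 0`, because
at `ε = 0` the scatterers degenerate to points. -/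
theorem IsLimitTriple.eventually_good (hDo : IsOpen D) (hDs : HasSmoothBoundary D)
    (haD : ∀ j, a j ∈ D) (ha : Function.Injective a) (hφ : ∀ j, Continuous (φ j))
    (h : IsLimitTriple D a φ A B C) (hl : IsClear D a φ B (A.pos a 0 0))
    (hr : IsClear D a φ B (C.pos a 0 0)) {δ c : ℝ} (hδ : 0 < δ)
    (hc : ∀ᶠ y in 𝓝 0, (∀ u, ‖u‖ ≤ c * ‖fderiv ℝ B.param y u‖) ∧
      ∀ u, ‖fderiv ℝ B.param y u‖ ≤ c * ‖u‖) :
    ∀ᶠ p : ℝ × Euc d × Euc d × Euc d in 𝓝[>] 0 ×ˢ 𝓝 0, IsGoodAt D a φ A B C c δ p := by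
  obtain ⟨R, hR⟩ : ∃ R : ℝ, ∀ j x, ‖φ j x‖ ≤ R := by
    obtain ⟨R, -, hR⟩ := exists_uniform_bound (s := (univ : Set (Fin N))) finite_univ
      (P := fun j R => ∀ x, ‖φ j x‖ ≤ R) (fun j c c' hcc' h x => (h x).trans hcc') (fun j _ => by
        obtain ⟨R, hR⟩ := (isCompact_range (hφ j)).isBounded.exists_norm_le
        exact ⟨R, fun x => hR _ (mem_range_self x)⟩)
    exact ⟨R, fun j x => hR j (mem_univ j) x⟩
  set l : Filter (ℝ × Euc d × Euc d × Euc d) := 𝓝[>] 0 ×ˢ 𝓝 0 with hl_def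
  have hl0 : l ≤ 𝓝 0 := nhdsGT_prod_nhds_le
  have t1 : Tendsto (fun X : Euc d × Euc d × Euc d => X.1) (𝓝 0) (𝓝 0) :=
    Continuous.tendsto' (by fun_prop) _ _ rfl
  have t2 : Tendsto (fun X : Euc d × Euc d × Euc d => X.2.1) (𝓝 0) (𝓝 0) :=
    Continuous.tendsto' (by fun_prop) _ _ rfl
  have t3 : Tendsto (fun X : Euc d × Euc d × Euc d => X.2.2) (𝓝 0) (𝓝 0) :=
    Continuous.tendsto' (by fun_prop) _ _ rfl
  have s2 : Tendsto (fun p : ℝ × Euc d × Euc d × Euc d => (p.1, p.2.2.1)) l (smallFilter d) :=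
    tendsto_fst.prodMk (t2.comp tendsto_snd)
  have q1 : Tendsto (fun p : ℝ × Euc d × Euc d × Euc d => A.pos a p.1 p.2.1) l
      (𝓝 (A.pos a 0 0)) := h.regular.contDiffAt_left.continuousAt.mono_left hl0
  have q3 : Tendsto (fun p : ℝ × Euc d × Euc d × Euc d => C.pos a p.1 p.2.2.2) l
      (𝓝 (C.pos a 0 0)) := h.regular.contDiffAt_right.continuousAt.mono_left hl0
  filter_upwards [h.eventually_regular.filter_mono hl0,
    (h.eventually_deriv_near hδ).filter_mono hl0,
    (s2.prodMk q3).eventually (h.valid_mid.eventually_segment_subset hDo hDs haD ha hφ hR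
      h.notMem_range.1 hr.segment_subset hr.avoids hr.ray),
    (s2.prodMk q1).eventually (h.valid_mid.eventually_segment_subset hDo hDs haD ha hφ hR
      h.notMem_range.2 hl.segment_subset hl.avoids hl.ray),
    s2.eventually (h.valid_mid.eventually_isLocalParam_walls hDo haD ha hφ hR),
    (t2.comp tendsto_snd).eventually hc] with p h1 h2 h3 h4 h5 h6
  exact ⟨h1, h2, h3, h4, h5, h6.1, h6.2⟩

theorem fderiv_pos_translate {ε : ℝ} {y : Euc d} (hB : ContDiffAt ℝ ∞ B.param y) :
    fderiv ℝ (fun z => B.pos a ε (y + z)) 0 = B.scale ε • fderiv ℝ B.param y := by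
  have h1 : fderiv ℝ (fun z => B.pos a ε (y + z)) 0 = fderiv ℝ (B.pos a ε) (y + 0) :=
    fderiv_comp_add_left (f := B.pos a ε) (x := 0) y
  rw [h1, add_zero]
  exact (((hB.differentiableAt (by simp)).hasFDerivAt.const_smul (B.scale ε)).const_add _).fderiv

theorem IsGoodAt.injective {c δ : ℝ} {p : ℝ × Euc d × Euc d × Euc d}
    (h : IsGoodAt D a φ A B C c δ p) : Function.Injective (fderiv ℝ B.param p.2.2.1) := by
  rw [injective_iff_map_eq_zero]
  intro u hu
  have := h.lower u
  rw [hu, norm_zero, mul_zero] at this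
  exact norm_le_zero_iff.1 this

/-- The configuration of the sequence of sites `σ` with parameters `y`, seen from the site `n`. -/
def config (ε : ℝ) (y : ℤ → Euc d) (n : ℤ) : ℝ × Euc d × Euc d × Euc d :=
  (ε, y (n - 1), y n, y (n + 1))

/-- Each segment is covered by two halves, each controlled from its own end point. -/
theorem isBilliardTrajectory_of_good {σ : ℤ → Site d N} {ε c δ : ℝ} {y : ℤ → Euc d}
    (hgood : ∀ n, IsGoodAt D a φ (σ (n - 1)) (σ n) (σ (n + 1)) c δ (config ε y n))
    (hzero : ∀ n, mirror a (σ (n - 1)) (σ n) (σ (n + 1)) (config ε y n) = 0) :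
    IsBilliardTrajectory D a φ ε (fun n => (σ n).pos a ε (y n)) where
  mem_walls n := by
    have := (hgood n).localParam.eventually_mem.self_of_nhds
    simpa [config] using this
  ne n := (hgood n).regular.ne_right
  segment_subset n := by
    rw [openSegment_eq_image']
    rintro _ ⟨t, ⟨ht0, ht1⟩, rfl⟩
    rcases le_total t (1 / 2) with ht | ht
    · exact (hgood n).segment_right t ht0 ht
    · have h1 := (hgood (n + 1)).segment_left (1 - t) (by linarith) (by linarith)
      simp only [config, add_sub_cancel_right] at h1
      convert h1 using 1
      simp only [sub_smul, one_smul, smul_sub]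
      abel
  reflects n := by
    have hg := hgood n
    refine ReflectsAt.of_inner_eq_zero hg.localParam (norm_dir hg.regular.ne_left)
      (norm_dir hg.regular.ne_right) hg.regular.dir_ne fun u => ?_
    have h1 := DFunLike.congr_fun (hzero n) u
    have h2 := fderiv_pos_translate (a := a) (ε := ε) hg.regular.smooth_mid
    simp only [config] at h2 ⊢
    rw [h2, smul_apply, real_inner_smul_right]
    refine mul_eq_zero_of_right _ h1

/-- The twist condition turns the variational equation into invertible transfer maps, and closeness
to the limit operator gives the dichotomy in chart coordinates. -/
theorem isHyperbolic_of_good {σ : ℤ → Site d N} {ε c δ K M : ℝ} {y : ℤ → Euc d}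
    (hε : 0 < ε) (hε1 : ε ≤ 1) (hc : 0 < c)
    (hgood : ∀ n, IsGoodAt D a φ (σ (n - 1)) (σ n) (σ (n + 1)) c δ (config ε y n))
    (hzero : ∀ n, mirror a (σ (n - 1)) (σ n) (σ (n + 1)) (config ε y n) = 0)
    (hinv : UniformlyInvertible (fun n => mirrorDeriv a (σ (n - 1)) (σ n) (σ (n + 1)) 0) K)
    (hKδ : K * δ ≤ 1 / 4) (hM : ∀ n, ‖mirrorDeriv a (σ (n - 1)) (σ n) (σ (n + 1)) 0‖ ≤ M) :
    IsHyperbolic (walls D a φ ε) (fun n => (σ n).pos a ε (y n)) := by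
  set L : ℤ → Euc d × Euc d × Euc d →L[ℝ] (Euc d →L[ℝ] ℝ) := fun n =>
    mirrorDeriv a (σ (n - 1)) (σ n) (σ (n + 1)) (config ε y n) with hL
  have htr : ∀ n, dir ((σ (n - 1)).pos a ε (y (n - 1))) ((σ n).pos a ε (y n)) ∉
        range (fderiv ℝ (σ n).param (y n)) ∧
      dir ((σ n).pos a ε (y n)) ((σ (n + 1)).pos a ε (y (n + 1))) ∉
        range (fderiv ℝ (σ n).param (y n)) := fun n =>
    notMem_range_of_inner_eq_zero (norm_dir (hgood n).regular.ne_left)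
      (norm_dir (hgood n).regular.ne_right) (hgood n).regular.dir_ne
      fun u => DFunLike.congr_fun (hzero n) u
  have hinj : ∀ n, Function.Injective (fderiv ℝ (σ n).param (y n)) := fun n => (hgood n).injective
  have hfin : Module.finrank ℝ (Euc d) = Module.finrank ℝ (Euc d →L[ℝ] ℝ) :=
    (InnerProductSpace.toDual ℝ (Euc d)).toLinearEquiv.finrank_eq
  have hleft : ∀ n u, L n (u, 0, 0) = 0 → u = 0 := fun n u hu => by
    refine (hgood n).regular.eq_zero_of_mirrorDeriv_left hε.ne' (hinj (n - 1)) (hinj n) ?_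
      (htr n).1 hu
    have := (htr (n - 1)).2
    rwa [sub_add_cancel] at this
  have hright : ∀ n r, L n (0, 0, r) = 0 → r = 0 := fun n r hr => by
    refine (hgood n).regular.eq_zero_of_mirrorDeriv_right hε.ne' (hinj n) (hinj (n + 1))
      (htr n).2 ?_ hr
    have := (htr (n + 1)).1
    rwa [add_sub_cancel_right] at this
  choose T hT using fun n : ℤ => exists_transfer hfin (L (n + 1)) (hleft (n + 1)) (hright (n + 1))
  have hLM : ∀ n, ‖L n‖ ≤ M + δ := fun n => by
    have h1 := norm_le_norm_add_norm_sub' (L n) (mirrorDeriv a (σ (n - 1)) (σ n) (σ (n + 1)) 0)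
    exact h1.trans (add_le_add (hM n) (hgood n).deriv_near)
  obtain ⟨Es, Eu, C, θ, hC, h0, h1, hcompl, hEs, hEu, hdec⟩ :=
    hinv.exists_dichotomy (A := L) (fun n => (hgood n).deriv_near) hKδ hLM hT
  have hfd : ∀ n, fderiv ℝ (fun z => (σ n).pos a ε (y n + z)) 0 =
      (σ n).scale ε • fderiv ℝ (σ n).param (y n) := fun n =>
    fderiv_pos_translate (hgood n).regular.smooth_mid
  -- Passing from chart norms to Euclidean norms costs `c / ε` in one direction, so the constant of
  -- hyperbolicity depends on `ε`; the rate `θ` is left unchanged.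
  have hscale : ∀ n, ε ≤ (σ n).scale ε ∧ (σ n).scale ε ≤ 1 := fun n => by
    cases h : (σ n).obst <;> simp [scale, h, hε1]
  have hnorm : ∀ n u, ‖fderiv ℝ (fun z => (σ n).pos a ε (y n + z)) 0 u‖ =
      (σ n).scale ε * ‖fderiv ℝ (σ n).param (y n) u‖ := fun n u => by
    rw [hfd, smul_apply, norm_smul, Real.norm_of_nonneg (hε.le.trans (hscale n).1)]
  have hup : ∀ n u, ‖fderiv ℝ (fun z => (σ n).pos a ε (y n + z)) 0 u‖ ≤ c * ‖u‖ := fun n u => by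
    rw [hnorm]
    exact (mul_le_of_le_one_left (norm_nonneg _) (hscale n).2).trans ((hgood n).upper u)
  have hlow : ∀ n u, ‖u‖ ≤ c / ε * ‖fderiv ℝ (fun z => (σ n).pos a ε (y n + z)) 0 u‖ :=
    fun n u => by
    rw [hnorm]
    have h2 : ‖u‖ ≤ c * ‖fderiv ℝ (σ n).param (y n) u‖ := (hgood n).lower u
    calc ‖u‖ ≤ c / ε * (ε * ‖fderiv ℝ (σ n).param (y n) u‖) := by
          rw [← mul_assoc, div_mul_cancel₀ _ hε.ne']; exact h2
      _ ≤ _ := by gcongr; exact (hscale n).1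
  refine ⟨fun n z => (σ n).pos a ε (y n + z), T, Es, Eu, 2 * c * C * (c / ε), θ,
    fun n => (hgood n).localParam, fun n ξ η => ?_, h0, h1, hcompl, hEs, hEu, ?_⟩
  · rw [hT n ξ η]
    refine and_congr_right fun _ => ?_
    have hreg := (hgood (n + 1)).regular
    have e1 : n + 1 - 1 = n := by ring
    have e2 : n + 1 + 1 = n + 2 := by ring
    simp only [hL, config, e1, e2] at hreg ⊢
    exact (hreg.variationalEq_iff hε.ne' _ _ _).symm
  · intro size ξ hξ n k
    have hsu : ∀ n ξ, size n ξ ≤ 2 * c * ‖ξ‖ := fun n ξ => by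
      have h2 := (hup n ξ.1).trans (mul_le_mul_of_nonneg_left (norm_fst_le ξ) hc.le)
      have h3 := (hup (n + 1) ξ.2).trans (mul_le_mul_of_nonneg_left (norm_snd_le ξ) hc.le)
      calc size n ξ ≤ c * ‖ξ‖ + c * ‖ξ‖ := add_le_add h2 h3
        _ = _ := by ring
    have hsl : ∀ n ξ, ‖ξ‖ ≤ c / ε * size n ξ := fun n ξ => by
      have hcε : 0 < c / ε := by positivity
      rw [Prod.norm_def, sup_le_iff]
      constructor
      · refine (hlow n ξ.1).trans (mul_le_mul_of_nonneg_left ?_ hcε.le)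
        exact le_add_of_nonneg_right (norm_nonneg _)
      · refine (hlow (n + 1) ξ.2).trans (mul_le_mul_of_nonneg_left ?_ hcε.le)
        exact le_add_of_nonneg_left (norm_nonneg _)
    have key : ∀ m, ‖ξ m‖ ≤ C * θ ^ k * ‖ξ n‖ →
        size m (ξ m) ≤ 2 * c * C * (c / ε) * θ ^ k * size n (ξ n) := fun m hm =>
      calc size m (ξ m) ≤ 2 * c * ‖ξ m‖ := hsu _ _
        _ ≤ 2 * c * (C * θ ^ k * ‖ξ n‖) := by gcongr
        _ ≤ 2 * c * (C * θ ^ k * (c / ε * size n (ξ n))) := by gcongr; exact hsl _ _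
        _ = _ := by ring
    exact ⟨fun hn => key _ ((hdec ξ hξ n k).1 hn), fun hn => key _ ((hdec ξ hξ n k).2 hn)⟩

/-- Hyperbolic trajectories of the billiard with small scatterers, close to a sequence of sites
with a uniformly invertible linearized equation. -/
theorem exists_trajectory (hDo : IsOpen D) (hDs : HasSmoothBoundary D)
    (haD : ∀ j, a j ∈ D) (ha : Function.Injective a) (hφ : ∀ j, Continuous (φ j))
    {S : Set (Site d N)} (hS : S.Finite) (hSv : ∀ B ∈ S, B.IsValid D φ) {K : ℝ} (hK : 0 ≤ K) :
    ∃ ε₀ C : ℝ, 0 < ε₀ ∧ 0 < C ∧ ∀ ε, 0 < ε → ε < ε₀ → ∀ σ : ℤ → Site d N, (∀ n, σ n ∈ S) →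
      (∀ n, IsLimitTriple D a φ (σ (n - 1)) (σ n) (σ (n + 1))) →
      (∀ n, IsClear D a φ (σ n) ((σ (n - 1)).pos a 0 0)) →
      (∀ n, IsClear D a φ (σ n) ((σ (n + 1)).pos a 0 0)) →
      UniformlyInvertible (fun n => mirrorDeriv a (σ (n - 1)) (σ n) (σ (n + 1)) 0) K →
      ∃ y : ℤ → Euc d, (∀ n, ‖y n‖ ≤ C * ε) ∧
        IsBilliardTrajectory D a φ ε (fun n => (σ n).pos a ε (y n)) ∧
        IsHyperbolic (walls D a φ ε) (fun n => (σ n).pos a ε (y n)) := by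
  -- Small enough both for the contraction (`1 / 2`) and for the dichotomy (`1 / 4`).
  set δ : ℝ := 1 / (4 * (K + 1)) with hδ
  have hδ0 : 0 < δ := by positivity
  have hKδ : K * δ ≤ 1 / 4 := by
    rw [hδ, mul_one_div, div_le_div_iff₀ (by positivity) (by norm_num)]; linarith
  have hS3 : (S ×ˢ S ×ˢ S).Finite := hS.prod (hS.prod hS)
  -- The equations involve only triples of consecutive sites, and finitely many triples occur in all
  -- codes together; hence constants independent of the code.
  let Tr : Set (Site d N × Site d N × Site d N) := {τ | τ ∈ S ×ˢ S ×ˢ S ∧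
    IsLimitTriple D a φ τ.1 τ.2.1 τ.2.2 ∧ IsClear D a φ τ.2.1 (τ.1.pos a 0 0) ∧
    IsClear D a φ τ.2.1 (τ.2.2.pos a 0 0)}
  have hTr : Tr.Finite := hS3.subset fun τ hτ => hτ.1
  obtain ⟨c, hc, hcS⟩ := exists_uniform_bound hS (P := fun (B : Site d N) (c : ℝ) =>
      ∀ᶠ y in 𝓝 0, (∀ u, ‖u‖ ≤ c * ‖fderiv ℝ B.param y u‖) ∧
      ∀ u, ‖fderiv ℝ B.param y u‖ ≤ c * ‖u‖) (fun B c c' hcc' h => by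
        filter_upwards [h] with y hy
        exact ⟨fun u => (hy.1 u).trans (by gcongr), fun u => (hy.2 u).trans (by gcongr)⟩)
    (fun B hB => by
      obtain ⟨c, -, h⟩ := (hSv B hB).exists_fderiv_bounds
      exact ⟨c, h⟩)
  obtain ⟨M, -, hM⟩ := exists_uniform_bound hTr
    (P := fun τ M => ‖mirrorDeriv a τ.1 τ.2.1 τ.2.2 0‖ ≤ M)
    (fun τ c c' hcc' h => h.trans hcc') (fun τ _ => ⟨_, le_rfl⟩)
  obtain ⟨b, hb, hbT⟩ := exists_uniform_bound hTr
    (P := fun τ b => ∀ᶠ ε : ℝ in 𝓝 0, ‖mirror a τ.1 τ.2.1 τ.2.2 (ε, 0)‖ ≤ b * |ε|)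
    (fun τ c c' hcc' h => by
      filter_upwards [h] with ε hε
      exact hε.trans (by gcongr))
    (fun τ hτ => by
      obtain ⟨c, -, h⟩ := hτ.2.1.exists_bound
      exact ⟨c, h⟩)
  obtain ⟨ρ₁, hρ₁, h1⟩ := exists_pos_of_eventually
    (P := fun ε (X : Euc d × Euc d × Euc d) => ∀ τ ∈ Tr, IsGoodAt D a φ τ.1 τ.2.1 τ.2.2 c δ (ε, X))
    ((eventually_all_finite hTr).2 fun τ hτ => hτ.2.1.eventually_good hDo hDs haD ha hφ
      hτ.2.2.1 hτ.2.2.2 hδ0 (hcS _ hτ.1.2.1))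
  obtain ⟨ρ₂, hρ₂, h2⟩ := exists_pos_of_eventually
    (P := fun ε (X : (Euc d × Euc d × Euc d) × (Euc d × Euc d × Euc d)) => ∀ τ ∈ Tr,
      ‖mirror a τ.1 τ.2.1 τ.2.2 (ε, X.1) - mirror a τ.1 τ.2.1 τ.2.2 (ε, X.2) -
        mirrorDeriv a τ.1 τ.2.1 τ.2.2 0 (X.1 - X.2)‖ ≤ δ * ‖X.1 - X.2‖)
    ((eventually_all_finite hTr).2 fun τ hτ => (hτ.2.1.eventually_approx hδ0).filter_mono
      nhdsGT_prod_nhds_le)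
  obtain ⟨ρ₃, hρ₃, h3⟩ := Metric.eventually_nhds_iff.1 ((eventually_all_finite hTr).2 hbT)
  set r : ℝ := min ρ₁ ρ₂ / 2 with hr
  have hr0 : 0 < r := by positivity
  have hr1 : r < ρ₁ := by have := min_le_left ρ₁ ρ₂; linarith
  have hr2 : r < ρ₂ := by have := min_le_right ρ₁ ρ₂; linarith
  -- The zero has norm at most `2 * K * (b * ε)`. The last bound on `ε` keeps it in the ball of
  -- radius `r`; the `+ 1` makes the constant positive.
  refine ⟨min (min ρ₁ ρ₂) (min ρ₃ (min 1 (r / (2 * K * b + 1)))), 2 * K * b + 1, by positivity,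
    by positivity, fun ε hε hε' σ hσ htri hcl hcr hinv => ?_⟩
  simp only [lt_min_iff] at hε'
  obtain ⟨⟨he1, he2⟩, he3, he4, he5⟩ := hε'
  have hTn : ∀ n, (σ (n - 1), σ n, σ (n + 1)) ∈ Tr := fun n =>
    ⟨⟨hσ _, hσ _, hσ _⟩, htri n, hcl n, hcr n⟩
  rw [lt_div_iff₀ (by positivity)] at he5
  have he6 : ε * (2 * K * b + 1) = 2 * K * (b * ε) + ε := by ring
  have he7 : 2 * K * (b * ε) ≤ r := by linarith
  have he8 : 2 * K * (b * ε) ≤ (2 * K * b + 1) * ε := by linarith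
  obtain ⟨y, hy, hyF⟩ := exists_zero_of_approx_linear
    (tridiag fun n => mirrorDeriv a (σ (n - 1)) (σ n) (σ (n + 1)) 0) hK hinv.bound hinv.surj
    (fun y n => mirror a (σ (n - 1)) (σ n) (σ (n + 1)) (config ε y n)) (r := r) (δ := δ)
    (c := b * ε) (fun x y s hx hy hxy n => by
      have h4 := h2 ε ((x (n - 1), x n, x (n + 1)), (y (n - 1), y n, y (n + 1))) hε he2
        ((norm_prod_le_iff.2 ⟨norm_triple_le (hx _) (hx _) (hx _),
          norm_triple_le (hy _) (hy _) (hy _)⟩).trans_lt hr2) _ (hTn n)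
      have e : tridiag (fun n => mirrorDeriv a (σ (n - 1)) (σ n) (σ (n + 1)) 0) (x - y) n =
        mirrorDeriv a (σ (n - 1)) (σ n) (σ (n + 1)) 0
          ((x (n - 1), x n, x (n + 1)) - (y (n - 1), y n, y (n + 1))) := tridiag_apply _ _ _
      rw [e]
      exact h4.trans (mul_le_mul_of_nonneg_left
        (norm_triple_le (hxy _) (hxy _) (hxy _)) hδ0.le)) (fun n => by
      have h4 := h3 (y := ε) (by rwa [dist_zero_right, Real.norm_of_nonneg hε.le]) _ (hTn n)
      rwa [abs_of_pos hε] at h4) (by positivity) (by linarith) he7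
  have hyr : ∀ n, ‖y n‖ ≤ r := fun n => (hy n).trans he7
  have hgood : ∀ n, IsGoodAt D a φ (σ (n - 1)) (σ n) (σ (n + 1)) c δ (config ε y n) := fun n =>
    h1 ε (y (n - 1), y n, y (n + 1)) hε he1
      ((norm_triple_le (hyr _) (hyr _) (hyr _)).trans_lt hr1) _ (hTn n)
  have hzero : ∀ n, mirror a (σ (n - 1)) (σ n) (σ (n + 1)) (config ε y n) = 0 := fun n =>
    congrFun hyF n
  have hbil := isBilliardTrajectory_of_good (σ := σ) (y := y) hgood hzero
  have hhyp := isHyperbolic_of_good (σ := σ) (y := y) hε he4.le hc hgood hzero hinv hKδ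
    fun n => hM (σ (n - 1), σ n, σ (n + 1)) (hTn n)
  exact ⟨y, fun n => (hy n).trans he8, hbil, hhyp⟩

end Site

/-! ### Sequences cut into blocks, and block triangular systems -/

section Blocks

variable {n : ℤ → ℕ} {t : ℤ → ℤ}

theorem exists_block_starts (n : ℤ → ℕ) : ∃ t : ℤ → ℤ, ∀ i, t (i + 1) = t i + n i + 1 := by
  obtain ⟨t, -, ht⟩ := exists_orbit (fun i => Equiv.addRight ((n i : ℤ) + 1)) 0 0
  exact ⟨t, fun i => by rw [ht, Equiv.coe_addRight, add_assoc]⟩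

theorem block_starts_strictMono (ht : ∀ i, t (i + 1) = t i + n i + 1) : StrictMono t :=
  strictMono_int_of_lt_succ fun i => by rw [ht]; omega

theorem exists_block (ht : ∀ i, t (i + 1) = t i + n i + 1) (m : ℤ) :
    ∃ i, t i ≤ m ∧ m < t (i + 1) := by
  refine Int.inductionOn' (motive := fun m => ∃ i, t i ≤ m ∧ m < t (i + 1)) m (t 0)
    ⟨0, le_rfl, block_starts_strictMono ht (by omega)⟩ ?_ ?_
  · rintro k - ⟨i, h1, h2⟩
    rcases lt_or_ge (k + 1) (t (i + 1)) with h | h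
    · exact ⟨i, by omega, h⟩
    · exact ⟨i + 1, h, by rw [ht (i + 1)]; omega⟩
  · rintro k - ⟨i, h1, h2⟩
    rcases le_or_gt (t i) (k - 1) with h | h
    · exact ⟨i, h, by omega⟩
    · refine ⟨i - 1, ?_, ?_⟩
      · have := block_starts_strictMono ht (show i - 1 < i by omega)
        omega
      · rw [sub_add_cancel]; omega

theorem block_cases (ht : ∀ i, t (i + 1) = t i + n i + 1) (m : ℤ) :
    ∃ i, m = t i ∨ ∃ k : Fin (n i), m = t i + 1 + (k : ℕ) := by
  obtain ⟨i, h1, h2⟩ := exists_block ht m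
  refine ⟨i, ?_⟩
  rcases h1.eq_or_lt with h | h
  · exact Or.inl h.symm
  · rw [ht] at h2
    exact Or.inr ⟨⟨(m - t i - 1).toNat, by omega⟩, by simp only; omega⟩

theorem exists_flatten (ht : ∀ i, t (i + 1) = t i + n i + 1) {α : Type*} (x : ℤ → α)
    (w : ∀ i, Fin (n i) → α) :
    ∃ F : ℤ → α, (∀ i, F (t i) = x i) ∧ ∀ i (k : Fin (n i)), F (t i + 1 + (k : ℕ)) = w i k := by
  choose b hb1 hb2 using exists_block ht
  have hmono := block_starts_strictMono ht
  have hb : ∀ m i, t i ≤ m → m < t (i + 1) → b m = i := fun m i h1 h2 => by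
    have h3 := hmono.lt_iff_lt.1 ((hb1 m).trans_lt h2)
    have h4 := hmono.lt_iff_lt.1 (h1.trans_lt (hb2 m))
    omega
  -- `G` is used only for `m` in the block `i`, so the default `x i` is taken exactly at `m = t i`.
  let G : ℤ → ℤ → α := fun m i => if h : 0 < m - t i ∧ (m - t i - 1).toNat < n i
    then w i ⟨(m - t i - 1).toNat, h.2⟩ else x i
  refine ⟨fun m => G m (b m), fun i => ?_, fun i k => ?_⟩
  · have h1 : b (t i) = i := hb _ _ le_rfl (hmono (by omega))
    simp only [h1, G]
    rw [dif_neg (by omega)]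
  · have h1 : b (t i + 1 + (k : ℕ)) = i := hb _ _ (by omega) (by rw [ht]; omega)
    have h2 : (t i + 1 + (k : ℕ) - t i - 1).toNat = k := by omega
    have h3 : 0 < t i + 1 + (k : ℕ) - t i ∧ (t i + 1 + (k : ℕ) - t i - 1).toNat < n i :=
      ⟨by omega, by rw [h2]; exact k.2⟩
    have h4 : (⟨_, h3.2⟩ : Fin (n i)) = k := Fin.ext h2
    simp only [h1]
    exact (dif_pos h3).trans (congrArg (w i) h4)

theorem block_interior_ne_start (ht : ∀ i, t (i + 1) = t i + n i + 1) (i j : ℤ) (k : Fin (n i)) :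
    t i + 1 + (k : ℕ) ≠ t j := by
  have hmono := block_starts_strictMono ht
  intro h
  have h1 : i < j := hmono.lt_iff_lt.1 (by omega)
  have h2 : j < i + 1 := hmono.lt_iff_lt.1 (by rw [ht]; omega)
  omega


open Classical in
/-- The sequence obtained from `U` by erasing its terms at the starting points of the blocks. -/
noncomputable def eraseStarts {V : Type*} [Zero V] (t : ℤ → ℤ) (U : ℤ → V) : ℤ → V :=
  fun m => if m ∈ range t then 0 else U m

theorem eraseStarts_start {V : Type*} [Zero V] (t : ℤ → ℤ) (U : ℤ → V) (i : ℤ) :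
    eraseStarts t U (t i) = 0 :=
  if_pos (mem_range_self i)

theorem eraseStarts_interior {V : Type*} [Zero V] (ht : ∀ i, t (i + 1) = t i + n i + 1)
    (U : ℤ → V) (i : ℤ) (k : Fin (n i)) :
    eraseStarts t U (t i + 1 + (k : ℕ)) = U (t i + 1 + (k : ℕ)) := by
  refine if_neg ?_
  rintro ⟨j, hj⟩
  exact block_interior_ne_start ht i j k hj.symm

/-- Uniform invertibility of a block triangular system: the interiors of the blocks are not
coupled to the rest, and the starting points of the blocks are not coupled to each other. -/
theorem uniformlyInvertible_of_blocks (ht : ∀ i, t (i + 1) = t i + n i + 1)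
    {V W : Type*} [NormedAddCommGroup V] [NormedSpace ℝ V] [NormedAddCommGroup W]
    [NormedSpace ℝ W] {L : ℤ → V × V × V →L[ℝ] W} (H : ∀ i, (Fin (n i) → V) → (Fin (n i) → W))
    (Q : ℤ → V → W)
    {K₁ K₂ M : ℝ} (hK₁ : 0 ≤ K₁) (hK₂ : 0 ≤ K₂) (hM : ∀ m, ‖L m‖ ≤ M)
    (hint : ∀ i (k : Fin (n i)) U, tridiag L U (t i + 1 + (k : ℕ)) =
      H i (fun k => U (t i + 1 + (k : ℕ))) k)
    (hstart : ∀ i U, tridiag L U (t i) = Q i (U (t i)) + tridiag L (eraseStarts t U) (t i))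
    (hH : ∀ i u c, (∀ k, ‖H i u k‖ ≤ c) → ∀ k, ‖u k‖ ≤ K₁ * c)
    (hHs : ∀ i, Function.Surjective (H i))
    (hQ : ∀ i v, ‖v‖ ≤ K₂ * ‖Q i v‖) (hQs : ∀ i, Function.Surjective (Q i)) :
    UniformlyInvertible L (K₁ + K₂ * (1 + M * K₁)) := by
  have hM0 : 0 ≤ M := (norm_nonneg _).trans (hM 0)
  refine ⟨by positivity, fun U c hU => ?_, fun f => ?_⟩
  · have hc : 0 ≤ c := (norm_nonneg _).trans (hU 0)
    -- Back substitution: the interiors are bounded first, then they enter the equations at the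
    -- starts as a known term of size at most `M * K₁ * c`.
    have h1 : ∀ i (k : Fin (n i)), ‖U (t i + 1 + (k : ℕ))‖ ≤ K₁ * c := fun i k =>
      hH i (fun k => U (t i + 1 + (k : ℕ))) c (fun k => by rw [← hint]; exact hU _) k
    have h2 : ∀ m, ‖eraseStarts t U m‖ ≤ K₁ * c := fun m => by
      obtain ⟨i, rfl | ⟨k, rfl⟩⟩ := block_cases ht m
      · rw [eraseStarts_start, norm_zero]; positivity
      · rw [eraseStarts_interior ht]; exact h1 i k
    intro m
    obtain ⟨i, rfl | ⟨k, rfl⟩⟩ := block_cases ht m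
    · have h3 : Q i (U (t i)) = tridiag L U (t i) - tridiag L (eraseStarts t U) (t i) := by
        rw [hstart, add_sub_cancel_right]
      have h4 : ‖tridiag L (eraseStarts t U) (t i)‖ ≤ M * (K₁ * c) :=
        (L (t i)).le_of_opNorm_le_of_le (hM _) (norm_triple_le (h2 _) (h2 _) (h2 _))
      have h5 : ‖Q i (U (t i))‖ ≤ c + M * (K₁ * c) := by
        rw [h3]; exact (norm_sub_le _ _).trans (add_le_add (hU _) h4)
      calc ‖U (t i)‖ ≤ K₂ * (c + M * (K₁ * c)) :=
            (hQ i _).trans (mul_le_mul_of_nonneg_left h5 hK₂)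
        _ ≤ K₁ * c + K₂ * (c + M * (K₁ * c)) := le_add_of_nonneg_left (by positivity)
        _ = _ := by ring
    · refine (h1 i k).trans (mul_le_mul_of_nonneg_right ?_ hc)
      exact le_add_of_nonneg_right (by positivity)
  -- Solve in the same order: `Z` carries the interior solution with zeros at the starts, and its
  -- effect is subtracted before `Q` is inverted.
  · choose u hu using fun i => hHs i (fun k => f (t i + 1 + (k : ℕ)))
    obtain ⟨Z, hZ0, hZ1⟩ := exists_flatten ht (fun _ => (0 : V)) u
    choose v hv using fun i => hQs i (f (t i) - tridiag L Z (t i))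
    obtain ⟨U, hU0, hU1⟩ := exists_flatten ht v u
    have hZU : eraseStarts t U = Z := by
      funext m
      obtain ⟨i, rfl | ⟨k, rfl⟩⟩ := block_cases ht m
      · rw [eraseStarts_start, hZ0]
      · rw [eraseStarts_interior ht, hU1, hZ1]
    refine ⟨U, ?_⟩
    funext m
    obtain ⟨i, rfl | ⟨k, rfl⟩⟩ := block_cases ht m
    · rw [hstart, hU0, hv, hZU, sub_add_cancel]
    · rw [hint]
      simp only [hU1]
      exact congrFun (hu i) k

end Blocks

/-! ### Derivatives of the length of a broken line -/

section PathLength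

variable {m n d : ℕ}

theorem vertices_zero (x y : Euc m) (p : Fin n → Euc m) : vertices x y p 0 = x := rfl

theorem vertices_last (x y : Euc m) (p : Fin n → Euc m) :
    vertices x y p (Fin.last (n + 1)) = y := by
  rw [vertices, ← Fin.succ_last, Fin.cons_succ, Fin.snoc_last]

theorem vertices_castSucc_succ (x y : Euc m) (p : Fin n → Euc m) (k : Fin n) :
    vertices x y p k.castSucc.succ = p k := by
  rw [vertices, Fin.cons_succ, Fin.snoc_castSucc]

theorem vertices_succ_castSucc (x y : Euc m) (p : Fin n → Euc m) (k : Fin n) :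
    vertices x y p k.succ.castSucc = p k := by
  rw [← Fin.succ_castSucc, vertices_castSucc_succ]

/-- The defect of the law of reflection at the `k`-th point of a broken line with parametrized
vertices. -/
noncomputable def defect (x z : Euc (d + 1)) (ψ : Fin n → Euc d → Euc (d + 1)) (k : Fin n)
    (y : Fin n → Euc d) : Euc d →L[ℝ] ℝ :=
  (innerSL ℝ (dir (vertices x z (fun k => ψ k (y k)) k.castSucc.castSucc) (ψ k (y k)) -
    dir (ψ k (y k)) (vertices x z (fun k => ψ k (y k)) k.succ.succ))).comp (fderiv ℝ (ψ k) (y k))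

variable {x z : Euc (d + 1)} {ψ : Fin n → Euc d → Euc (d + 1)} {y : Fin n → Euc d}

theorem contDiffAt_vertices {N : WithTop ℕ∞} (hψ : ∀ k, ContDiffAt ℝ N (ψ k) (y k))
    (r : Fin (n + 2)) :
    ContDiffAt ℝ N (fun y : Fin n → Euc d => vertices x z (fun k => ψ k (y k)) r) y := by
  induction r using Fin.cases with
  | zero => exact contDiffAt_const
  | succ r =>
    induction r using Fin.lastCases with
    | last =>
      simp only [Fin.succ_last, vertices_last]
      exact contDiffAt_const
    | cast k =>
      simp only [vertices_castSucc_succ]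
      exact (hψ k).comp y (contDiff_apply ℝ (Euc d) k).contDiffAt

/-- Summation by parts: each moving vertex belongs to two consecutive segments, and the outer end
points are fixed. -/
theorem hasFDerivAt_pathLength (hψ : ∀ k, DifferentiableAt ℝ (ψ k) (y k))
    (hne : ∀ r : Fin (n + 1), vertices x z (fun k => ψ k (y k)) r.castSucc ≠
      vertices x z (fun k => ψ k (y k)) r.succ) :
    HasFDerivAt (fun y : Fin n → Euc d => pathLength x z (fun k => ψ k (y k)))
      (∑ k, (defect x z ψ k y).comp (ContinuousLinearMap.proj k)) y := by
  let v' : Fin (n + 2) → (Fin n → Euc d) →L[ℝ] Euc (d + 1) :=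
    Fin.cons (α := fun _ => (Fin n → Euc d) →L[ℝ] Euc (d + 1)) 0
      (Fin.snoc (α := fun _ => (Fin n → Euc d) →L[ℝ] Euc (d + 1))
        (fun k => (fderiv ℝ (ψ k) (y k)).comp (ContinuousLinearMap.proj k)) 0)
  have hv'0 : v' 0 = 0 := rfl
  have hv'l : v' (Fin.last n).succ = 0 := by
    simp only [v', Fin.cons_succ, Fin.snoc_last]
  have hv'k : ∀ k : Fin n, v' k.castSucc.succ =
      (fderiv ℝ (ψ k) (y k)).comp (ContinuousLinearMap.proj k) := fun k => by
    simp only [v', Fin.cons_succ, Fin.snoc_castSucc]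
  have hv : ∀ r, HasFDerivAt (fun y : Fin n → Euc d => vertices x z (fun k => ψ k (y k)) r)
      (v' r) y := by
    intro r
    induction r using Fin.cases with
    | zero => exact hasFDerivAt_const _ _
    | succ r =>
      induction r using Fin.lastCases with
      | last =>
        rw [hv'l]
        simp only [Fin.succ_last, vertices_last]
        exact hasFDerivAt_const _ _
      | cast k =>
        rw [hv'k]
        simp only [vertices_castSucc_succ]
        exact HasFDerivAt.comp y (hψ k).hasFDerivAt (hasFDerivAt_apply k y)
  have h1 := HasFDerivAt.fun_sum (u := Finset.univ) fun (r : Fin (n + 1)) _ =>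
    hasFDerivAt_dist (hv r.castSucc) (hv r.succ) (hne r)
  refine h1.congr_fderiv ?_
  ext w
  simp only [sum_apply, ContinuousLinearMap.comp_apply, sub_apply,
    innerSL_apply_apply, inner_sub_right, Finset.sum_sub_distrib, defect,
    ContinuousLinearMap.proj_apply, inner_sub_left]
  rw [Fin.sum_univ_castSucc, Fin.sum_univ_succ (fun r : Fin (n + 1) => ⟪_, v' r.castSucc w⟫)]
  simp only [hv'l, hv'k, Fin.castSucc_zero, hv'0, zero_apply, inner_zero_right,
    add_zero, zero_add, ← Fin.succ_castSucc, vertices_castSucc_succ, ContinuousLinearMap.comp_apply,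
    ContinuousLinearMap.proj_apply]

theorem contDiffAt_defect (hψ : ∀ k, ContDiffAt ℝ ∞ (ψ k) (y k))
    (hne : ∀ r : Fin (n + 1), vertices x z (fun k => ψ k (y k)) r.castSucc ≠
      vertices x z (fun k => ψ k (y k)) r.succ) (k : Fin n) :
    ContDiffAt ℝ ∞ (defect x z ψ k) y := by
  have h1 : ContDiffAt ℝ ∞ (fun y : Fin n → Euc d => ψ k (y k)) y :=
    (hψ k).comp y (contDiff_apply ℝ (Euc d) k).contDiffAt
  have h2 : ContDiffAt ℝ ∞ (fun y : Fin n → Euc d => fderiv ℝ (ψ k) (y k)) y :=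
    ((hψ k).fderiv_right (m := ∞) (by simp)).comp y (contDiff_apply ℝ (Euc d) k).contDiffAt
  have h3 := hne k.castSucc
  have h4 := hne k.succ
  rw [vertices_castSucc_succ] at h3
  rw [vertices_succ_castSucc] at h4
  exact (contDiffAt_innerSL ((contDiffAt_dir (contDiffAt_vertices hψ _) h1 h3).sub
    (contDiffAt_dir h1 (contDiffAt_vertices hψ _) h4))).clm_comp h2

/-- The first and second derivatives of the length of a broken line, in terms of the defects of
the law of reflection. -/
theorem IsNondegCritPt.defect_of_pathLength
    (h : IsNondegCritPt (fun y : Fin n → Euc d => pathLength x z (fun k => ψ k (y k))) 0)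
    (hψ : ∀ k, ContDiffAt ℝ ∞ (ψ k) 0)
    (hne : ∀ r : Fin (n + 1), vertices x z (fun k => ψ k 0) r.castSucc ≠
      vertices x z (fun k => ψ k 0) r.succ) :
    (∀ k, defect x z ψ k 0 = 0) ∧
      ∀ u, (∀ k, fderiv ℝ (defect x z ψ k) 0 u = 0) → u = 0 := by
  have hne' : ∀ᶠ y : Fin n → Euc d in 𝓝 0, ∀ r : Fin (n + 1),
      vertices x z (fun k => ψ k (y k)) r.castSucc ≠ vertices x z (fun k => ψ k (y k)) r.succ := by
    rw [eventually_all]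
    intro r
    exact (contDiffAt_vertices (N := ∞) (y := 0) hψ _).continuousAt.ne_iff_eventually_ne
      (contDiffAt_vertices (N := ∞) (y := 0) hψ _).continuousAt |>.1 (hne r)
  have hψ' : ∀ᶠ y : Fin n → Euc d in 𝓝 0, ∀ k, DifferentiableAt ℝ (ψ k) (y k) := by
    rw [eventually_all]
    intro k
    have h1 : Tendsto (fun y : Fin n → Euc d => y k) (𝓝 0) (𝓝 0) :=
      (continuous_apply k).tendsto' _ _ rfl
    filter_upwards [h1.eventually (((hψ k).of_le (m := 1) (by simp)).eventually (by simp))]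
      with y hy using hy.differentiableAt (by simp)
  have hf : fderiv ℝ (fun y : Fin n → Euc d => pathLength x z (fun k => ψ k (y k))) =ᶠ[𝓝 0]
      fun y => ∑ k, (defect x z ψ k y).comp (ContinuousLinearMap.proj k) := by
    filter_upwards [hne', hψ'] with y h1 h2
    exact (hasFDerivAt_pathLength h2 h1).fderiv
  have hdef : ∀ k, DifferentiableAt ℝ (defect x z ψ k) 0 := fun k =>
    (contDiffAt_defect (y := 0) hψ hne k).differentiableAt (by simp)
  constructor
  · intro k
    have h1 := h.1
    rw [hf.self_of_nhds] at h1
    ext u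
    have h2 := DFunLike.congr_fun h1 (Pi.single k u)
    rw [sum_apply, Finset.sum_eq_single k] at h2
    · simpa using h2
    · intro j _ hj
      simp [Pi.single_eq_of_ne hj]
    · simp
  · intro u hu
    refine h.2 u fun w => ?_
    have h1 : HasFDerivAt (fun y => ∑ k, (defect x z ψ k y).comp
        (ContinuousLinearMap.proj (R := ℝ) (φ := fun _ : Fin n => Euc d) k))
        (∑ k, (ContinuousLinearMap.precomp ℝ (ContinuousLinearMap.proj (R := ℝ)
          (φ := fun _ : Fin n => Euc d) k)).comp (fderiv ℝ (defect x z ψ k) 0)) 0 :=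
      HasFDerivAt.fun_sum (u := Finset.univ) fun k _ =>
        HasFDerivAt.comp (g := fun l : Euc d →L[ℝ] ℝ => l.comp (ContinuousLinearMap.proj (R := ℝ)
          (φ := fun _ : Fin n => Euc d) k)) (0 : Fin n → Euc d)
          (ContinuousLinearMap.precomp ℝ (ContinuousLinearMap.proj (R := ℝ)
            (φ := fun _ : Fin n => Euc d) k)).hasFDerivAt (hdef k).hasFDerivAt
    rw [hf.fderiv_eq, h1.fderiv]
    simp [hu]

end PathLength

/-! ### The chain of sites of a code -/

variable {d : ℕ}

/-- The inverse of a smooth embedding of the sphere is locally Lipschitz. -/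
theorem exists_lipschitz_inverse {f : Sph d → Euc (d + 1)}
    (hf : Manifold.IsSmoothEmbedding (𝓡 d) 𝓘(ℝ, Euc (d + 1)) ∞ f) (s : Sph d) :
    ∃ L : ℝ, ∀ᶠ z in 𝓝 (f s), ∀ x, f x = z → dist x s ≤ L * ‖z - f s‖ := by
  have : Fact (Module.finrank ℝ (Euc (d + 1)) = d + 1) := ⟨finrank_euclideanSpace_fin⟩
  have h := hf.isImmersion.isImmersionAt s
  set e := h.domChart
  set e' := h.codChart
  have hes : s ∈ e.source := h.mem_domChart_source
  have hes' : f s ∈ e'.source := h.mem_codChart_source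
  have hw : ∀ x ∈ e.source, e' (f x) = h.equiv (e x, 0) := fun x hx => by
    have h0 : e x ∈ (e.extend (𝓡 d)).target := by simpa using e.map_source hx
    have := h.writtenInCharts h0
    simpa [e, e', e.left_inv hx] using this
  -- In immersion charts, projecting away the normal coordinate is a smooth left inverse of `f`.
  let g : Euc (d + 1) → Euc (d + 1) := fun z => (e.symm (h.equiv.symm (e' z)).1 : Sph d)
  have hg : ∀ x ∈ e.source, g (f x) = x := fun x hx => by
    simp only [g, hw x hx, ContinuousLinearEquiv.symm_apply_apply, e.left_inv hx]
  have h1 : ContMDiffAt 𝓘(ℝ, Euc (d + 1)) 𝓘(ℝ, Euc (d + 1)) ∞ e' (f s) :=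
    contMDiffAt_of_mem_maximalAtlas h.codChart_mem_maximalAtlas hes'
  have h2 : ContMDiffAt (𝓡 d) (𝓡 d) ∞ e.symm (e s) :=
    contMDiffAt_symm_of_mem_maximalAtlas h.domChart_mem_maximalAtlas (e.map_source hes)
  have h3 : ContMDiffAt 𝓘(ℝ, Euc (d + 1)) 𝓘(ℝ, Euc (d + 1)) ∞ g (f s) := by
    have h4 : ContMDiff 𝓘(ℝ, Euc (d + 1)) 𝓘(ℝ, Euc d) ∞
      fun z => (h.equiv.symm z).1 :=
      (contDiff_fst.comp h.equiv.symm.contDiff).contMDiff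
    have h5 : ContMDiffAt 𝓘(ℝ, Euc (d + 1)) (𝓡 d) ∞ (fun z => (h.equiv.symm (e' z)).1) (f s) :=
      ContMDiffAt.comp (g := fun z => (h.equiv.symm z).1) (f s) (h4 _) h1
    have h6 : (h.equiv.symm (e' (f s))).1 = e s := by rw [hw s hes]; simp
    have h7 : ContMDiffAt 𝓘(ℝ, Euc (d + 1)) (𝓡 d) ∞
        (fun z => e.symm (h.equiv.symm (e' z)).1) (f s) :=
      ContMDiffAt.comp (g := e.symm) (f s) (by rw [h6]; exact h2) h5
    exact ContMDiffAt.comp (g := ((↑) : Sph d → Euc (d + 1))) (f s)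
      (contMDiff_coe_sphere (n := d) _) h7
  obtain ⟨K, t, ht, hK⟩ := (h3.contDiffAt.of_le (m := 1) (by simp)).exists_lipschitzOnWith
  -- An immersion alone could return to `f s` from another sheet; the embedding property excludes
  -- this.
  have h8 : ∀ᶠ z in 𝓝 (f s), ∀ x, f x = z → x ∈ e.source := by
    have := hf.isEmbedding.isInducing.nhds_eq_comap s ▸ e.open_source.mem_nhds hes
    obtain ⟨u, hu, hu'⟩ := mem_comap.1 this
    filter_upwards [hu] with z hz x hx
    exact hu' (by rwa [mem_preimage, hx])
  refine ⟨K, ?_⟩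
  filter_upwards [h8, ht] with z hz hzt x hx
  have h9 := hK.norm_sub_le hzt (mem_of_mem_nhds ht)
  rw [← hx, hg x (hz x hx), hg s hes, hx] at h9
  rwa [Subtype.dist_eq, dist_eq_norm]

open Site

variable {d N : ℕ} {D : Set (Euc (d + 1))} {a : Fin N → Euc (d + 1)}
  {φ : Fin N → Sph d → Euc (d + 1)}

theorem norm_sub_smul_dir {m : ℕ} (x y : Euc m) : ‖y - x‖ • dir x y = y - x := by
  rcases eq_or_ne x y with rfl | h
  · simp
  · exact (sub_eq_smul_dir h).symm

variable (φ) in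
/-- The sequence of sites of a code: the `i`-th block starts at number `t i` with a scatterer,
parametrized by `X i`, and continues with the walls met by `κ i`, parametrized by `Ω i`. -/
structure IsChain (κ : ℤ → QuasiTrajectory D a) (s : ℤ → Sph d) (t : ℤ → ℤ) (σ : ℤ → Site d N)
    (X : ℤ → Euc d → Euc (d + 1)) (Ω : ∀ i, Fin (κ i).n → Euc d → Euc (d + 1)) : Prop where
  starts : ∀ i, t (i + 1) = t i + (κ i).n + 1
  edge : ∀ i, IsEdge φ (κ (i - 1)) (κ i) (s i)
  start : ∀ i, σ (t i) = ⟨some (κ i).src, X i⟩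
  interior : ∀ i (k : Fin (κ i).n), σ (t i + 1 + (k : ℕ)) = ⟨none, Ω i k⟩
  start_param : ∀ i, IsLocalParam (range (φ (κ i).src)) (φ (κ i).src (s i)) (X i)
  start_crit : ∀ i, IsNondegCritPt (fun y => ⟪dir (κ (i - 1)).vFinal (κ i).vInit, X i y⟫) 0
  wall_param : ∀ i k, IsLocalParam (frontier D) ((κ i).p k) (Ω i k)
  wall_crit : ∀ i, IsNondegCritPt (fun y : Fin (κ i).n → Euc d =>
    pathLength (a (κ i).src) (a (κ i).tgt) (fun k => Ω i k (y k))) 0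

namespace IsChain

variable {κ : ℤ → QuasiTrajectory D a} {s : ℤ → Sph d} {t : ℤ → ℤ} {σ : ℤ → Site d N}
  {X : ℤ → Euc d → Euc (d + 1)} {Ω : ∀ i, Fin (κ i).n → Euc d → Euc (d + 1)}

theorem pos_start (h : IsChain φ κ s t σ X Ω) (i : ℤ) (y : Euc d) :
    (σ (t i)).pos a 0 y = a (κ i).src := by
  rw [h.start, pos_scatterer (j := (κ i).src) rfl, zero_smul, add_zero]

theorem pos_interior (h : IsChain φ κ s t σ X Ω) (i : ℤ) (k : Fin (κ i).n) (ε : ℝ) (y : Euc d) :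
    (σ (t i + 1 + (k : ℕ))).pos a ε y = Ω i k y := by
  rw [h.interior, pos_wall rfl]

/-- At `ε = 0` the scatterer parameters drop out. The last vertex is the start of the next block,
because the target of `κ i` is the source of `κ (i + 1)`. -/
theorem pos_eq_vertices (h : IsChain φ κ s t σ X Ω) (U : ℤ → Euc d) (i : ℤ)
    (r : Fin ((κ i).n + 2)) {m : ℤ} (hm : m = t i + (r : ℕ)) :
    (σ m).pos a 0 (U m) =
      vertices (a (κ i).src) (a (κ i).tgt) (fun k => Ω i k (U (t i + 1 + (k : ℕ)))) r := by
  induction r using Fin.cases with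
  | zero =>
    obtain rfl : m = t i := by simpa using hm
    rw [h.pos_start, vertices_zero]
  | succ r =>
    induction r using Fin.lastCases with
    | last =>
      obtain rfl : m = t (i + 1) := by
        rw [hm, h.starts, Fin.val_succ, Fin.val_last]; push_cast; ring
      have h1 := (h.edge (i + 1)).tgt_eq_src
      rw [add_sub_cancel_right] at h1
      rw [h.pos_start, Fin.succ_last, vertices_last, h1]
    | cast k =>
      obtain rfl : m = t i + 1 + (k : ℕ) := by
        rw [hm, Fin.val_succ, Fin.val_castSucc]; push_cast; ring
      rw [h.pos_interior, vertices_castSucc_succ]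

theorem pos_eq_vert (h : IsChain φ κ s t σ X Ω) (i : ℤ) (r : Fin ((κ i).n + 2)) {m : ℤ}
    (hm : m = t i + (r : ℕ)) : (σ m).pos a 0 0 = (κ i).vert r := by
  have h1 := h.pos_eq_vertices (fun _ => 0) i r hm
  simp only [fun k => (h.wall_param i k).apply_zero] at h1
  exact h1

theorem exists_link (h : IsChain φ κ s t σ X Ω) (m : ℤ) :
    ∃ i, ∃ r : Fin ((κ i).n + 1), (σ m).pos a 0 0 = (κ i).vert r.castSucc ∧
      (σ (m + 1)).pos a 0 0 = (κ i).vert r.succ := by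
  obtain ⟨i, h1, h2⟩ := exists_block h.starts m
  rw [h.starts] at h2
  refine ⟨i, ⟨(m - t i).toNat, by omega⟩, h.pos_eq_vert i _ ?_, h.pos_eq_vert i _ ?_⟩
  · simp only [Fin.castSucc_mk]; omega
  · simp only [Fin.succ_mk]; omega

theorem pos_ne (h : IsChain φ κ s t σ X Ω) (m : ℤ) :
    (σ m).pos a 0 0 ≠ (σ (m + 1)).pos a 0 0 := by
  obtain ⟨i, r, h1, h2⟩ := h.exists_link m
  rw [h1, h2]
  exact (κ i).ne r

theorem segment_clear (h : IsChain φ κ s t σ X Ω) (m : ℤ) :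
    openSegment ℝ ((σ m).pos a 0 0) ((σ (m + 1)).pos a 0 0) ⊆ D ∧
      ∀ j, a j ∉ openSegment ℝ ((σ m).pos a 0 0) ((σ (m + 1)).pos a 0 0) := by
  obtain ⟨i, r, h1, h2⟩ := h.exists_link m
  rw [h1, h2]
  exact ⟨(κ i).segment_subset r, (κ i).avoids r⟩

theorem isValid (h : IsChain φ κ s t σ X Ω) (m : ℤ) : (σ m).IsValid D φ := by
  obtain ⟨i, rfl | ⟨k, rfl⟩⟩ := block_cases h.starts m
  · have h1 := h.start_param i
    rw [← h1.apply_zero] at h1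
    rw [h.start, IsValid, surface_scatterer (j := (κ i).src) rfl]
    exact h1
  · have h1 := h.wall_param i k
    rw [← h1.apply_zero] at h1
    rw [h.interior, IsValid, surface_wall rfl]
    exact h1

theorem pos_next_start (h : IsChain φ κ s t σ X Ω) (U : ℤ → Euc d) (i : ℤ) :
    (σ (t i + 1)).pos a 0 (U (t i + 1)) =
      vertices (a (κ i).src) (a (κ i).tgt) (fun k => Ω i k (U (t i + 1 + (k : ℕ)))) 1 :=
  h.pos_eq_vertices U i 1 (by simp)

theorem pos_prev_start (h : IsChain φ κ s t σ X Ω) (U : ℤ → Euc d) (i : ℤ) :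
    (σ (t i - 1)).pos a 0 (U (t i - 1)) =
      vertices (a (κ (i - 1)).src) (a (κ (i - 1)).tgt)
        (fun k => Ω (i - 1) k (U (t (i - 1) + 1 + (k : ℕ)))) (Fin.last _).castSucc := by
  refine h.pos_eq_vertices U (i - 1) _ ?_
  have h1 := h.starts (i - 1)
  rw [sub_add_cancel] at h1
  rw [h1, Fin.val_castSucc, Fin.val_last, add_sub_cancel_right]

theorem dir_next_start (h : IsChain φ κ s t σ X Ω) (i : ℤ) :
    dir ((σ (t i)).pos a 0 0) ((σ (t i + 1)).pos a 0 0) = (κ i).vInit := by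
  rw [h.pos_eq_vert i 0 (by simp), h.pos_eq_vert i 1 (by simp)]; rfl

theorem dir_prev_start (h : IsChain φ κ s t σ X Ω) (i : ℤ) :
    dir ((σ (t i - 1)).pos a 0 0) ((σ (t i)).pos a 0 0) = (κ (i - 1)).vFinal := by
  have h1 := h.starts (i - 1)
  rw [sub_add_cancel] at h1
  rw [h.pos_eq_vert (i - 1) (Fin.last _).castSucc
    (by rw [h1, Fin.val_castSucc, Fin.val_last, add_sub_cancel_right]),
    h.pos_eq_vert (i - 1) (Fin.last _) (by rw [h1, Fin.val_last]; push_cast; ring)]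
  rfl

/-- The decoupling: in the limit the wall equations of a block contain no other parameters than
those of its own walls. -/
theorem mirror_interior (h : IsChain φ κ s t σ X Ω) (U : ℤ → Euc d) (i : ℤ) (k : Fin (κ i).n) :
    mirror a (σ (t i + 1 + (k : ℕ) - 1)) (σ (t i + 1 + (k : ℕ))) (σ (t i + 1 + (k : ℕ) + 1))
      (0, U (t i + 1 + (k : ℕ) - 1), U (t i + 1 + (k : ℕ)), U (t i + 1 + (k : ℕ) + 1)) =
    defect (a (κ i).src) (a (κ i).tgt) (Ω i) k (fun k => U (t i + 1 + (k : ℕ))) := by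
  rw [mirror, defect]
  simp only
  rw [h.pos_eq_vertices U i k.castSucc.castSucc (m := t i + 1 + (k : ℕ) - 1) (by simp; ring),
    h.pos_eq_vertices U i k.succ.succ (m := t i + 1 + (k : ℕ) + 1) (by simp; ring),
    h.pos_interior, h.interior]

/-- With the walls at their limit positions both directions at the scatterer are fixed, and only the
chart of the scatterer varies. -/
theorem mirror_start_zero (h : IsChain φ κ s t σ X Ω) {U : ℤ → Euc d}
    (hU : ∀ i (k : Fin (κ i).n), U (t i + 1 + (k : ℕ)) = 0) (i : ℤ) :
    mirror a (σ (t i - 1)) (σ (t i)) (σ (t i + 1)) (0, U (t i - 1), U (t i), U (t i + 1)) =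
    (innerSL ℝ ((κ (i - 1)).vFinal - (κ i).vInit)).comp (fderiv ℝ (X i) (U (t i))) := by
  have h1 : (σ (t i + 1)).pos a 0 (U (t i + 1)) = (σ (t i + 1)).pos a 0 0 := by
    rw [h.pos_next_start, h.pos_next_start (fun _ => 0)]
    simp only [hU]
  have h2 : (σ (t i - 1)).pos a 0 (U (t i - 1)) = (σ (t i - 1)).pos a 0 0 := by
    rw [h.pos_prev_start, h.pos_prev_start (fun _ => 0)]
    simp only [hU]
  have h3 : (σ (t i)).pos a 0 (U (t i)) = (σ (t i)).pos a 0 0 := by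
    rw [h.pos_start, h.pos_start]
  rw [mirror]
  simp only
  rw [h1, h2, h3, h.dir_next_start, h.dir_prev_start, h.start]

end IsChain

theorem ReflectsAt.ne {S : Set (Euc (d + 1))} {q e e' : Euc (d + 1)} (h : ReflectsAt S q e e') :
    e ≠ e' := by
  obtain ⟨ν, h1, -, h2, h3⟩ := h
  intro h4
  rw [h4, eq_comm, sub_eq_self, smul_eq_zero] at h3
  rcases h3 with h3 | h3
  · rw [h4] at h2
    exact h2 (by linarith)
  · simp [h3] at h1

/-- The vectors `e - e'` and `dir e e'` differ by the factor `-‖e' - e‖`, which is nonzero when the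
direction changes. -/
theorem IsNondegCritPt.smul_inner {V : Type*} [NormedAddCommGroup V] [NormedSpace ℝ V]
    {e e' : Euc (d + 1)} {f : V → Euc (d + 1)}
    (h : IsNondegCritPt (fun y => ⟪dir e e', f y⟫) 0) (hf : ContDiffAt ℝ ∞ f 0) :
    (innerSL ℝ (e - e')).comp (fderiv ℝ f 0) = 0 ∧
      ∀ u, (e ≠ e') → (innerSL ℝ (e - e')).comp (fderiv ℝ (fderiv ℝ f) 0 u) = 0 → u = 0 := by
  have hf' : ∀ᶠ y in 𝓝 0, DifferentiableAt ℝ f y :=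
    ((hf.of_le (m := 1) (by simp)).eventually (by simp)).mono fun y hy =>
      hy.differentiableAt (by simp)
  have h1 : ∀ y, DifferentiableAt ℝ f y → fderiv ℝ (fun y => ⟪dir e e', f y⟫) y =
      (innerSL ℝ (dir e e')).comp (fderiv ℝ f y) := fun y hy =>
    ((innerSL ℝ (dir e e')).hasFDerivAt.comp y hy.hasFDerivAt).fderiv
  have h2 : fderiv ℝ (fun y => ⟪dir e e', f y⟫) =ᶠ[𝓝 0]
      fun y => (innerSL ℝ (dir e e')).comp (fderiv ℝ f y) := hf'.mono h1
  have h3 : DifferentiableAt ℝ (fderiv ℝ f) 0 :=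
    (hf.fderiv_right (m := ∞) (by simp)).differentiableAt (by simp)
  have h4 : fderiv ℝ (fderiv ℝ (fun y => ⟪dir e e', f y⟫)) 0 =
      (ContinuousLinearMap.postcomp V (innerSL ℝ (dir e e'))).comp (fderiv ℝ (fderiv ℝ f) 0) := by
    rw [h2.fderiv_eq]
    exact (HasFDerivAt.comp (g := fun l : V →L[ℝ] Euc (d + 1) => (innerSL ℝ (dir e e')).comp l) 0
      (ContinuousLinearMap.postcomp V (innerSL ℝ (dir e e'))).hasFDerivAt h3.hasFDerivAt).fderiv
  have h5 : ∀ w : Euc (d + 1), ⟪e - e', w⟫ = -‖e' - e‖ * ⟪dir e e', w⟫ := fun w => by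
    rw [← neg_sub, inner_neg_left, neg_mul, ← real_inner_smul_left, norm_sub_smul_dir]
  constructor
  · have h6 := h.1
    rw [h1 0 hf'.self_of_nhds] at h6
    ext w
    have h7 := DFunLike.congr_fun h6 w
    have h8 : ⟪dir e e', fderiv ℝ f 0 w⟫ = 0 := h7
    exact (h5 _).trans ((congrArg _ h8).trans (mul_zero _))
  · intro u hne hu
    refine h.2 u fun w => ?_
    have h7 := DFunLike.congr_fun hu w
    rw [h4]
    simp only [ContinuousLinearMap.comp_apply, innerSL_apply_apply, zero_apply,
      ContinuousLinearMap.postcomp_apply] at h7 ⊢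
    rw [h5, mul_eq_zero, neg_eq_zero] at h7
    exact h7.resolve_left (norm_ne_zero_iff.2 (sub_ne_zero.2 hne.symm))

open Site

variable {d N : ℕ} {D : Set (Euc (d + 1))} {a : Fin N → Euc (d + 1)}
  {φ : Fin N → Sph d → Euc (d + 1)}

/-- The Hessian of the length of a quasi-trajectory. -/
theorem QuasiTrajectory.exists_hessian_bound (κ : QuasiTrajectory D a)
    {ψ : Fin κ.n → Euc d → Euc (d + 1)} (hψ : ∀ k, IsLocalParam (frontier D) (κ.p k) (ψ k))
    (hcrit : IsNondegCritPt (fun y : Fin κ.n → Euc d =>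
      pathLength (a κ.src) (a κ.tgt) (fun k => ψ k (y k))) 0) :
    (∀ k, DifferentiableAt ℝ (defect (a κ.src) (a κ.tgt) ψ k) 0) ∧
    (∀ k, defect (a κ.src) (a κ.tgt) ψ k 0 = 0) ∧
    Function.Surjective (fun (u : Fin κ.n → Euc d) k =>
      fderiv ℝ (defect (a κ.src) (a κ.tgt) ψ k) 0 u) ∧
    ∃ K : ℝ, ∀ u c, (∀ k, ‖fderiv ℝ (defect (a κ.src) (a κ.tgt) ψ k) 0 u‖ ≤ c) →
      ∀ k, ‖u k‖ ≤ K * c := by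
  have hne : ∀ r : Fin (κ.n + 1), vertices (a κ.src) (a κ.tgt) (fun k => ψ k 0) r.castSucc ≠
      vertices (a κ.src) (a κ.tgt) (fun k => ψ k 0) r.succ := by
    simp only [fun k => (hψ k).apply_zero]
    exact κ.ne
  have hs : ∀ k, ContDiffAt ℝ ∞ (ψ k) 0 := fun k => (hψ k).contDiffAt
  obtain ⟨h1, h2⟩ := hcrit.defect_of_pathLength hs hne
  let H : (Fin κ.n → Euc d) →L[ℝ] (Fin κ.n → (Euc d →L[ℝ] ℝ)) :=
    ContinuousLinearMap.pi fun k => fderiv ℝ (defect (a κ.src) (a κ.tgt) ψ k) 0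
  have hH : Function.Injective H := (injective_iff_map_eq_zero H).2 fun u hu =>
    h2 u fun k => congrFun hu k
  have hfin : Module.finrank ℝ (Euc d) = Module.finrank ℝ (Euc d →L[ℝ] ℝ) :=
    (InnerProductSpace.toDual ℝ (Euc d)).toLinearEquiv.finrank_eq
  refine ⟨fun k => (contDiffAt_defect (y := 0) hs hne k).differentiableAt (by simp), h1, ?_, ?_⟩
  · exact (LinearMap.injective_iff_surjective_of_finrank_eq_finrank (f := H.toLinearMap)
      (by rw [Module.finrank_pi_fintype, Module.finrank_pi_fintype, hfin])).1 hH
  · obtain ⟨c, hc, h3⟩ := exists_lower_bound_of_injective hH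
    refine ⟨c⁻¹, fun u b hu k => (norm_le_pi_norm u k).trans ?_⟩
    rw [le_inv_mul_iff₀ hc]
    exact (h3 u).trans ((pi_norm_le_iff_of_nonneg ((norm_nonneg _).trans (hu k))).2 hu)

/-- The second fundamental form of a scatterer at a reflection point. -/
theorem IsNondegCritPt.exists_bound {e e' : Euc (d + 1)} (hne : e ≠ e')
    {f : Euc d → Euc (d + 1)} (h : IsNondegCritPt (fun y => ⟪dir e e', f y⟫) 0)
    (hf : ContDiffAt ℝ ∞ f 0) :
    Function.Surjective (fun u => (innerSL ℝ (e - e')).comp (fderiv ℝ (fderiv ℝ f) 0 u)) ∧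
      ∃ K : ℝ, ∀ u, ‖u‖ ≤ K * ‖(innerSL ℝ (e - e')).comp (fderiv ℝ (fderiv ℝ f) 0 u)‖ := by
  let Q : Euc d →L[ℝ] (Euc d →L[ℝ] ℝ) :=
    (ContinuousLinearMap.postcomp (Euc d) (innerSL ℝ (e - e'))).comp (fderiv ℝ (fderiv ℝ f) 0)
  have hQ : Function.Injective Q := (injective_iff_map_eq_zero Q).2 fun u hu =>
    (h.smul_inner hf).2 u hne hu
  have hfin : Module.finrank ℝ (Euc d) = Module.finrank ℝ (Euc d →L[ℝ] ℝ) :=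
    (InnerProductSpace.toDual ℝ (Euc d)).toLinearEquiv.finrank_eq
  refine ⟨(LinearMap.injective_iff_surjective_of_finrank_eq_finrank (f := Q.toLinearMap) hfin).1 hQ,
    ?_⟩
  obtain ⟨c, hc, h3⟩ := exists_lower_bound_of_injective hQ
  exact ⟨c⁻¹, fun u => by rw [le_inv_mul_iff₀ hc]; exact h3 u⟩

namespace IsChain

variable {κ : ℤ → QuasiTrajectory D a} {s : ℤ → Sph d} {t : ℤ → ℤ} {σ : ℤ → Site d N}
  {X : ℤ → Euc d → Euc (d + 1)} {Ω : ∀ i, Fin (κ i).n → Euc d → Euc (d + 1)}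

theorem isLimitTriple (h : IsChain φ κ s t σ X Ω) (m : ℤ) :
    IsLimitTriple D a φ (σ (m - 1)) (σ m) (σ (m + 1)) := by
  have hl := h.pos_ne (m - 1)
  rw [sub_add_cancel] at hl
  have key : dir ((σ (m - 1)).pos a 0 0) ((σ m).pos a 0 0) ≠
      dir ((σ m).pos a 0 0) ((σ (m + 1)).pos a 0 0) ∧
      mirror a (σ (m - 1)) (σ m) (σ (m + 1)) 0 = 0 := by
    obtain ⟨i, rfl | ⟨k, rfl⟩⟩ := block_cases h.starts m
    · rw [h.dir_next_start, h.dir_prev_start]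
      refine ⟨(h.edge i).direction_change, ?_⟩
      exact (h.mirror_start_zero (U := fun _ => 0) (fun _ _ => rfl) i).trans
        ((h.start_crit i).smul_inner (h.start_param i).contDiffAt).1
    · constructor
      · rw [h.pos_eq_vert i k.castSucc.castSucc (m := t i + 1 + (k : ℕ) - 1) (by simp; ring),
          h.pos_eq_vert i k.succ.succ (m := t i + 1 + (k : ℕ) + 1) (by simp; ring),
          h.pos_interior, (h.wall_param i k).apply_zero]
        exact ((κ i).reflects k).ne
      · exact (h.mirror_interior (fun _ => 0) i k).trans
          (((κ i).exists_hessian_bound (h.wall_param i) (h.wall_crit i)).2.1 k)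
  exact ⟨h.isValid _, h.isValid _, h.isValid _, ⟨(h.isValid _).contDiffAt, (h.isValid _).contDiffAt,
    (h.isValid _).contDiffAt, hl, h.pos_ne m, key.1⟩, key.2⟩

/-- At a scatterer the ray condition is membership in `U_κ^-`, up to rescaling time by the length of
the first segment. -/
theorem isClear_next (h : IsChain φ κ s t σ X Ω) (m : ℤ) :
    IsClear D a φ (σ m) ((σ (m + 1)).pos a 0 0) := by
  refine ⟨(h.segment_clear m).1, (h.segment_clear m).2, fun j hj τ hτ => ?_⟩
  obtain ⟨i, rfl | ⟨k, rfl⟩⟩ := block_cases h.starts m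
  · have hne : 0 < ‖(σ (t i + 1)).pos a 0 0 - (σ (t i)).pos a 0 0‖ :=
      norm_pos_iff.2 (sub_ne_zero.2 (h.pos_ne _).symm)
    rw [← norm_sub_smul_dir, h.dir_next_start, smul_smul]
    have h1 := (h.edge i).mem_startSet _ (mul_pos hτ hne)
    rw [← (h.start_param i).apply_zero] at h1
    rw [h.start] at hj ⊢
    obtain rfl : (κ i).src = j := by simpa using hj
    rw [h.start] at h1
    exact h1
  · rw [h.interior] at hj
    simp at hj

theorem isClear_prev (h : IsChain φ κ s t σ X Ω) (m : ℤ) :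
    IsClear D a φ (σ m) ((σ (m - 1)).pos a 0 0) := by
  have hs := h.segment_clear (m - 1)
  have hne := h.pos_ne (m - 1)
  rw [sub_add_cancel, openSegment_symm] at hs
  rw [sub_add_cancel] at hne
  refine ⟨hs.1, hs.2, fun j hj τ hτ => ?_⟩
  obtain ⟨i, rfl | ⟨k, rfl⟩⟩ := block_cases h.starts m
  · have hne : 0 < ‖(σ (t i)).pos a 0 0 - (σ (t i - 1)).pos a 0 0‖ :=
      norm_pos_iff.2 (sub_ne_zero.2 hne.symm)
    rw [← neg_sub ((σ (t i)).pos a 0 0), ← norm_sub_smul_dir, h.dir_prev_start, smul_neg, smul_smul,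
      ← sub_eq_add_neg]
    have h1 := (h.edge i).mem_endSet _ (mul_pos hτ hne)
    rw [(h.edge i).tgt_eq_src, ← (h.start_param i).apply_zero] at h1
    rw [h.start] at hj h1 ⊢
    obtain rfl : (κ i).src = j := by simpa using hj
    exact h1
  · rw [h.interior] at hj
    simp at hj

theorem hasDerivAt_tridiag (h : IsChain φ κ s t σ X Ω) (U : ℤ → Euc d) (m : ℤ) (v : Euc d) :
    HasDerivAt (fun τ : ℝ => mirror a (σ (m - 1)) (σ m) (σ (m + 1))
      (0, (τ • U) (m - 1), (τ • U) m, (τ • U) (m + 1)) v)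
      (tridiag (fun m => mirrorDeriv a (σ (m - 1)) (σ m) (σ (m + 1)) 0) U m v) 0 := by
  have h1 := (h.isLimitTriple m).regular.hasDerivAt_line (U (m - 1), U m, U (m + 1)) v
  refine h1.congr_of_eventuallyEq (Eventually.of_forall fun τ => ?_)
  simp

/-- Differentiating `mirror_interior` along `U` identifies the diagonal block with the Hessian of
the length of `κ i`. -/
theorem tridiag_interior (h : IsChain φ κ s t σ X Ω) (U : ℤ → Euc d) (i : ℤ) (k : Fin (κ i).n) :
    tridiag (fun m => mirrorDeriv a (σ (m - 1)) (σ m) (σ (m + 1)) 0) U (t i + 1 + (k : ℕ)) =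
      fderiv ℝ (defect (a (κ i).src) (a (κ i).tgt) (Ω i) k) 0
        (fun k => U (t i + 1 + (k : ℕ))) := by
  ext v
  refine (h.hasDerivAt_tridiag U _ v).unique ?_
  simp only [h.mirror_interior]
  have h1 : HasDerivAt (fun (τ : ℝ) (k : Fin (κ i).n) => (τ • U) (t i + 1 + (k : ℕ)))
      (fun k => U (t i + 1 + (k : ℕ))) 0 :=
    hasDerivAt_pi.2 fun k => by
      simpa using (hasDerivAt_id (0 : ℝ)).smul_const (U (t i + 1 + (k : ℕ)))
  have h2 : HasFDerivAt (defect (a (κ i).src) (a (κ i).tgt) (Ω i) k)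
      (fderiv ℝ (defect (a (κ i).src) (a (κ i).tgt) (Ω i) k) 0)
      (fun k => ((0 : ℝ) • U) (t i + 1 + (k : ℕ))) := by
    rw [zero_smul]
    exact (((κ i).exists_hessian_bound (h.wall_param i) (h.wall_crit i)).1 k).hasFDerivAt
  exact (ContinuousLinearMap.apply ℝ ℝ v).hasFDerivAt.comp_hasDerivAt (0 : ℝ)
    (HasFDerivAt.comp_hasDerivAt
      (l := defect (a (κ i).src) (a (κ i).tgt) (Ω i) k) (0 : ℝ) h2 h1)

/-- By linearity, split `U` into its values at the starts and the rest. The first part vanishes at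
the walls, so `mirror_start_zero` applies and yields the second fundamental form; the rest is the
coupling to the adjacent walls. -/
theorem tridiag_start (h : IsChain φ κ s t σ X Ω) (U : ℤ → Euc d) (i : ℤ) :
    tridiag (fun m => mirrorDeriv a (σ (m - 1)) (σ m) (σ (m + 1)) 0) U (t i) =
      (innerSL ℝ ((κ (i - 1)).vFinal - (κ i).vInit)).comp (fderiv ℝ (fderiv ℝ (X i)) 0 (U (t i))) +
      tridiag (fun m => mirrorDeriv a (σ (m - 1)) (σ m) (σ (m + 1)) 0) (eraseStarts t U) (t i) := by
  rw [← sub_eq_iff_eq_add]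
  set V := U - eraseStarts t U with hV
  have hV0 : ∀ i (k : Fin (κ i).n), V (t i + 1 + (k : ℕ)) = 0 := fun i k => by
    rw [hV, Pi.sub_apply, eraseStarts_interior h.starts, sub_self]
  have hV1 : V (t i) = U (t i) := by rw [hV, Pi.sub_apply, eraseStarts_start, sub_zero]
  rw [← Pi.sub_apply, ← map_sub, ← hV, ← hV1]
  ext v
  refine (h.hasDerivAt_tridiag V _ v).unique ?_
  have h0 : ∀ (τ : ℝ) i (k : Fin (κ i).n), (τ • V) (t i + 1 + (k : ℕ)) = 0 := fun τ i k => by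
    rw [Pi.smul_apply, hV0, smul_zero]
  simp only [fun τ => h.mirror_start_zero (h0 τ) i]
  have h1 : HasDerivAt (fun τ : ℝ => (τ • V) (t i)) (V (t i)) 0 := by
    simpa using (hasDerivAt_id (0 : ℝ)).smul_const (V (t i))
  have h2 : HasFDerivAt (fderiv ℝ (X i)) (fderiv ℝ (fderiv ℝ (X i)) 0) (((0 : ℝ) • V) (t i)) := by
    rw [zero_smul]
    exact (((h.start_param i).contDiffAt.fderiv_right (m := ∞) (by simp)).differentiableAt
      (by simp)).hasFDerivAt
  have h3 : HasDerivAt (fun τ : ℝ => fderiv ℝ (X i) ((τ • V) (t i)))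
      (fderiv ℝ (fderiv ℝ (X i)) 0 (V (t i))) 0 :=
    HasFDerivAt.comp_hasDerivAt (l := fderiv ℝ (X i)) (0 : ℝ) h2 h1
  exact ((innerSL ℝ ((κ (i - 1)).vFinal - (κ i).vInit)).comp
    (ContinuousLinearMap.apply ℝ (Euc (d + 1)) v)).hasFDerivAt.comp_hasDerivAt (0 : ℝ) h3

theorem uniformlyInvertible (h : IsChain φ κ s t σ X Ω) {K₁ K₂ M : ℝ} (hK₁ : 0 ≤ K₁) (hK₂ : 0 ≤ K₂)
    (hM : ∀ m, ‖mirrorDeriv a (σ (m - 1)) (σ m) (σ (m + 1)) 0‖ ≤ M)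
    (hH : ∀ i u c, (∀ k, ‖fderiv ℝ (defect (a (κ i).src) (a (κ i).tgt) (Ω i) k) 0 u‖ ≤ c) →
      ∀ k, ‖u k‖ ≤ K₁ * c)
    (hQ : ∀ i u, ‖u‖ ≤ K₂ * ‖(innerSL ℝ ((κ (i - 1)).vFinal - (κ i).vInit)).comp
      (fderiv ℝ (fderiv ℝ (X i)) 0 u)‖) :
    UniformlyInvertible (fun m => mirrorDeriv a (σ (m - 1)) (σ m) (σ (m + 1)) 0)
      (K₁ + K₂ * (1 + M * K₁)) :=
  uniformlyInvertible_of_blocks h.starts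
    (fun i u k => fderiv ℝ (defect (a (κ i).src) (a (κ i).tgt) (Ω i) k) 0 u)
    (fun i u => (innerSL ℝ ((κ (i - 1)).vFinal - (κ i).vInit)).comp
      (fderiv ℝ (fderiv ℝ (X i)) 0 u)) hK₁ hK₂ hM
    (fun i k U => h.tridiag_interior U i k) (fun i U => h.tridiag_start U i) hH
    (fun i => ((κ i).exists_hessian_bound (h.wall_param i) (h.wall_crit i)).2.2.1) hQ
    (fun i => ((h.start_crit i).exists_bound (h.edge i).direction_change
      (h.start_param i).contDiffAt).1)

end IsChain

/-! ### Shadowing estimates and conclusion -/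

open Site

variable {d N : ℕ} {D : Set (Euc (d + 1))} {a : Fin N → Euc (d + 1)}
  {φ : Fin N → Sph d → Euc (d + 1)}

theorem IsLocalParam.eventually_dist_le {S : Set (Euc (d + 1))} {q : Euc (d + 1)}
    {ψ : Euc d → Euc (d + 1)} (h : IsLocalParam S q ψ) :
    ∃ L > 0, ∀ᶠ y in 𝓝 0, dist (ψ y) q ≤ L * ‖y‖ := by
  obtain ⟨L, hL, h1⟩ := h.hasStrictFDerivAt.eventually_lipschitz
  have h2 : Tendsto (fun y : Euc d => (y, (0 : Euc d))) (𝓝 0) (𝓝 (0, 0)) :=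
    Continuous.tendsto' (by fun_prop) _ _ rfl
  refine ⟨L, hL, ?_⟩
  filter_upwards [h2.eventually h1] with y hy
  simpa [dist_eq_norm, h.apply_zero] using hy

theorem QuasiTrajectory.exists_shadow_bound (κ : QuasiTrajectory D a)
    {ψ : Fin κ.n → Euc d → Euc (d + 1)} (hψ : ∀ k, IsLocalParam (frontier D) (κ.p k) (ψ k)) :
    ∃ L : ℝ, ∀ᶠ y in 𝓝 0, ∀ k, ψ k y ∈ frontier D ∧ dist (ψ k y) (κ.p k) ≤ L * ‖y‖ := by
  obtain ⟨L, -, hL⟩ := exists_uniform_bound (finite_univ : (univ : Set (Fin κ.n)).Finite)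
    (P := fun k L => ∀ᶠ y in 𝓝 0, dist (ψ k y) (κ.p k) ≤ L * ‖y‖)
    (fun k c c' hc h => by filter_upwards [h] with y hy using hy.trans (by gcongr))
    (fun k _ => by obtain ⟨L, -, h⟩ := (hψ k).eventually_dist_le; exact ⟨L, h⟩)
  refine ⟨L, eventually_all.2 fun k => ?_⟩
  filter_upwards [(hψ k).eventually_mem, hL k (mem_univ k)] with y h1 h2 using ⟨h1, h2⟩

/-- Shadowing is measured by the parameter on the sphere, while the chart controls only its image
under the embedding. -/
theorem exists_preimage_bound {f : Sph d → Euc (d + 1)}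
    (hf : Manifold.IsSmoothEmbedding (𝓡 d) 𝓘(ℝ, Euc (d + 1)) ∞ f) {s : Sph d}
    {ψ : Euc d → Euc (d + 1)} (h : IsLocalParam (range f) (f s) ψ) :
    ∃ L : ℝ, ∀ᶠ y in 𝓝 0, ∃ x, f x = ψ y ∧ dist x s ≤ L * ‖y‖ := by
  obtain ⟨L₁, h1⟩ := exists_lipschitz_inverse hf s
  obtain ⟨L₂, -, h2⟩ := h.eventually_dist_le
  refine ⟨max L₁ 0 * L₂, ?_⟩
  filter_upwards [h.eventually_mem, h2, h.tendsto.eventually h1] with y ⟨x, hx⟩ h3 h4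
  refine ⟨x, hx, (h4 x hx).trans ?_⟩
  rw [← dist_eq_norm, mul_assoc]
  exact mul_le_mul (le_max_left _ _) h3 dist_nonneg (le_max_right _ _)

theorem exists_isChain {κ : ℤ → QuasiTrajectory D a} {s : ℤ → Sph d}
    {X : ℤ → Euc d → Euc (d + 1)} {Ω : ∀ i, Fin (κ i).n → Euc d → Euc (d + 1)}
    (hedge : ∀ i, IsEdge φ (κ (i - 1)) (κ i) (s i))
    (hX : ∀ i, IsLocalParam (range (φ (κ i).src)) (φ (κ i).src (s i)) (X i))
    (hXc : ∀ i, IsNondegCritPt (fun y => ⟪dir (κ (i - 1)).vFinal (κ i).vInit, X i y⟫) 0)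
    (hΩ : ∀ i k, IsLocalParam (frontier D) ((κ i).p k) (Ω i k))
    (hΩc : ∀ i, IsNondegCritPt (fun y : Fin (κ i).n → Euc d =>
      pathLength (a (κ i).src) (a (κ i).tgt) (fun k => Ω i k (y k))) 0) :
    ∃ t σ, IsChain φ κ s t σ X Ω := by
  obtain ⟨t, ht⟩ := exists_block_starts fun i => (κ i).n
  obtain ⟨σ, hσ0, hσ1⟩ := exists_flatten (α := Site d N) ht
    (fun i => ⟨some (κ i).src, X i⟩) (fun i k => ⟨none, Ω i k⟩)
  exact ⟨t, σ, ht, hedge, hσ0, hσ1, hX, hXc, hΩ, hΩc⟩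

theorem IsChain.mem_of_forall {κ : ℤ → QuasiTrajectory D a} {s : ℤ → Sph d} {t : ℤ → ℤ}
    {σ : ℤ → Site d N} {X : ℤ → Euc d → Euc (d + 1)}
    {Ω : ∀ i, Fin (κ i).n → Euc d → Euc (d + 1)} (h : IsChain φ κ s t σ X Ω)
    {S : Set (Site d N)} (h0 : ∀ i, ⟨some (κ i).src, X i⟩ ∈ S) (h1 : ∀ i k, ⟨none, Ω i k⟩ ∈ S)
    (m : ℤ) : σ m ∈ S := by
  obtain ⟨i, rfl | ⟨k, rfl⟩⟩ := block_cases h.starts m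
  · rw [h.start]; exact h0 i
  · rw [h.interior]; exact h1 i k

end SmallScatterers

open SmallScatterers in
theorem mainTheorem9 {d N : ℕ} (hd : 1 ≤ d)
    (D : Set (Euc (d + 1))) (hDo : IsOpen D) (hDc : IsConnected D) (hDs : HasSmoothBoundary D)
    (a : Fin N → Euc (d + 1)) (ha : Function.Injective a) (haD : ∀ j, a j ∈ D)
    (φ : Fin N → Sph d → Euc (d + 1))
    (hφ : ∀ j, Manifold.IsSmoothEmbedding (𝓡 d) 𝓘(ℝ, Euc (d + 1)) ∞ (φ j))
    (J : Set (QuasiTrajectory D a)) (hJ : J.Finite)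
    (E : Set (QuasiTrajectory D a × QuasiTrajectory D a × Sph d)) (hE : E.Finite)
    (hEJ : ∀ κ κ' s, (κ, κ', s) ∈ E → κ ∈ J ∧ κ' ∈ J ∧ IsEdge φ κ κ' s) :
    ∃ ε₀ C : ℝ, 0 < ε₀ ∧ 0 < C ∧ ∀ ε : ℝ, 0 < ε → ε < ε₀ →
      ∀ (κ : ℤ → QuasiTrajectory D a) (s : ℤ → Sph d), IsCode E κ s →
        ∃ q : ℤ → Euc (d + 1),
          IsBilliardTrajectory D a φ ε q ∧
          Shadows φ ε (C * ε) κ s q ∧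
          IsHyperbolic (walls D a φ ε) q := by
  -- Wall charts are chosen once per quasi-trajectory and scatterer charts once per edge, not per
  -- position in a code, so the set `S` of sites is finite.
  choose ψ hψ hψc using fun κ : QuasiTrajectory D a => κ.nondegenerate
  have hedge : ∀ e : QuasiTrajectory D a × QuasiTrajectory D a × Sph d, e ∈ E →
      ∃ χ, IsLocalParam (range (φ e.2.1.src)) (φ e.2.1.src e.2.2) χ ∧
        IsNondegCritPt (fun y => ⟪dir e.1.vFinal e.2.1.vInit, χ y⟫) 0 := fun e he => by
    obtain ⟨-, -, h⟩ := hEJ _ _ _ he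
    have h1 := h.curvature
    rw [h.tgt_eq_src] at h1
    exact h1
  choose! χ hχ hχc using hedge
  let edgeSite : QuasiTrajectory D a × QuasiTrajectory D a × Sph d → Site d N :=
    fun e => ⟨some e.2.1.src, χ e⟩
  let wallSite : ∀ κ : QuasiTrajectory D a, Fin κ.n → Site d N := fun κ k => ⟨none, ψ κ k⟩
  let S : Set (Site d N) := edgeSite '' E ∪ ⋃ κ ∈ J, range (wallSite κ)
  have hS : S.Finite := (hE.image _).union (hJ.biUnion fun κ _ => finite_range _)
  have hSv : ∀ B ∈ S, B.IsValid D φ := by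
    rintro B (⟨e, he, rfl⟩ | hB)
    · have h1 := hχ e he
      rw [← h1.apply_zero] at h1
      rw [Site.IsValid, Site.surface_scatterer (j := e.2.1.src) rfl]
      exact h1
    · obtain ⟨κ, -, k, rfl⟩ := mem_iUnion₂.1 hB
      have h1 := hψ κ k
      rw [← h1.apply_zero] at h1
      rw [Site.IsValid, Site.surface_wall rfl]
      exact h1
  obtain ⟨K₁, hK₁, hH⟩ := exists_uniform_bound hJ (P := fun κ K => ∀ u c,
      (∀ k, ‖fderiv ℝ (defect (a κ.src) (a κ.tgt) (ψ κ) k) 0 u‖ ≤ c) → ∀ k, ‖u k‖ ≤ K * c)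
    (fun κ c c' hc h u b hb k => (h u b hb k).trans
      (mul_le_mul_of_nonneg_right hc ((norm_nonneg _).trans (hb k))))
    (fun κ _ => (κ.exists_hessian_bound (hψ κ) (hψc κ)).2.2.2)
  obtain ⟨K₂, hK₂, hQ⟩ := exists_uniform_bound hE (P := fun e K => ∀ u, ‖u‖ ≤
      K * ‖(innerSL ℝ (e.1.vFinal - e.2.1.vInit)).comp (fderiv ℝ (fderiv ℝ (χ e)) 0 u)‖)
    (fun e c c' hc h u => (h u).trans (by gcongr))
    (fun e he => ((hχc e he).exists_bound (hEJ _ _ _ he).2.2.direction_change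
      (hχ e he).contDiffAt).2)
  obtain ⟨M, hM0, hM⟩ := exists_uniform_bound (hS.prod (hS.prod hS))
    (P := fun τ M => ‖Site.mirrorDeriv a τ.1 τ.2.1 τ.2.2 0‖ ≤ M)
    (fun _ c c' hc h => h.trans hc) (fun _ _ => ⟨_, le_rfl⟩)
  obtain ⟨L₁, hL₁, hwall⟩ := exists_uniform_bound hJ (P := fun κ L => ∀ᶠ y in 𝓝 0, ∀ k,
      ψ κ k y ∈ frontier D ∧ dist (ψ κ k y) (κ.p k) ≤ L * ‖y‖)
    (fun κ c c' hc h => by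
      filter_upwards [h] with y hy k using ⟨(hy k).1, (hy k).2.trans (by gcongr)⟩)
    (fun κ _ => κ.exists_shadow_bound (hψ κ))
  obtain ⟨L₂, hL₂, hscat⟩ := exists_uniform_bound hE (P := fun e L => ∀ᶠ y in 𝓝 0, ∃ x,
      φ e.2.1.src x = χ e y ∧ dist x e.2.2 ≤ L * ‖y‖)
    (fun e c c' hc h => by
      filter_upwards [h] with y ⟨x, h1, h2⟩ using ⟨x, h1, h2.trans (by gcongr)⟩)
    (fun e he => exists_preimage_bound (hφ _) (hχ e he))
  obtain ⟨ρ, hρ, hρ'⟩ := Metric.eventually_nhds_iff.1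
    (((eventually_all_finite hJ).2 hwall).and ((eventually_all_finite hE).2 hscat))
  obtain ⟨ε₀, C, hε₀, hC, htraj⟩ := Site.exists_trajectory hDo hDs haD ha
    (fun j => (hφ j).isEmbedding.continuous) hS hSv
    (K := K₁ + K₂ * (1 + M * K₁)) (by positivity)
  -- The parameters satisfy `‖y m‖ ≤ C * ε < ρ`, where the Lipschitz bounds `L₁` at the walls and
  -- `L₂` at the scatterers are valid.
  refine ⟨min ε₀ (ρ / C), (L₁ + L₂) * C, lt_min hε₀ (by positivity), by positivity, ?_⟩
  intro ε hε hεlt κ s hcode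
  have hκJ : ∀ i, κ i ∈ J := fun i => (hEJ _ _ _ (hcode i)).2.1
  obtain ⟨t, σ, hchain⟩ := exists_isChain (φ := φ) (X := fun i => χ (κ (i - 1), κ i, s i))
    (Ω := fun i => ψ (κ i)) (fun i => (hEJ _ _ _ (hcode i)).2.2)
    (fun i => hχ (κ (i - 1), κ i, s i) (hcode i))
    (fun i => hχc (κ (i - 1), κ i, s i) (hcode i)) (fun i => hψ (κ i)) (fun i => hψc (κ i))
  have hσS : ∀ m, σ m ∈ S := hchain.mem_of_forall
    (fun i => Or.inl (mem_image_of_mem edgeSite (hcode i)))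
    (fun i k => Or.inr (mem_iUnion₂.2 ⟨κ i, hκJ i, k, rfl⟩))
  obtain ⟨y, hy, htr, hhyp⟩ := htraj ε hε (hεlt.trans_le (min_le_left _ _)) σ hσS
    hchain.isLimitTriple hchain.isClear_prev hchain.isClear_next
    (hchain.uniformlyInvertible hK₁.le hK₂.le
      (fun m => hM (_, _, _) ⟨hσS _, hσS _, hσS _⟩) (fun i => hH (κ i) (hκJ i))
      (fun i => hQ (κ (i - 1), κ i, s i) (hcode i)))
  have hCε : C * ε < ρ := by
    rw [mul_comm, ← lt_div_iff₀ hC]; exact hεlt.trans_le (min_le_right _ _)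
  have hyρ : ∀ m, dist (y m) 0 < ρ := fun m => by
    rw [dist_zero_right]; exact (hy m).trans_lt hCε
  have hbound : ∀ {L : ℝ}, 0 ≤ L → L ≤ L₁ + L₂ → ∀ m, L * ‖y m‖ ≤ (L₁ + L₂) * C * ε :=
    fun h0 h1 m => by
      rw [mul_assoc]
      exact mul_le_mul h1 (hy m) (norm_nonneg _) (by positivity)
  choose x hx hxs using fun i => (hρ' (hyρ (t i))).2 (κ (i - 1), κ i, s i) (hcode i)
  refine ⟨_, htr, ⟨t, x, fun i => ⟨hchain.starts i, ?_,
    (hxs i).trans (hbound hL₂.le (by linarith) _),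
    fun k => ?_⟩⟩, hhyp⟩
  · beta_reduce
    rw [hx, hchain.start, Site.pos_scatterer (j := (κ i).src) rfl]
  · obtain ⟨h1, h2⟩ := (hρ' (hyρ (t i + 1 + (k : ℕ)))).1 (κ i) (hκJ i) k
    have h3 : t i + (k : ℕ) + 1 = t i + 1 + (k : ℕ) := add_right_comm _ _ _
    simp only [h3, hchain.pos_interior]
    exact ⟨h1, h2.trans (hbound hL₁.le (by linarith) _)⟩
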